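/- Let $k$ be an algebraically closed field of characteristic $0$, $G$ a finite group, $A\subset G$ an abelian subgroup, and $A^*=\mathrm{Hom}(A,k^\times)$, written additively; let $P_\mu=|A|^{-1}\sum_{a\in A}\mu(a)^{-1}a\in k[A]$. **Twists.** A *dynamical twist* is a function $J:A^*\to k[G]\otimes k[G]$ with invertible values commuting with all $a\otimes a$ ($a\in A$), such that $(\varepsilon\otimes\mathrm{id})J(\lambda)=(\mathrm{id}\otimes\varepsilon)J(\lambda)=1$ and $$(\Delta\otimes\mathrm{id})(J(\lambda))\cdot\sum_{\mu}J(\lambda-\mu)\otimes P_\mu=(\mathrm{id}\otimes\Delta)(J(\lambda))\cdot(1\otimes J(\lambda))\qquad(\lambda\in A^*).$$ Twists $J,J'$ are *gauge equivalent* if there is $t:A^*\to k[G]$ with invertible values commuting with $A$ and $\varepsilon(t(\lambda))=1$ such that $J'(\lambda)=\Delta(t(\lambda)^{-1})J(\lambda)\sum_\mu t(\lambda-\mu)\otimes P_\mu t(\lambda)$. **Data.** A *dynamical datum* for $(G,A)$ is a subgroup $K\subset G$ with irreducible projective representations $\pi_\lambda:K\to GL(V_\lambda)$, $\lambda\in A^*$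 (irreducible: $\pi_\lambda(K)$ spans $\mathrm{End}_kV_\lambda$), such that $V_\lambda\otimes V_{\lambda-\mu}^*$ is a linear representation of $K$ and $\mathrm{Ind}_K^G(V_\lambda\otimes V_{\lambda-\mu}^*)\cong\mathrm{Ind}_A^G\mu$ for all $\lambda,\mu$. An *isomorphism* $(K,\{V_\lambda\})\to(K',\{V'_\lambda\})$ is an element $g\in G$ with $gKg^{-1}=K'$ and linear isomorphisms $\phi_\lambda:V_\lambda\to V'_\lambda$ with $\pi'_\lambda(ghg^{-1})\phi_\lambda=\alpha(h)\phi_\lambda\pi_\lambda(h)$ for all $h\in K$, $\lambda \in A^*$, where $\alpha:K\to k^\times$ does not depend on $\lambda$. **The data defined by a twist.** Let $F_\mu[G]$ be the space of functions $f:G\to k$ with $f(ha)=f(h)\mu(a)$; $G$ acts on functions by shifts $(g\circ f)(x)=f(g^{-1}x)$. Let $B_\lambda$ be the $G$-algebra $F_0[G]$ with product $(f_1*_\lambda f_2)(g)=(f_1\otimes f_2)((g\otimes g)J(\lambda))$. The same formula, with $J(\mu)$, makes $F_{\mu-\lambda}[G]$ a $B_\lambda$-$B_\mu$-bimodule. A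 dynamical datum $(K,\{V_\lambda\})$ is *defined by* $J$ if there are minimal two-sided ideals $B_\lambda^i\subset B_\lambda$, $\lambda\in A^*$, corresponding to each other in the sense that $F^i_{\lambda\mu}:=B_\lambda^iF_{\mu-\lambda}[G]B_\mu^i\ne0$ for all $\lambda,\mu$, such that $K$ is the stabilizer of $B^i_\lambda$ in $G$ for every $\lambda$, and structures of a simple $B_\lambda^i$-module on the $V_\lambda$ such that $h\in K$ acts on $B_\lambda^i$ through conjugation by $\pi_\lambda(h)$, and such that for all $\lambda,\mu$ there is an isomorphism of bimodules $F^i_{\lambda\mu}\cong V_\lambda\otimes V_\mu^*$ that is $K$-equivariant, for the action of $K$ on $F_{\lambda\mu}^i$ by shifts and on $V_\lambda\otimes V_\mu^*$ by $\pi_\lambda(h)\otimes(\pi_\mu(h)^{-1})^*$. **Theorem.** The algebras $B_\lambda$ of a dynamical twist are semisimple, and every minimal two-sided ideal of $B_\lambda$ occurs as the ideal $B^i_\lambda$ for some dynamical datum defined by the twist. For every dynamical twist $J$, the dynamical data defined by $J$ form exactly one isomorphism class of dynamical data. Gauge equivalent dynamical twists define the same isomorphism class. -/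

import Mathlib

open scoped TensorProduct

noncomputable section

set_option linter.unusedSectionVars false

namespace DynTwist

universe u v

variable {k : Type u} [Field k] {G : Type v} [Group G]

/-! ### Group algebras and characters -/

/-- The group algebra `k[G]`, with its bialgebra structure (`Δ(g) = g ⊗ g`, `ε(g) = 1`). -/
def GA (k : Type u) [Field k] (G : Type v) [Group G] : Type (max u v) := MonoidAlgebra k G

instance : Ring (GA k G) := inferInstanceAs (Ring (MonoidAlgebra k G))

instance : Bialgebra k (GA k G) := inferInstanceAs (Bialgebra k (MonoidAlgebra k G))

variable (k) in
/-- The group element `g`, as an element of `k[G]`. -/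
def grp (g : G) : GA k G := MonoidAlgebra.single g 1

/-- The character group `A^* = Hom(A, kˣ)`, written additively. -/
def Chars (k : Type u) [Field k] {G : Type v} [Group G] (A : Subgroup G) : Type (max u v) :=
  Additive (A →* kˣ)

instance (A : Subgroup G) : AddCommGroup (Chars k A) :=
  inferInstanceAs (AddCommGroup (Additive (A →* kˣ)))

instance [Finite G] (A : Subgroup G) : Finite (Chars k A) :=
  inferInstanceAs (Finite (A →* kˣ))

/-- The homomorphism `A → kˣ` underlying an element of `A^*`. -/
def Chars.hom {A : Subgroup G} (l : Chars k A) : A →* kˣ := Additive.toMul l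

lemma Chars.hom_ext {A : Subgroup G} {l m : Chars k A} (h : ∀ a, l.hom a = m.hom a) : l = m :=
  MonoidHom.ext (f := l.hom) (g := m.hom) h

@[simp] lemma Chars.hom_add {A : Subgroup G} (l m : Chars k A) (a : A) :
    (l + m).hom a = l.hom a * m.hom a := rfl

@[simp] lemma Chars.hom_sub {A : Subgroup G} (l m : Chars k A) (a : A) :
    (l - m).hom a = l.hom a / m.hom a := rfl

@[simp] lemma Chars.hom_zero {A : Subgroup G} (a : A) : (0 : Chars k A).hom a = 1 := rfl

/-! ### Dynamical twists in `k[G]` -/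

/-- The minimal idempotent `P_μ = |A|⁻¹ ∑ₐ μ(a)⁻¹ a` of `k[A]` (viewed inside `k[G]`) attached to
the character `μ` of the finite group `A`. -/
def charIdem {A : Subgroup G} (m : Chars k A) : GA k G :=
  (Nat.card A : k)⁻¹ • ∑ᶠ a : A, (((m.hom a)⁻¹ : kˣ) : k) • grp k (a : G)

/-- A dynamical twist `J : A^* → k[G] ⊗ k[G]`. The element `J(λ - h⁽³⁾)` of
`k[G] ⊗ k[G] ⊗ k[A]` is `∑_μ J(λ - μ) ⊗ P_μ`. -/
structure DynamicalTwist (k : Type u) [Field k] {G : Type v} [Group G] (A : Subgroup G) where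
  /-- The function `λ ↦ J(λ)`. -/
  toFun : (Chars k A) → GA k G ⊗[k] GA k G
  /-- Zero weight: `J(λ)` commutes with `Δ(a) = a ⊗ a`. -/
  zero_weight : ∀ (l : Chars k A) (a : A),
    (grp k (a : G) ⊗ₜ[k] grp k (a : G)) * toFun l = toFun l * (grp k (a : G) ⊗ₜ[k] grp k (a : G))
  /-- Every value is invertible. -/
  isUnit : ∀ l, IsUnit (toFun l)
  /-- `J^{12,3}(λ) J^{12}(λ - h⁽³⁾) = J^{1,23}(λ) J^{23}(λ)`. -/
  dynamical : ∀ l : Chars k A,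
    Algebra.TensorProduct.assoc k k k (GA k G) (GA k G) (GA k G)
        (TensorProduct.map Coalgebra.comul LinearMap.id (toFun l) *
          ∑ᶠ m : Chars k A, toFun (l - m) ⊗ₜ[k] charIdem m)
      = TensorProduct.map LinearMap.id Coalgebra.comul (toFun l) *
          ((1 : GA k G) ⊗ₜ[k] toFun l)
  /-- `(ε ⊗ id) J(λ) = 1`. -/
  counit_left : ∀ l,
    TensorProduct.lid k (GA k G)
      (TensorProduct.map Coalgebra.counit LinearMap.id (toFun l)) = 1
  /-- `(id ⊗ ε) J(λ) = 1`. -/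
  counit_right : ∀ l,
    TensorProduct.rid k (GA k G)
      (TensorProduct.map LinearMap.id Coalgebra.counit (toFun l)) = 1

/-- `J` and `J'` are gauge equivalent: there is a zero weight function `t : A^* → k[G]` with
invertible values and `ε(t(λ)) = 1` such that
`J'(λ) = Δ(t(λ)⁻¹) J(λ) (t(λ - h⁽²⁾) ⊗ t(λ))`, where
`t(λ - h⁽²⁾) ⊗ t(λ) = ∑_μ t(λ - μ) ⊗ P_μ t(λ)`. -/
def GaugeEquivalent {A : Subgroup G} (J J' : DynamicalTwist k A) : Prop :=
  ∃ t : (Chars k A) → (GA k G)ˣ,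
    (∀ l (a : A), grp k (a : G) * (t l : GA k G) = t l * grp k (a : G)) ∧
    (∀ l, Coalgebra.counit (R := k) (t l : GA k G) = 1) ∧
    ∀ l, J'.toFun l = Coalgebra.comul (R := k) (((t l)⁻¹ : (GA k G)ˣ) :
        GA k G) * J.toFun l *
      ∑ᶠ m : Chars k A, (t (l - m) : GA k G) ⊗ₜ[k]
        (charIdem m * (t l : GA k G))

/-! ### Functions on `G`, the algebras `B_λ` and the bimodules `F_μ[G]` -/

/-- The linear extension of a function on `G` to `k[G]`. -/
def linExt (f : G → k) : GA k G →ₗ[k] k :=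
  Finsupp.linearCombination k f ∘ₗ (MonoidAlgebra.coeffLinearEquiv k).toLinearMap

/-- `f₁ ⊗ f₂` as a linear functional on `k[G] ⊗ k[G]`. -/
def pair (f₁ f₂ : G → k) : GA k G ⊗[k] GA k G →ₗ[k] k :=
  LinearMap.mul' k k ∘ₗ TensorProduct.map (linExt f₁) (linExt f₂)

/-- The operation `(f₁, f₂) ↦ (g ↦ (f₁ ⊗ f₂)((g ⊗ g) x))` on functions on `G`. -/
def tw (x : GA k G ⊗[k] GA k G) (f₁ f₂ : G → k) : G → k :=
  fun g => pair f₁ f₂ ((grp k g ⊗ₜ[k] grp k g) * x)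

/-- The action of `g ∈ G` on functions by shifts, `(g ∘ f)(x) = f(g⁻¹ x)`. -/
def shift (g : G) (f : G → k) : G → k := fun x => f (g⁻¹ * x)

/-- `F_μ[G]`, the functions with `f(h a) = f(h) μ(a)`. -/
def weightFun {A : Subgroup G} (m : Chars k A) : Submodule k (G → k) where
  carrier := {f | ∀ (h : G) (a : A), f (h * a) = f h * (m.hom a : k)}
  add_mem' := by
    intro f f' hf hf' h a
    simp only [Pi.add_apply, hf h a, hf' h a, add_mul]
  zero_mem' := by intro h a; simp
  smul_mem' := by
    intro c f hf h a
    simp only [Pi.smul_apply, hf h a, smul_eq_mul, mul_assoc]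

@[simp] lemma linExt_grp (f : G → k) (g : G) : linExt f (grp k g) = f g := by
  change Finsupp.linearCombination k f (MonoidAlgebra.coeff (MonoidAlgebra.single g (1 : k))) = _
  simp

lemma grp_mul (g h : G) : grp k g * grp k h = grp k (g * h) := by
  have h1 : (MonoidAlgebra.single g (1 : k) * MonoidAlgebra.single h (1 : k) : MonoidAlgebra k G) =
      MonoidAlgebra.single (g * h) (1 : k) := by
    simp [MonoidAlgebra.single_mul_single]
  exact h1

lemma grp_one : grp k (1 : G) = 1 := rfl

/-- Linear maps out of `k[G]` are determined on group elements. -/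
lemma hom_ext_grp {M : Type*} [AddCommMonoid M] [Module k M]
    {φ ψ : GA k G →ₗ[k] M} (h : ∀ g, φ (grp k g) = ψ (grp k g)) : φ = ψ :=
  MonoidAlgebra.lhom_ext' fun g => LinearMap.ext_ring (h g)

@[simp] lemma pair_tmul (f₁ f₂ : G → k) (x y : GA k G) :
    pair f₁ f₂ (x ⊗ₜ[k] y) = linExt f₁ x * linExt f₂ y := by simp [pair]

lemma comul_grp (g : G) :
    Coalgebra.comul (R := k) (grp k g) = grp k g ⊗ₜ[k] grp k g := by
  change Coalgebra.comul (R := k) (MonoidAlgebra.single g (1 : k) : MonoidAlgebra k G) =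
    MonoidAlgebra.single g (1 : k) ⊗ₜ[k] MonoidAlgebra.single g (1 : k)
  simp

lemma counit_grp (g : G) : Coalgebra.counit (R := k) (grp k g) = 1 := by
  change Coalgebra.counit (R := k) (MonoidAlgebra.single g (1 : k) : MonoidAlgebra k G) = 1
  simp

lemma linExt_tw (x : GA k G ⊗[k] GA k G) (f₁ f₂ : G → k)
    (y : GA k G) :
    linExt (tw x f₁ f₂) y = pair f₁ f₂ (Coalgebra.comul (R := k) y * x) := by
  have : linExt (tw x f₁ f₂) =
      pair f₁ f₂ ∘ₗ LinearMap.mulRight k x ∘ₗ Coalgebra.comul (R := k) := by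
    apply hom_ext_grp
    intro g
    simp [comul_grp, tw]
  rw [this]; rfl

lemma linExt_add (f f' : G → k) : linExt (f + f') = linExt f + linExt f' :=
  hom_ext_grp (by intro g; simp)

lemma linExt_smul (c : k) (f : G → k) : linExt (c • f) = c • linExt f :=
  hom_ext_grp (by intro g; simp)

lemma pair_add_left (f f' h : G → k) : pair (f + f') h = pair f h + pair f' h := by
  simp [pair, linExt_add, TensorProduct.map_add_left, LinearMap.comp_add]

lemma pair_add_right (f h h' : G → k) : pair f (h + h') = pair f h + pair f h' := by
  simp [pair, linExt_add, TensorProduct.map_add_right, LinearMap.comp_add]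

lemma pair_smul_left (c : k) (f h : G → k) : pair (c • f) h = c • pair f h := by
  simp [pair, linExt_smul, TensorProduct.map_smul_left, LinearMap.comp_smul]

lemma pair_smul_right (c : k) (f h : G → k) : pair f (c • h) = c • pair f h := by
  simp [pair, linExt_smul, TensorProduct.map_smul_right, LinearMap.comp_smul]

lemma tw_shift (x : GA k G ⊗[k] GA k G) (g : G) (f₁ f₂ : G → k) :
    tw x (shift g f₁) (shift g f₂) = shift g (tw x f₁ f₂) := by
  have e : ∀ f : G → k, linExt (shift g f) = linExt f ∘ₗ LinearMap.mulLeft k (grp k g⁻¹) := by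
    intro f
    apply hom_ext_grp
    intro h
    simp [grp_mul, shift]
  have p : pair (shift g f₁) (shift g f₂) =
      pair f₁ f₂ ∘ₗ LinearMap.mulLeft k (grp k g⁻¹ ⊗ₜ[k] grp k g⁻¹) := by
    apply TensorProduct.ext'
    intro a b
    simp [e]
  funext h
  simp only [tw, shift, p, LinearMap.comp_apply, LinearMap.mulLeft_apply, ← mul_assoc,
    Algebra.TensorProduct.tmul_mul_tmul, grp_mul]

section Assoc

variable [Finite G] [CharZero k] {A : Subgroup G}

lemma linExt_mul_charIdem {m n : Chars k A} {f : G → k} (hf : f ∈ weightFun m)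
    (y : GA k G) [Decidable (m = n)] :
    linExt f (y * charIdem n) = if m = n then linExt f y else 0 := by
  classical
  have key : linExt f ∘ₗ LinearMap.mulRight k (charIdem n) = if m = n then linExt f else 0 := by
    apply hom_ext_grp
    intro g
    have := Fintype.ofFinite A
    have h1 : linExt f (grp k g * charIdem n) =
        f g * ((Nat.card A : k)⁻¹ * ∑ a : A, (((m - n).hom a : kˣ) : k)) := by
      simp only [charIdem, finsum_eq_sum_of_fintype, mul_smul_comm, map_smul, Finset.mul_sum,
        map_sum, grp_mul, linExt_grp, smul_eq_mul]
      refine Finset.sum_congr rfl fun a _ => ?_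
      rw [hf g a]
      simp only [Chars.hom_sub, div_eq_mul_inv, Units.val_mul]
      ring
    simp only [LinearMap.comp_apply, LinearMap.mulRight_apply, h1]
    split_ifs with hmn
    · subst hmn
      have : (Nat.card A : k) ≠ 0 := by exact_mod_cast Nat.card_pos.ne'
      simp [Nat.card_eq_fintype_card] at this ⊢
    · have h0 := sum_hom_units_eq_zero ((Units.coeHom k).comp (m - n).hom) (by
        intro h
        apply hmn
        refine sub_eq_zero.mp (Chars.hom_ext fun a => Units.ext ?_)
        simpa using DFunLike.congr_fun h a)
      have h0' : ∑ a : A, (((m - n).hom a : kˣ) : k) = 0 := h0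
      rw [h0']; simp
  have := DFunLike.congr_fun key y
  simp only [LinearMap.comp_apply, LinearMap.mulRight_apply] at this
  rw [this]
  split_ifs <;> rfl

/-- The functional `f₁ ⊗ f₂ ⊗ f₃` on `k[G] ⊗ k[G] ⊗ k[G]`. -/
def trip (f₁ f₂ f₃ : G → k) :
    GA k G ⊗[k] (GA k G ⊗[k] GA k G) →ₗ[k] k :=
  LinearMap.mul' k k ∘ₗ TensorProduct.map (linExt f₁) (pair f₂ f₃)

lemma pair_tw_right (x z : GA k G ⊗[k] GA k G) (f₁ f₂ f₃ : G → k) :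
    pair f₁ (tw x f₂ f₃) z =
      trip f₁ f₂ f₃ (TensorProduct.map LinearMap.id Coalgebra.comul z * (1 ⊗ₜ[k] x)) := by
  induction z with
  | zero => simp
  | add a b ha hb => simp only [map_add, add_mul, ha, hb]
  | tmul a b => simp [trip, linExt_tw]

lemma pair_tw_left (x z : GA k G ⊗[k] GA k G) (f₁ f₂ f₃ : G → k) :
    pair (tw x f₁ f₂) f₃ z =
      trip f₁ f₂ f₃ (Algebra.TensorProduct.assoc k k k _ _ _
        (TensorProduct.map Coalgebra.comul LinearMap.id z * (x ⊗ₜ[k] 1))) := by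
  have h : ∀ (p : GA k G ⊗[k] GA k G) (q : GA k G),
      trip f₁ f₂ f₃ (Algebra.TensorProduct.assoc k k k _ _ _ (p ⊗ₜ[k] q)) =
        pair f₁ f₂ p * linExt f₃ q := by
    intro p q
    induction p with
    | zero => simp
    | add a b ha hb => simp only [TensorProduct.add_tmul, map_add, ha, hb, add_mul]
    | tmul a b => simp [trip, mul_assoc]
  induction z with
  | zero => simp
  | add a b ha hb => simp only [map_add, add_mul, ha, hb]
  | tmul a b => simp [h, linExt_tw]

lemma trip_assoc_charIdem {m n : Chars k A} {f₃ : G → k} (hf : f₃ ∈ weightFun m) (f₁ f₂ : G → k)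
    (w : (GA k G ⊗[k] GA k G) ⊗[k] GA k G)
    (y : GA k G ⊗[k] GA k G) [Decidable (m = n)] :
    trip f₁ f₂ f₃ (Algebra.TensorProduct.assoc k k k _ _ _ (w * (y ⊗ₜ[k] charIdem n))) =
      if m = n then trip f₁ f₂ f₃ (Algebra.TensorProduct.assoc k k k _ _ _ (w * (y ⊗ₜ[k] 1)))
      else 0 := by
  have h : ∀ (p : GA k G ⊗[k] GA k G) (q : GA k G),
      trip f₁ f₂ f₃ (Algebra.TensorProduct.assoc k k k _ _ _ (p ⊗ₜ[k] q)) =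
        pair f₁ f₂ p * linExt f₃ q := by
    intro p q
    induction p with
    | zero => simp
    | add a b ha hb => simp only [TensorProduct.add_tmul, map_add, ha, hb, add_mul]
    | tmul a b => simp [trip, mul_assoc]
  induction w with
  | zero => simp
  | add a b ha hb =>
    simp only [map_add, add_mul, ha, hb]
    split_ifs <;> simp
  | tmul p q =>
    simp only [Algebra.TensorProduct.tmul_mul_tmul, h, linExt_mul_charIdem hf, mul_one]
    split_ifs <;> simp

/-- Associativity: for `f₃ ∈ F_μ[G]`, the operation for `J(λ)` satisfies
`(f₁ *_{λ-μ} f₂) ∘ f₃ = f₁ ∘ (f₂ ∘ f₃)`. -/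
lemma tw_assoc (J : DynamicalTwist k A) (l m : Chars k A) (f₁ f₂ : G → k) {f₃ : G → k}
    (hf : f₃ ∈ weightFun m) :
    tw (J.toFun l) (tw (J.toFun (l - m)) f₁ f₂) f₃ =
      tw (J.toFun l) f₁ (tw (J.toFun l) f₂ f₃) := by
  classical
  have := Fintype.ofFinite (Chars k A)
  funext g
  have hL : TensorProduct.map (Coalgebra.comul (R := k)) LinearMap.id
      ((grp k g ⊗ₜ[k] grp k g) * J.toFun l) =
      ((grp k g ⊗ₜ[k] grp k g) ⊗ₜ[k] grp k g) *
        TensorProduct.map (Coalgebra.comul (R := k)) LinearMap.id (J.toFun l) := by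
    generalize J.toFun l = x
    induction x with
    | zero => simp
    | add a b ha hb => simp only [mul_add, map_add, ha, hb]
    | tmul a b => simp [comul_grp]
  have hR : TensorProduct.map LinearMap.id (Coalgebra.comul (R := k))
      ((grp k g ⊗ₜ[k] grp k g) * J.toFun l) =
      (grp k g ⊗ₜ[k] (grp k g ⊗ₜ[k] grp k g)) *
        TensorProduct.map LinearMap.id (Coalgebra.comul (R := k)) (J.toFun l) := by
    generalize J.toFun l = x
    induction x with
    | zero => simp
    | add a b ha hb => simp only [mul_add, map_add, ha, hb]
    | tmul a b => simp [comul_grp]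
  have hd := congrArg (fun z => trip f₁ f₂ f₃ ((grp k g ⊗ₜ[k] (grp k g ⊗ₜ[k] grp k g)) * z))
    (J.dynamical l)
  have hassoc : (grp k g ⊗ₜ[k] (grp k g ⊗ₜ[k] grp k g)) =
      Algebra.TensorProduct.assoc k k k _ _ _ ((grp k g ⊗ₜ[k] grp k g) ⊗ₜ[k] grp k g) := by
    simp
  simp only [← mul_assoc, ← hR] at hd
  rw [← pair_tw_right, hassoc, ← map_mul, ← mul_assoc, ← hL, finsum_eq_sum_of_fintype,
    Finset.mul_sum, map_sum, map_sum] at hd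
  simp only [trip_assoc_charIdem hf, Finset.sum_ite_eq, Finset.mem_univ, if_true,
    ← pair_tw_left] at hd
  exact hd

end Assoc

section Algebras

variable {A : Subgroup G}

lemma tw_mem (J : DynamicalTwist k A) (l : Chars k A) {m n : Chars k A} {f f' : G → k}
    (hf : f ∈ weightFun m) (hf' : f' ∈ weightFun n) :
    tw (J.toFun l) f f' ∈ weightFun (m + n) := by
  intro g a
  have key : pair f f' ∘ₗ LinearMap.mulRight k (grp k (a : G) ⊗ₜ[k] grp k (a : G)) =
      (((m + n).hom a : kˣ) : k) • pair f f' := by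
    have e : ∀ {m : Chars k A} {f : G → k}, f ∈ weightFun m →
        linExt f ∘ₗ LinearMap.mulRight k (grp k (a : G)) = ((m.hom a : kˣ) : k) • linExt f := by
      intro m f hf
      apply hom_ext_grp
      intro h
      simp [grp_mul, hf h a, mul_comm]
    apply TensorProduct.ext'
    intro x y
    have h1 := DFunLike.congr_fun (e hf) x
    have h2 := DFunLike.congr_fun (e hf') y
    simp only [LinearMap.comp_apply, LinearMap.mulRight_apply, LinearMap.smul_apply,
      smul_eq_mul] at h1 h2
    simp only [LinearMap.comp_apply, LinearMap.mulRight_apply,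
      Algebra.TensorProduct.tmul_mul_tmul, pair_tmul, h1, h2, LinearMap.smul_apply, smul_eq_mul,
      Chars.hom_add, Units.val_mul]
    ring
  have := DFunLike.congr_fun key ((grp k g ⊗ₜ[k] grp k g) * J.toFun l)
  simp only [LinearMap.comp_apply, LinearMap.mulRight_apply, LinearMap.smul_apply,
    smul_eq_mul, mul_assoc, ← J.zero_weight] at this
  simp only [tw]
  rw [← grp_mul, ← Algebra.TensorProduct.tmul_mul_tmul, mul_assoc, this, mul_comm]

lemma one_tw (J : DynamicalTwist k A) (l : Chars k A) (f : G → k) :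
    tw (J.toFun l) 1 f = f := by
  funext g
  have h : ∀ x : GA k G ⊗[k] GA k G,
      pair 1 f ((grp k g ⊗ₜ[k] grp k g) * x) = linExt f (grp k g *
        TensorProduct.lid k _ (TensorProduct.map Coalgebra.counit LinearMap.id x)) := by
    intro x
    have e : linExt (1 : G → k) = Coalgebra.counit :=
      hom_ext_grp (by intro g; simp [counit_grp])
    have e' : ∀ y, linExt (1 : G → k) (grp k g * y) = Coalgebra.counit y := by
      intro y
      rw [e]
      exact (Bialgebra.counit_mul _ _).trans (by simp [counit_grp])
    induction x with
    | zero => simp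
    | add a b ha hb => simp only [mul_add, map_add, ha, hb]
    | tmul a b => simp [e']
  rw [tw, h, J.counit_left]
  simp

lemma tw_one (J : DynamicalTwist k A) (l : Chars k A) (f : G → k) :
    tw (J.toFun l) f 1 = f := by
  funext g
  have h : ∀ x : GA k G ⊗[k] GA k G,
      pair f 1 ((grp k g ⊗ₜ[k] grp k g) * x) = linExt f (grp k g *
        TensorProduct.rid k _ (TensorProduct.map LinearMap.id Coalgebra.counit x)) := by
    intro x
    have e : linExt (1 : G → k) = Coalgebra.counit :=
      hom_ext_grp (by intro g; simp [counit_grp])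
    have e' : ∀ y, linExt (1 : G → k) (grp k g * y) = Coalgebra.counit y := by
      intro y
      rw [e]
      exact (Bialgebra.counit_mul _ _).trans (by simp [counit_grp])
    induction x with
    | zero => simp
    | add a b ha hb => simp only [mul_add, map_add, ha, hb]
    | tmul a b => simp [e', mul_comm]
  rw [tw, h, J.counit_right]
  simp

/-- The algebra `B_λ`: the functions on `G` invariant under right translations by `A`, i.e.
`F_0[G]`, with the multiplication `(f₁ *_λ f₂)(g) = (f₁ ⊗ f₂)((g ⊗ g) J(λ))`. -/
def B (_J : DynamicalTwist k A) (_l : Chars k A) : Type (max u v) :=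
  (weightFun (0 : Chars k A) : Submodule k (G → k))

variable (J : DynamicalTwist k A) (l : Chars k A)

instance : AddCommGroup (B J l) :=
  inferInstanceAs (AddCommGroup (weightFun (0 : Chars k A) : Submodule k (G → k)))

instance : Module k (B J l) :=
  inferInstanceAs (Module k (weightFun (0 : Chars k A) : Submodule k (G → k)))

/-- The function on `G` underlying an element of `B_λ`. -/
def B.val {J : DynamicalTwist k A} {l : Chars k A} : B J l →ₗ[k] (G → k) :=
  (weightFun (0 : Chars k A) : Submodule k (G → k)).subtype

variable {J l}

lemma B.val_injective : Function.Injective (B.val : B J l → G → k) :=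
  Subtype.val_injective

lemma B.val_mem (b : B J l) : B.val b ∈ (weightFun (0 : Chars k A) : Submodule k (G → k)) := b.2

instance : Mul (B J l) :=
  ⟨fun b b' => ⟨tw (J.toFun l) (B.val b) (B.val b'), by
    simpa using tw_mem J l (B.val_mem b) (B.val_mem b')⟩⟩

instance : One (B J l) := ⟨⟨(1 : G → k), by intro h a; simp⟩⟩

lemma B.val_mul (b b' : B J l) :
    B.val (b * b') = tw (J.toFun l) (B.val b) (B.val b') := rfl

lemma B.val_one : B.val (1 : B J l) = 1 := rfl

variable [Finite G] [CharZero k]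

instance : Ring (B J l) :=
  { (inferInstance : AddCommGroup (B J l)), (inferInstance : Mul (B J l)),
    (inferInstance : One (B J l)) with
    left_distrib := by
      intro a b c
      apply B.val_injective
      funext g
      simp [B.val_mul, tw, pair_add_right]
    right_distrib := by
      intro a b c
      apply B.val_injective
      funext g
      simp [B.val_mul, tw, pair_add_left]
    zero_mul := by
      intro a
      apply B.val_injective
      funext g
      have := pair_smul_left (0 : k) 0 (B.val a)
      rw [zero_smul, zero_smul] at this
      simp [B.val_mul, tw, this]
    mul_zero := by
      intro a
      apply B.val_injective
      funext g
      have := pair_smul_right (0 : k) (B.val a) 0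
      rw [zero_smul, zero_smul] at this
      simp [B.val_mul, tw, this]
    mul_assoc := by
      intro a b c
      apply B.val_injective
      have := tw_assoc J l 0 (B.val a) (B.val b) (B.val_mem c)
      rw [sub_zero] at this
      simpa only [B.val_mul] using this
    one_mul := by
      intro a
      apply B.val_injective
      rw [B.val_mul, B.val_one, one_tw]
    mul_one := by
      intro a
      apply B.val_injective
      rw [B.val_mul, B.val_one, tw_one] }

instance : Algebra k (B J l) :=
  Algebra.ofModule
    (by
      intro r x y
      apply B.val_injective
      funext g
      simp [B.val_mul, tw, pair_smul_left])
    (by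
      intro r x y
      apply B.val_injective
      funext g
      simp [B.val_mul, tw, pair_smul_right])

/-- `B_λ` is a `G`-algebra: `G` acts by shifts `(h ∘ f)(g) = f(h⁻¹ g)`. -/
instance : MulSemiringAction G (B J l) where
  smul g b := ⟨shift g (B.val b), by
    intro h a
    simpa [shift, mul_assoc] using B.val_mem b (g⁻¹ * h) a⟩
  one_smul b := by
    apply B.val_injective
    funext x
    change B.val b (1⁻¹ * x) = B.val b x
    simp
  mul_smul g h b := by
    apply B.val_injective
    funext x
    change B.val b ((g * h)⁻¹ * x) = B.val b (h⁻¹ * (g⁻¹ * x))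
    rw [mul_inv_rev, mul_assoc]
  smul_zero g := rfl
  smul_add g b b' := rfl
  smul_one g := rfl
  smul_mul g b b' := by
    apply B.val_injective
    exact (tw_shift (J.toFun l) g (B.val b) (B.val b')).symm

lemma B.val_smul (g : G) (b : B J l) : B.val (g • b) = shift g (B.val b) := rfl

end Algebras

/-! ### Projective representations and dynamical data -/

section Data

variable {H : Type*} [Group H] {V : Type*} [AddCommGroup V] [Module k V]

/-- `π : H → GL(V)` is a projective representation on the nonzero space `V`:
`π(g) π(h) = c(g, h) π(g h)` for a `2`-cocycle `c` of `H` with values in `kˣ`. -/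
def IsProjectiveRep (π : H → V ≃ₗ[k] V) : Prop :=
  Nontrivial V ∧ ∃ c : H → H → kˣ,
    (∀ g h j, c g h * c (g * h) j = c h j * c g (h * j)) ∧
    ∀ g h v, π g (π h v) = (c g h : k) • π (g * h) v

/-- `π` is irreducible: `π(H)` spans `End_k V`. -/
def IsIrreducibleProj (π : H → V ≃ₗ[k] V) : Prop :=
  Submodule.span k (Set.range fun g => (π g : V →ₗ[k] V)) = ⊤

/-- For `p ∈ GL(V)` and `q ∈ GL(W)`, the operator `p ⊗ (q⁻¹)^*` on `V ⊗ W^*`. -/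
def tensorDual {W : Type*} [AddCommGroup W] [Module k W] (p : V ≃ₗ[k] V) (q : W ≃ₗ[k] W) :
    V ⊗[k] Module.Dual k W →ₗ[k] V ⊗[k] Module.Dual k W :=
  TensorProduct.map (p : V →ₗ[k] V) (q.symm : W →ₗ[k] W).dualMap

/-- The one-dimensional representation of `A` given by the character `μ`. -/
def charRep {A : Subgroup G} (m : Chars k A) : Representation k A k :=
  (Algebra.lmul k k).toMonoidHom.comp ((Units.coeHom k).comp m.hom)

/-- A dynamical datum for `(G, A)`: a subgroup `K` of `G` and irreducible projective
representations `π_λ : K → GL(V_λ)`, `λ ∈ A^*`, such that every `V_λ ⊗ V_{λ-μ}^*` is a linear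
representation of `K` and `Ind_K^G (V_λ ⊗ V_{λ-μ}^*) ≅ Ind_A^G μ`. -/
structure DynamicalDatum (k : Type u) [Field k] {G : Type v} [Group G] (A : Subgroup G) where
  /-- The subgroup `K`. -/
  K : Subgroup G
  /-- The spaces `V_λ`. -/
  V : Chars k A → Type u
  [addCommGroup : ∀ l, AddCommGroup (V l)]
  [module : ∀ l, Module k (V l)]
  /-- The maps `π_λ : K → GL(V_λ)`. -/
  π : ∀ l, K → V l ≃ₗ[k] V l
  projective : ∀ l, IsProjectiveRep (π l)
  irreducible : ∀ l, IsIrreducibleProj (π l)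
  coherent : ∀ l m : Chars k A,
    ∃ σ : Representation k K (V l ⊗[k] Module.Dual k (V (l - m))),
      (∀ h, σ h = tensorDual (π l h) (π (l - m) h)) ∧
      Nonempty ((Representation.ind K.subtype σ).Equiv
        (Representation.ind A.subtype (charRep m)))

attribute [instance] DynamicalDatum.addCommGroup DynamicalDatum.module

variable {A : Subgroup G}

/-- An isomorphism of dynamical data: an element `g` with `g K g⁻¹ = K'` and linear isomorphisms
`φ_λ : V_λ → V'_λ` with `π'_λ(g h g⁻¹) φ_λ = α(h) φ_λ π_λ(h)` for `h ∈ K`, where the multiplier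
function `α : K → kˣ` does not depend on `λ`. -/
structure DynamicalDatum.Iso (D D' : DynamicalDatum k A) where
  g : G
  map_conj : D.K.map (MulAut.conj g).toMonoidHom = D'.K
  φ : ∀ l, D.V l ≃ₗ[k] D'.V l
  α : D.K → kˣ
  comm : ∀ l (h : D.K) (h' : D'.K), (h' : G) = g * h * g⁻¹ →
    ∀ v, D'.π l h' (φ l v) = (α h : k) • φ l (D.π l h v)

lemma DynamicalDatum.Iso.mem {D D' : DynamicalDatum k A} (e : D.Iso D') (h : G) :
    e.g * h * e.g⁻¹ ∈ D'.K ↔ h ∈ D.K := by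
  rw [← e.map_conj]
  constructor
  · rintro ⟨x, hx, hxe⟩
    have : x = h := by simpa using hxe
    exact this ▸ hx
  · intro hh
    exact ⟨h, hh, by simp⟩

instance DynamicalDatum.setoid (k : Type u) [Field k] {G : Type v} [Group G] (A : Subgroup G) :
    Setoid (DynamicalDatum k A) where
  r D D' := Nonempty (D.Iso D')
  iseqv :=
    { refl := fun D => ⟨{
        g := 1
        map_conj := by
          ext x
          simp
        φ := fun l => LinearEquiv.refl k _
        α := fun _ => 1
        comm := by
          intro l h h' hh v
          have : h' = h := Subtype.ext (by simpa using hh)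
          subst this
          simp }⟩
      symm := by
        rintro D D' ⟨e⟩
        have key : ∀ h' : D'.K, e.g⁻¹ * h' * e.g ∈ D.K := by
          intro h'
          rw [← e.mem]
          simp [mul_assoc]
        refine ⟨{
          g := e.g⁻¹
          map_conj := ?_
          φ := fun l => (e.φ l).symm
          α := fun h' => (e.α ⟨e.g⁻¹ * h' * e.g, key h'⟩)⁻¹
          comm := ?_ }⟩
        · rw [← e.map_conj, Subgroup.map_map]
          ext x
          simp [mul_assoc]
        · intro l h' h hh v
          have hh' : h = ⟨e.g⁻¹ * h' * e.g, key h'⟩ := Subtype.ext (by simpa using hh)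
          have := e.comm l h h' (by rw [hh]; simp [mul_assoc]) ((e.φ l).symm v)
          rw [LinearEquiv.apply_symm_apply] at this
          rw [this, ← hh', map_smul, LinearEquiv.symm_apply_apply, smul_smul]
          simp
      trans := by
        rintro D D' D'' ⟨e⟩ ⟨e'⟩
        have key : ∀ h : D.K, e.g * h * e.g⁻¹ ∈ D'.K := fun h => (e.mem h).2 h.2
        refine ⟨{
          g := e'.g * e.g
          map_conj := ?_
          φ := fun l => (e.φ l).trans (e'.φ l)
          α := fun h => e.α h * e'.α ⟨e.g * h * e.g⁻¹, key h⟩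
          comm := ?_ }⟩
        · rw [← e'.map_conj, ← e.map_conj, Subgroup.map_map]
          ext x
          simp
        · intro l h h'' hh v
          have h1 := e'.comm l ⟨e.g * h * e.g⁻¹, key h⟩ h'' (by rw [hh]; simp [mul_assoc])
            (e.φ l v)
          have h2 := e.comm l h ⟨e.g * h * e.g⁻¹, key h⟩ rfl v
          simp only [LinearEquiv.trans_apply]
          rw [h1, h2, map_smul, smul_smul, Units.val_mul, mul_comm] }

/-- The isomorphism classes of dynamical data for `(G, A)`. -/
abbrev DynamicalDatum.IsoClass (k : Type u) [Field k] {G : Type v} [Group G] (A : Subgroup G) :=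
  Quotient (DynamicalDatum.setoid k A)

end Data

/-! ### The dynamical data defined by a dynamical twist -/

section Construction

open scoped Pointwise

variable [Finite G] [CharZero k] {A : Subgroup G}

/-- The bimodule `F_{λμ} = I F_{μ-λ}[G] I'` attached to two-sided ideals `I` of `B_λ` and `I'` of
`B_μ`: the span of the functions `b ∘ f ∘ b'` with `b ∈ I`, `f ∈ F_{μ-λ}[G]`, `b' ∈ I'`. Here
`F_{μ-λ}[G]` is a `B_λ`-`B_μ`-bimodule, both actions being given by `J(μ)`. -/
def blockBimodule (J : DynamicalTwist k A) {l m : Chars k A} (I : TwoSidedIdeal (B J l))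
    (I' : TwoSidedIdeal (B J m)) : Submodule k (G → k) :=
  Submodule.span k {x | ∃ b ∈ I, ∃ f ∈ (weightFun (m - l) : Submodule k (G → k)), ∃ b' ∈ I',
    x = tw (J.toFun m) (tw (J.toFun m) (B.val b) f) (B.val b')}

/-- The data and choices by which a dynamical twist `J` gives rise to the dynamical datum `D`. -/
structure Realization (J : DynamicalTwist k A) (D : DynamicalDatum k A) where
  /-- The minimal two-sided ideals `B_λ^i` of the algebras `B_λ`. -/
  ideal : ∀ l, TwoSidedIdeal (B J l)
  minimal : ∀ l, IsAtom (ideal l)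
  /-- The ideals `B_λ^i` correspond to the same point `i` under the identifications of the sets of
  minimal ideals of the `B_λ` given by the decomposition of the bimodules `F_{μ-λ}[G]`. -/
  corresponding : ∀ l m, blockBimodule J (ideal l) (ideal m) ≠ ⊥
  /-- `K` is the stabilizer of the point `i`. -/
  stabilizer_eq : ∀ l, MulAction.stabilizer G (ideal l : Set (B J l)) = D.K
  /-- The action of `B_λ` on `V_λ`, through which `V_λ` is a simple module over `B_λ^i`. -/
  ρ : ∀ l, B J l →ₐ[k] Module.End k (D.V l)
  ideal_acts : ∀ l, ∃ b ∈ ideal l, ρ l b ≠ 0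
  simple : ∀ l (W : Submodule k (D.V l)),
    (∀ b ∈ ideal l, ∀ w ∈ W, ρ l b w ∈ W) → W = ⊥ ∨ W = ⊤
  /-- `h ∈ K` acts on `B_λ^i` (which acts faithfully on `V_λ`) by conjugation by `π_λ(h)`. -/
  conj : ∀ l (h : D.K), ∀ b ∈ ideal l, ∀ v,
    ρ l ((h : G) • b) (D.π l h v) = D.π l h (ρ l b v)
  /-- The inverse of an isomorphism `F_{λμ}^i = B_λ^i F_{μ-λ}[G] B_μ^i ≅ V_λ ⊗ V_μ^*`. -/
  iso : ∀ l m, D.V l ⊗[k] Module.Dual k (D.V m) →ₗ[k] (G → k)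
  iso_injective : ∀ l m, Function.Injective (iso l m)
  iso_range : ∀ l m, LinearMap.range (iso l m) = blockBimodule J (ideal l) (ideal m)
  /-- `iso` is a homomorphism of bimodules. -/
  iso_bimodule : ∀ l m (b : B J l) (b' : B J m) x,
    iso l m (TensorProduct.map (ρ l b) (ρ m b').dualMap x) =
      tw (J.toFun m) (tw (J.toFun m) (B.val b) (iso l m x)) (B.val b')
  /-- `iso` is `K`-equivariant, `K` acting on functions by shifts. -/
  iso_equivariant : ∀ l m (h : D.K) x,
    iso l m (tensorDual (D.π l h) (D.π m h) x) = shift (h : G) (iso l m x)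

/-- The dynamical datum `D` is defined by the dynamical twist `J`. -/
def Determines (J : DynamicalTwist k A) (D : DynamicalDatum k A) : Prop :=
  Nonempty (Realization J D)

end Construction

end DynTwist

end

/-! The dynamical equation says exactly that the compositions `F_{μ-λ}[G] ⊗ F_{ν-μ}[G] → F_{ν-λ}[G]`
given by `J(ν)` are associative. All these spaces therefore form one finite-dimensional algebra `E =
⨁ F_{μ-λ}[G]` (`CatAlg J`), on which `G` acts by shifts. It has `G`-fixed idempotents `e_λ` with sum
1, and `e_λ E e_λ = B_λ`, `e_λ E e_μ = F_{μ-λ}[G]`. The data defined by `J` are read off from the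
blocks of `E`.

Semisimplicity. Contracting the dynamical equation with the antipode shows that `(f, f') ↦ ∑_g (f
f')(g)` pairs `F_n[G]` and `F_{-n}[G]` nondegenerately (`exists_sum_tw_ne_zero`). The trace of left
multiplication on `E` is `G`-invariant, so on `B_λ` it is a nonzero multiple of the sum of values
(`trace_incl_ne_zero`). Thus every nonzero `x` has a non-nilpotent multiple `x y`, and the Jacobson
radical vanishes.

Existence. Shift-invariant functions are constant and no `F_{μ-λ}[G]` is zero. Hence the invariants
in the centre of `E` are scalars, `G` permutes the blocks transitively, and each block meets every
corner (`IsConnectedSystem`). Let `ε` be a block idempotent, `K` its stabilizer, `V` its simple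
module and `V_λ = e_λ V`. An element of `K` acts on the block by an automorphism, which is
implemented by an operator on `V` unique up to a scalar and preserving each `V_λ`. Since `ε e_λ E
e_μ = V_λ ⊗ V_μ^*`, the group `K` acts linearly there. The translates of this space sum to
`F_{μ-λ}[G]`, which is therefore induced from it, while `Ind_A^G μ` is `F_{-μ}[G]`. Irreducibility
follows by averaging rank-one operators over `K`, the result being scalar.

Uniqueness. Minimal ideals of `B_λ` are the corners of blocks; corresponding ideals lie in the same
block, and any two blocks are translates of each other. Simple modules of a matrix block being
isomorphic gives the `φ_λ`, and Schur's lemma gives multipliers `α_λ`. The bimodule isomorphisms are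
unique up to a scalar, so their `K`-equivariance forces `α_λ = α_μ` (`Realization.nonempty_iso`).
Conversely, shifts by `g` and right translations by a gauge transformation `t(λ)` carry realizations
to realizations (`Transport.determines`). -/

open scoped TensorProduct

noncomputable section

namespace DynTwist

/-! ### Simple modules, semisimplicity and blocks of a finite-dimensional algebra -/

section Rings

variable {k : Type*} [Field k] {R : Type*} [Ring R] [Algebra k R]

/-- A simple left ideal acting nontrivially on a module without proper invariant subspaces is
isomorphic to that module. -/
lemma exists_equiv_of_isAtom {V : Type*} [AddCommGroup V] [Module k V]
    (ρ : R →ₐ[k] Module.End k V)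
    (hs : ∀ W : Submodule k V, (∀ b, ∀ w ∈ W, ρ b w ∈ W) → W = ⊥ ∨ W = ⊤)
    {L : Submodule R R} (hL : IsAtom L) (h : ∃ x ∈ L, ρ x ≠ 0) :
    ∃ ψ : L ≃ₗ[k] V, ∀ (b : R) (x : L), ψ (b • x) = ρ b (ψ x) := by
  obtain ⟨x, hx, hρ⟩ := h
  obtain ⟨v, hv⟩ : ∃ v, ρ x v ≠ 0 := by
    by_contra! hv
    exact hρ (LinearMap.ext hv)
  let ψ : L →ₗ[k] V :=
    { toFun := fun y => ρ y v
      map_add' := by intro y z; simp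
      map_smul' := by intro c y; simp }
  have hψ : ∀ (b : R) (x : L), ψ (b • x) = ρ b (ψ x) := by intro b x; simp [ψ]
  have hinj : Function.Injective ψ := by
    rw [← LinearMap.ker_eq_bot, LinearMap.ker_eq_bot']
    intro y hy
    -- The annihilator of `v` in `L` is a left ideal properly contained in `L`, since it misses `x`;
    -- simplicity of `L` makes it zero.
    let N : Submodule R R :=
      { carrier := {z | z ∈ L ∧ ρ z v = 0}
        add_mem' := by
          rintro a b ⟨ha, ha'⟩ ⟨hb, hb'⟩
          exact ⟨L.add_mem ha hb, by simp [ha', hb']⟩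
        zero_mem' := ⟨L.zero_mem, by simp⟩
        smul_mem' := by
          rintro c a ⟨ha, ha'⟩
          exact ⟨L.smul_mem c ha, by simp [ha']⟩ }
    have hN : N = ⊥ := hL.2 N (lt_of_le_of_ne (fun z hz => hz.1) (by
      rintro hN
      have : x ∈ N := hN ▸ hx
      exact hv this.2))
    have : (y : R) ∈ N := ⟨y.2, hy⟩
    rw [hN] at this
    exact Subtype.ext (by simpa using this)
  have hsurj : Function.Surjective ψ := by
    rw [← LinearMap.range_eq_top]
    refine (hs (LinearMap.range ψ) ?_).resolve_left ?_
    · rintro b _ ⟨y, rfl⟩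
      exact ⟨b • y, hψ b y⟩
    · intro h
      have : ψ ⟨x, hx⟩ ∈ LinearMap.range ψ := ⟨_, rfl⟩
      rw [h, Submodule.mem_bot] at this
      exact hv this
  exact ⟨LinearEquiv.ofBijective ψ ⟨hinj, hsurj⟩, hψ⟩

/-- Two modules without proper invariant subspaces on which the same simple left ideal acts
nontrivially are isomorphic. -/
lemma exists_intertwiner_of_isAtom {V W : Type*} [AddCommGroup V] [Module k V]
    [AddCommGroup W] [Module k W]
    (ρ : R →ₐ[k] Module.End k V) (σ : R →ₐ[k] Module.End k W)
    (hρ : ∀ U : Submodule k V, (∀ b, ∀ w ∈ U, ρ b w ∈ U) → U = ⊥ ∨ U = ⊤)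
    (hσ : ∀ U : Submodule k W, (∀ b, ∀ w ∈ U, σ b w ∈ U) → U = ⊥ ∨ U = ⊤)
    {L : Submodule R R} (hL : IsAtom L) (hLρ : ∃ x ∈ L, ρ x ≠ 0) (hLσ : ∃ x ∈ L, σ x ≠ 0) :
    ∃ φ : V ≃ₗ[k] W, ∀ b v, φ (ρ b v) = σ b (φ v) := by
  obtain ⟨ψ, hψ⟩ := exists_equiv_of_isAtom ρ hρ hL hLρ
  obtain ⟨χ, hχ⟩ := exists_equiv_of_isAtom σ hσ hL hLσ
  refine ⟨ψ.symm.trans χ, fun b v => ?_⟩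
  obtain ⟨x, rfl⟩ := ψ.surjective v
  simp [← hψ, ← hχ]

/-- In a semisimple ring, an element acting nontrivially is detected by a simple left ideal. -/
lemma exists_isAtom_of_ne_zero [IsSemisimpleRing R] {V : Type*} [AddCommGroup V] [Module k V]
    (ρ : R →ₐ[k] Module.End k V) (I : Submodule R R) (h : ∃ x ∈ I, ρ x ≠ 0) :
    ∃ L : Submodule R R, IsAtom L ∧ L ≤ I ∧ ∃ x ∈ L, ρ x ≠ 0 := by
  obtain ⟨x, hx, hρ⟩ := h
  by_contra! hL
  let N : Submodule R R :=
    { carrier := {x | ρ x = 0}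
      add_mem' := by intro a b ha hb; simp_all
      zero_mem' := by simp
      smul_mem' := by intro c a ha; simp_all [smul_eq_mul] }
  have hI : I = sSup {a | IsAtom a ∧ a ≤ I} := (sSup_atoms_le_eq I).symm
  have : I ≤ N := by
    rw [hI]
    exact sSup_le fun L hL' z hz => hL L hL'.1 hL'.2 z hz
  exact hρ (this hx)

/-- The Jacobson radical of an Artinian ring is a nilpotent ideal, so a nonzero `x` in it would make
every `x * y` nilpotent. -/
lemma isSemisimpleRing_of_forall_not_isNilpotent [IsArtinianRing R]
    (h : ∀ x : R, x ≠ 0 → ∃ y, ¬ IsNilpotent (x * y)) : IsSemisimpleRing R := by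
  rw [IsArtinianRing.isSemisimpleRing_iff_jacobson, eq_bot_iff]
  intro x hx
  by_contra hx0
  obtain ⟨y, hy⟩ := h x (by simpa using hx0)
  obtain ⟨n, hn⟩ := IsSemiprimaryRing.isNilpotent (R := R)
  have hxy : x * y ∈ Ring.jacobson R := Ideal.mul_mem_right _ _ hx
  refine hy ⟨n, ?_⟩
  have := Ideal.pow_mem_pow hxy n
  rw [hn] at this
  simpa using this

/-- Rank-one operators move a nonzero vector to any prescribed vector. -/
lemma eq_bot_or_eq_top_of_forall_end {V : Type*} [AddCommGroup V] [Module k V]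
    (W : Submodule k V) (hW : ∀ (X : Module.End k V), ∀ w ∈ W, X w ∈ W) : W = ⊥ ∨ W = ⊤ := by
  rw [or_iff_not_imp_left, Submodule.eq_bot_iff, Submodule.eq_top_iff']
  intro h v
  push Not at h
  obtain ⟨w, hw, hw0⟩ := h
  obtain ⟨f, hf⟩ := Module.Projective.exists_dual_eq_one k hw0
  simpa [hf] using hW (f.smulRight v) w hw

/-- A primitive central idempotent. -/
structure IsPrimCentral (ε : R) : Prop where
  ne_zero : ε ≠ 0
  mul_self : ε * ε = ε
  comm : ∀ x, x * ε = ε * x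
  prim : ∀ z : R, z * z = z → (∀ x, x * z = z * x) → z * ε = 0 ∨ z * ε = ε

lemma IsPrimCentral.mul_eq_zero {ε ε' : R} (h : IsPrimCentral ε) (h' : IsPrimCentral ε')
    (hne : ε ≠ ε') : ε * ε' = 0 := by
  rcases h'.prim ε h.mul_self h.comm with h1 | h1
  · exact h1
  rcases h.prim ε' h'.mul_self h'.comm with h2 | h2
  · rw [h'.comm, h2]
  · exact absurd (by rw [← h1, h'.comm, h2]) hne

lemma IsPrimCentral.eq_of_mul_ne_zero {ε ε' : R} (h : IsPrimCentral ε) (h' : IsPrimCentral ε')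
    (hne : ε * ε' ≠ 0) : ε = ε' :=
  not_not.1 fun h1 => hne (h.mul_eq_zero h' h1)

/-- A representation of `R` by all endomorphisms of a nonzero coordinate space whose kernel is the
annihilator of `ε`. -/
structure BlockRep (k : Type*) [Field k] {R : Type*} [Ring R] [Algebra k R] (ε : R) where
  d : ℕ
  pos : 0 < d
  θ : R →ₐ[k] Module.End k (Fin d → k)
  surj : Function.Surjective θ
  ker : ∀ x, θ x = 0 ↔ ε * x = 0

section Wedderburn

variable [IsAlgClosed k] [IsSemisimpleRing R] [FiniteDimensional k R]

/-- By Wedderburn's theorem over an algebraically closed field, `x` has a nonzero component in some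
matrix factor. The unit of that factor serves as `ε`, and the projection to the factor as the
representation. -/
lemma exists_blockRep_of_ne_zero {x : R} (hx : x ≠ 0) :
    ∃ ε : R, IsPrimCentral ε ∧ ε * x ≠ 0 ∧ Nonempty (BlockRep k ε) := by
  classical
  obtain ⟨n, d, hd, ⟨Ψ⟩⟩ := IsSemisimpleRing.exists_algEquiv_pi_matrix_of_isAlgClosed k R
  obtain ⟨j, hj⟩ : ∃ j, Ψ x j ≠ 0 := by
    by_contra! h
    exact hx (Ψ.injective (by rw [map_zero]; exact funext h))
  have key : ∀ y z, Ψ.symm (Pi.single j y) * z = Ψ.symm (Pi.single j (y * Ψ z j)) := by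
    intro y z
    apply Ψ.injective
    rw [map_mul, Ψ.apply_symm_apply, Ψ.apply_symm_apply]
    ext1 i
    obtain rfl | hi := eq_or_ne i j
    · simp
    · simp [hi]
  have key' : ∀ y z, z * Ψ.symm (Pi.single j y) = Ψ.symm (Pi.single j (Ψ z j * y)) := by
    intro y z
    apply Ψ.injective
    rw [map_mul, Ψ.apply_symm_apply, Ψ.apply_symm_apply]
    ext1 i
    obtain rfl | hi := eq_or_ne i j
    · simp
    · simp [hi]
  have hsingle : ∀ y, Ψ.symm (Pi.single j y) = 0 ↔ y = 0 := by
    intro y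
    rw [map_eq_zero_iff _ Ψ.symm.injective, Pi.single_eq_zero_iff]
  have := hd j
  refine ⟨Ψ.symm (Pi.single j 1), ⟨?_, ?_, ?_, ?_⟩, ?_, ⟨⟨d j, Nat.pos_of_ne_zero (NeZero.ne _),
    (Matrix.toLinAlgEquiv' (R := k) (n := Fin (d j))).toAlgHom.comp
      ((Pi.evalAlgHom k _ j).comp Ψ.toAlgHom), ?_, ?_⟩⟩⟩
  · rw [Ne, hsingle]
    exact one_ne_zero
  · rw [key]; simp
  · intro z
    rw [key, key']; simp
  · intro z hz hc
    rw [key']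
    -- The component of a central idempotent is a central matrix, hence a scalar `c` with `c * c =
    -- c`.
    have hc' : ∀ y, y * Ψ z j = Ψ z j * y := by
      intro y
      have := hc (Ψ.symm (Pi.single j y))
      rw [key, key'] at this
      exact Pi.single_injective j (Ψ.symm.injective this)
    obtain ⟨c, hcc⟩ : Ψ z j ∈ Set.range (algebraMap k (Matrix (Fin (d j)) (Fin (d j)) k)) := by
      have : Ψ z j ∈ Subalgebra.center k (Matrix (Fin (d j)) (Fin (d j)) k) :=
        Subalgebra.mem_center_iff.2 hc'
      rw [Algebra.IsCentral.center_eq_bot] at this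
      exact this
    have hidem : c * c = c := by
      have h1 : Ψ z j * Ψ z j = Ψ z j := by rw [← Pi.mul_apply, ← map_mul, hz]
      rw [← hcc, ← map_mul] at h1
      exact (algebraMap k (Matrix (Fin (d j)) (Fin (d j)) k)).injective h1
    rw [← hcc]
    rcases (IsIdempotentElem.iff_eq_zero_or_one (p := c)).1 hidem with rfl | rfl
    · left; simp
    · right; simp
  · rw [key, Ne, hsingle]
    simpa using hj
  · refine (Matrix.toLinAlgEquiv' (R := k) (n := Fin (d j))).surjective.comp ?_
    intro y
    exact ⟨Ψ.symm (Pi.single j y), by simp⟩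
  · intro z
    rw [key, hsingle, one_mul]
    simp

/-- Distinct primitive central idempotents are orthogonal, so the idempotent detecting `ε` itself
can only be `ε`. -/
lemma IsPrimCentral.nonempty_blockRep {ε : R} (h : IsPrimCentral ε) :
    Nonempty (BlockRep k ε) := by
  obtain ⟨ε', h', hne, T⟩ := exists_blockRep_of_ne_zero (k := k) h.ne_zero
  rwa [← h'.eq_of_mul_ne_zero h hne]

end Wedderburn

end Rings

end DynTwist

end

open scoped TensorProduct

noncomputable section

set_option linter.unusedSectionVars false

namespace DynTwist

/-! ### Group actions on blocks -/

section GAlgebras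

variable {k : Type*} [Field k] {E : Type*} [Ring E] [Algebra k E]
  {G : Type*} [Group G] [MulSemiringAction G E] [SMulCommClass G k E]
  {Λ : Type*} [Fintype Λ]

/-- A system of `G`-fixed idempotents `e l` with sum `1` in a `G`-algebra `E`, such that
the invariants in the corners `e l * E * e l` are scalar and no `e l * E * e m` vanishes. -/
structure IsConnectedSystem (k : Type*) [Field k] {E : Type*} [Ring E] [Algebra k E]
    (G : Type*) [Group G] [MulSemiringAction G E] {Λ : Type*} [Fintype Λ] (e : Λ → E) : Prop where
  mul_self : ∀ l, e l * e l = e l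
  sum : ∑ l, e l = 1
  smul : ∀ (g : G) l, g • e l = e l
  inv : ∀ l x, e l * x = x → x * e l = x → (∀ g : G, g • x = x) → ∃ c : k, x = c • e l
  conn : ∀ l m, ∃ x, e l * x * e m ≠ 0

lemma IsPrimCentral.smul {ε : E} (h : IsPrimCentral ε) (g : G) : IsPrimCentral (g • ε) where
  ne_zero := by
    intro h0
    exact h.ne_zero (by simpa using congrArg (g⁻¹ • ·) h0)
  mul_self := by rw [← smul_mul', h.mul_self]
  comm x := by
    have := congrArg (g • ·) (h.comm (g⁻¹ • x))
    simpa [smul_mul'] using this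
  prim z hz hc := by
    have h1 := h.prim (g⁻¹ • z) (by rw [← smul_mul', hz]) (by
      intro x
      have := congrArg (g⁻¹ • ·) (hc (g • x))
      simpa [smul_mul'] using this)
    refine h1.imp (fun h2 => ?_) (fun h2 => ?_)
    · have := congrArg (g • ·) h2
      simpa [smul_mul'] using this
    · have := congrArg (g • ·) h2
      simpa [smul_mul'] using this

/-- The translate `g • x` lies in the block of `g • ε`, which equals the block of `ε` or is
orthogonal to it. This reduces sums over `G`, cut by `ε`, to sums over the stabilizer. -/
lemma IsPrimCentral.mul_smul_eq_ite {ε : E} (h : IsPrimCentral ε) (g : G) (x : E)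
    (hx : ε * x = x) [Decidable (g ∈ MulAction.stabilizer G ε)] :
    ε * (g • x) = if g ∈ MulAction.stabilizer G ε then g • x else 0 := by
  have h1 : g • x = (g • ε) * (g • x) := by rw [← smul_mul', hx]
  split_ifs with hg
  · rw [MulAction.mem_stabilizer_iff] at hg
    rw [hg] at h1
    exact h1.symm
  · rw [h1, ← mul_assoc, h.mul_eq_zero (h.smul g) (fun h2 => hg h2.symm), zero_mul]

namespace IsConnectedSystem

variable {e : Λ → E} (he : IsConnectedSystem k G e)
include he

/-- Each `e l * z` is an invariant element of a corner, hence a multiple `c l` of `e l`; a nonzero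
element `e l * x * e m`, commuting with `z`, identifies `c l` with `c m`. -/
lemma eq_smul_one {z : E} (hc : ∀ x, x * z = z * x) (hz : ∀ g : G, g • z = z) :
    ∃ c : k, z = c • 1 := by
  have h1 : ∀ l, ∃ c : k, e l * z = c • e l := by
    intro l
    refine he.inv l _ (by rw [← mul_assoc, he.mul_self]) (by rw [mul_assoc, ← hc, ← mul_assoc,
      he.mul_self]) ?_
    intro g
    rw [smul_mul', he.smul, hz]
  choose c hcl using h1
  have h2 : ∀ l m, c l = c m := by
    intro l m
    obtain ⟨x, hx⟩ := he.conn l m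
    have h3 : c l • (e l * x * e m) = c m • (e l * x * e m) := by
      calc c l • (e l * x * e m) = (e l * z) * x * e m := by
            rw [hcl]; simp only [smul_mul_assoc]
        _ = e l * x * (e m * z) := by
            rw [hc (e m), mul_assoc (e l), mul_assoc (e l), mul_assoc (e l), ← hc x, mul_assoc x]
        _ = _ := by rw [hcl]; simp only [mul_smul_comm]
    exact smul_left_injective k hx h3
  rcases isEmpty_or_nonempty Λ with h | ⟨⟨l₀⟩⟩
  · have : (1 : E) = 0 := by rw [← he.sum]; simp
    exact ⟨0, by rw [← one_mul z, this]; simp⟩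
  · refine ⟨c l₀, ?_⟩
    rw [← one_mul z, ← he.sum, Finset.sum_mul, Finset.smul_sum]
    exact Finset.sum_congr rfl fun l _ => by rw [hcl, h2 l l₀]

variable [Fintype G]

/-- The sum is central and invariant, hence scalar. Multiplication by `ε` kills all terms outside
the stabilizer and so determines the scalar. -/
lemma sum_smul {ε : E} (h : IsPrimCentral ε) :
    ∑ g : G, g • ε = (Nat.card (MulAction.stabilizer G ε) : k) • (1 : E) := by
  classical
  obtain ⟨c, hc⟩ := he.eq_smul_one (z := ∑ g : G, g • ε)
    (by
      intro x
      rw [Finset.mul_sum, Finset.sum_mul]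
      exact Finset.sum_congr rfl fun g _ => (h.smul g).comm x)
    (by
      intro g
      rw [Finset.smul_sum]
      exact Fintype.sum_equiv (Equiv.mulLeft g) _ _ (by intro x; simp [mul_smul]))
  have h1 : ε * ∑ g : G, g • ε = (Nat.card (MulAction.stabilizer G ε) : k) • ε := by
    rw [Finset.mul_sum]
    simp only [h.mul_smul_eq_ite _ _ h.mul_self]
    rw [← Finset.sum_filter, Finset.sum_congr rfl (g := fun _ => ε)]
    · rw [Finset.sum_const, Nat.card_eq_fintype_card, Fintype.card_subtype, Nat.cast_smul_eq_nsmul]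
    · intro g hg
      simpa using hg
  rw [hc, mul_smul_comm, mul_one] at h1
  rw [hc, smul_left_injective k h.ne_zero h1]

/-- The translates of `ε` sum to a nonzero scalar, so `ε'` cannot be orthogonal to all of them. -/
lemma exists_smul_eq [CharZero k] {ε ε' : E} (h : IsPrimCentral ε) (h' : IsPrimCentral ε') :
    ∃ g : G, ε' = g • ε := by
  by_contra! hne
  have h1 : (∑ g : G, g • ε) * ε' = 0 := by
    rw [Finset.sum_mul]
    exact Finset.sum_eq_zero fun g _ => (h.smul g).mul_eq_zero h' (hne g).symm
  rw [he.sum_smul h, smul_mul_assoc, one_mul, smul_eq_zero] at h1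
  rcases h1 with h1 | h1
  · exact absurd h1 (by exact_mod_cast Nat.card_pos.ne')
  · exact h'.ne_zero h1

/-- As `e l` is fixed by `G`, vanishing for `ε` would give vanishing for all translates of `ε`,
whose sum is a nonzero scalar. -/
lemma mul_ne_zero [CharZero k] {ε : E} (h : IsPrimCentral ε) (l : Λ) : ε * e l ≠ 0 := by
  intro h0
  have h1 : ∀ g : G, (g • ε) * e l = 0 := by
    intro g
    rw [← he.smul g l, ← smul_mul', h0, smul_zero]
  have h2 : (∑ g : G, g • ε) * e l = 0 := by
    rw [Finset.sum_mul]
    exact Finset.sum_eq_zero fun g _ => h1 g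
  rw [he.sum_smul h, smul_mul_assoc, one_mul, smul_eq_zero] at h2
  rcases h2 with h2 | h2
  · exact absurd h2 (by exact_mod_cast Nat.card_pos.ne')
  · obtain ⟨x, hx⟩ := he.conn l l
    exact hx (by rw [h2]; simp)

/-- The sum of the translates under the stabilizer of an element of a diagonal corner of a block. -/
lemma exists_sum_stabilizer_smul [CharZero k] {ε : E} (h : IsPrimCentral ε)
    [Fintype (MulAction.stabilizer G ε)] {l : Λ} {x : E} (hx : ε * x = x) (hl : e l * x = x)
    (hr : x * e l = x) :
    ∃ c : k, ∑ g : MulAction.stabilizer G ε, (g : G) • x = c • (ε * e l) := by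
  classical
  -- The sum over all of `G` is an invariant of the corner, hence scalar there; multiplying it by
  -- `ε` leaves only the terms from the stabilizer.
  obtain ⟨c, hc⟩ := he.inv l (∑ g : G, g • x)
    (by
      rw [Finset.mul_sum]
      refine Finset.sum_congr rfl fun g _ => ?_
      nth_rw 1 [← he.smul g l]
      rw [← smul_mul', hl])
    (by
      rw [Finset.sum_mul]
      refine Finset.sum_congr rfl fun g _ => ?_
      nth_rw 1 [← he.smul g l]
      rw [← smul_mul', hr])
    (by
      intro g
      rw [Finset.smul_sum]
      exact Fintype.sum_equiv (Equiv.mulLeft g) _ _ (by intro x; simp [mul_smul]))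
  refine ⟨c, ?_⟩
  rw [← mul_smul_comm, ← hc, Finset.mul_sum]
  rw [Finset.sum_congr rfl fun g _ => h.mul_smul_eq_ite g x hx]
  rw [← Finset.sum_filter]
  exact (Finset.sum_subtype (Finset.univ.filter (· ∈ MulAction.stabilizer G ε))
    (fun g => by simp) fun g => g • x).symm

end IsConnectedSystem

/-! ### The projective representation attached to a block -/

namespace BlockRep

variable {ε : E} (T : BlockRep k ε)

lemma map_idem (h : IsPrimCentral ε) : T.θ ε = 1 := by
  have : T.θ (1 - ε) = 0 := by rw [T.ker, mul_sub, mul_one, h.mul_self, sub_self]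
  rw [map_sub, map_one, sub_eq_zero] at this
  exact this.symm

lemma eq_of_map_eq {x y : E} (hx : ε * x = x) (hy : ε * y = y) (hxy : T.θ x = T.θ y) :
    x = y := by
  rw [← sub_eq_zero, ← map_sub, T.ker, mul_sub, hx, hy] at hxy
  exact sub_eq_zero.1 hxy

/-- The inverse of the isomorphism of the block of `ε` with the endomorphism algebra. -/
def sec (h : IsPrimCentral ε) : Module.End k (Fin T.d → k) →ₗ[k] E :=
  have hθ : ∀ X, T.θ (ε * Function.surjInv T.surj X) = X := by
    intro X
    rw [map_mul, T.map_idem h, one_mul, Function.surjInv_eq T.surj]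
  have hε : ∀ x, ε * (ε * x) = ε * x := by intro x; rw [← mul_assoc, h.mul_self]
  { toFun := fun X => ε * Function.surjInv T.surj X
    map_add' := by
      intro X Y
      exact T.eq_of_map_eq (hε _) (by rw [mul_add, hε, hε]) (by rw [map_add, hθ, hθ, hθ])
    map_smul' := by
      intro c X
      exact T.eq_of_map_eq (hε _) (by rw [RingHom.id_apply, mul_smul_comm, hε])
        (by rw [RingHom.id_apply, map_smul, hθ, hθ]) }

lemma map_sec (h : IsPrimCentral ε) (X : Module.End k (Fin T.d → k)) : T.θ (T.sec h X) = X := by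
  change T.θ (ε * Function.surjInv T.surj X) = X
  rw [map_mul, T.map_idem h, one_mul, Function.surjInv_eq T.surj]

lemma idem_mul_sec (h : IsPrimCentral ε) (X : Module.End k (Fin T.d → k)) :
    ε * T.sec h X = T.sec h X := by
  change ε * (ε * Function.surjInv T.surj X) = ε * Function.surjInv T.surj X
  rw [← mul_assoc, h.mul_self]

lemma sec_injective (h : IsPrimCentral ε) : Function.Injective (T.sec h) :=
  Function.LeftInverse.injective (T.map_sec h)

lemma mul_sec_mul (h : IsPrimCentral ε) (x y : E) (X : Module.End k (Fin T.d → k)) :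
    x * T.sec h X * y = T.sec h (T.θ x * X * T.θ y) := by
  refine T.eq_of_map_eq ?_ (T.idem_mul_sec h _) (by rw [map_mul, map_mul, map_sec, map_sec])
  rw [← mul_assoc, ← mul_assoc, ← h.comm x, mul_assoc x, T.idem_mul_sec]

lemma simple (W : Submodule k (Fin T.d → k)) (hW : ∀ b, ∀ w ∈ W, T.θ b w ∈ W) :
    W = ⊥ ∨ W = ⊤ := by
  refine eq_bot_or_eq_top_of_forall_end W fun X w hw => ?_
  obtain ⟨b, rfl⟩ := T.surj X
  exact hW b w hw

end BlockRep

end GAlgebras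

end DynTwist

end

open scoped TensorProduct

noncomputable section

set_option linter.unusedSectionVars false

namespace DynTwist

lemma tensorDual_tmul {k : Type*} [Field k] {V W : Type*} [AddCommGroup V] [Module k V]
    [AddCommGroup W] [Module k W] (p : V ≃ₗ[k] V) (q : W ≃ₗ[k] W) (v : V) (f : Module.Dual k W) :
    tensorDual p q (v ⊗ₜ f) = p v ⊗ₜ (f ∘ₗ (q.symm : W →ₗ[k] W)) := rfl

namespace BlockRep

variable {k : Type*} [Field k] {E : Type*} [Ring E] [Algebra k E]
  {G : Type*} [Group G] [MulSemiringAction G E] [SMulCommClass G k E]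
  {ε : E} (T : BlockRep k ε)

/-! ### The projective action of the stabilizer on the simple module -/

section Intertwiner

variable [IsSemisimpleRing E]

/-- A form of the Skolem–Noether theorem. Twisting the simple module by the automorphism `x ↦ g • x`
gives another simple module with the same kernel, because `g` fixes `ε`. One simple left ideal thus
acts nontrivially on both, so they are isomorphic. -/
lemma exists_intertwiner (g : MulAction.stabilizer G ε) :
    ∃ φ : (Fin T.d → k) ≃ₗ[k] (Fin T.d → k), ∀ x v,
      φ (T.θ x v) = T.θ ((g : G) • x) (φ v) := by
  let α : E ≃ₐ[k] E := MulSemiringAction.toAlgEquiv k E (g : G)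
  have hα : ∀ x, α x = (g : G) • x := fun x => rfl
  have hg : (g : G) • ε = ε := g.2
  have h1 : T.θ 1 ≠ 0 := by
    have : Nonempty (Fin T.d) := ⟨⟨0, T.pos⟩⟩
    rw [map_one]
    exact one_ne_zero
  obtain ⟨L, hL, -, x, hx, hx0⟩ := exists_isAtom_of_ne_zero T.θ ⊤ ⟨1, trivial, h1⟩
  refine exists_intertwiner_of_isAtom T.θ (T.θ.comp α.toAlgHom) T.simple ?_ hL ⟨x, hx, hx0⟩
    ⟨x, hx, ?_⟩
  · intro W hW
    refine T.simple W fun b w hw => ?_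
    obtain ⟨b, rfl⟩ := α.surjective b
    exact hW b w hw
  · intro h0
    apply hx0
    change T.θ (α x) = 0 at h0
    rw [T.ker] at h0 ⊢
    apply α.injective
    rw [map_mul, map_zero, hα ε, hg, h0]

/-- The operators by which the stabilizer of a block acts projectively on its simple module. -/
def act (g : MulAction.stabilizer G ε) :
    (Fin T.d → k) ≃ₗ[k] (Fin T.d → k) :=
  (T.exists_intertwiner g).choose

lemma act_map (g : MulAction.stabilizer G ε) (x : E) (v : Fin T.d → k) :
    T.act g (T.θ x v) = T.θ ((g : G) • x) (T.act g v) :=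
  (T.exists_intertwiner g).choose_spec x v

lemma act_symm_map (g : MulAction.stabilizer G ε) (x : E)
    (v : Fin T.d → k) :
    (T.act g).symm (T.θ ((g : G) • x) v) = T.θ x ((T.act g).symm v) := by
  rw [LinearEquiv.symm_apply_eq, act_map, LinearEquiv.apply_symm_apply]

lemma smul_sec (h : IsPrimCentral ε) (g : MulAction.stabilizer G ε)
    (X : Module.End k (Fin T.d → k)) :
    (g : G) • T.sec h X =
      T.sec h ((T.act g : _ →ₗ[k] _) ∘ₗ X ∘ₗ ((T.act g).symm : _ →ₗ[k] _)) := by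
  have hg : (g : G) • ε = ε := g.2
  refine T.eq_of_map_eq ?_ (T.idem_mul_sec h _) ?_
  · nth_rw 1 [← hg]
    rw [← smul_mul', T.idem_mul_sec]
  · rw [T.map_sec]
    refine LinearMap.ext fun v => ?_
    obtain ⟨v, rfl⟩ := (T.act g).surjective v
    simp only [LinearMap.comp_apply, LinearEquiv.coe_coe, LinearEquiv.symm_apply_apply]
    rw [← act_map, T.map_sec]

/-- The operators of `g g'` and of `g` after `g'` implement the same automorphism of the block, so
they differ by a central operator, a scalar. The cocycle identity compares the two ways of composing
three operators. -/
lemma exists_cocycle : ∃ c : MulAction.stabilizer G ε →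
    MulAction.stabilizer G ε → kˣ, (∀ g g' j, c g g' * c (g * g') j = c g' j * c g (g' * j)) ∧
      ∀ g g' v, T.act g (T.act g' v) = (c g g' : k) • T.act (g * g') v := by
  have hne : Nonempty (Fin T.d) := ⟨⟨0, T.pos⟩⟩
  have h1 : ∀ g g' : MulAction.stabilizer G ε, ∃ c : kˣ,
      ∀ v, T.act g (T.act g' v) = (c : k) • T.act (g * g') v := by
    intro g g'
    let P : (Fin T.d → k) ≃ₗ[k] (Fin T.d → k) :=
      (T.act (g * g')).symm.trans ((T.act g').trans (T.act g))
    have hP : (P : Module.End k (Fin T.d → k)) ∈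
        Subalgebra.center k (Module.End k (Fin T.d → k)) := by
      rw [Subalgebra.mem_center_iff]
      intro X
      obtain ⟨x, rfl⟩ := T.surj X
      refine LinearMap.ext fun v => ?_
      obtain ⟨x, rfl⟩ : ∃ y, ((g * g' : MulAction.stabilizer G ε) : G) • y = x :=
        ⟨((g * g' : MulAction.stabilizer G ε) : G)⁻¹ • x, smul_inv_smul _ _⟩
      simp only [Module.End.mul_apply, LinearEquiv.coe_coe, P, LinearEquiv.trans_apply,
        act_symm_map]
      rw [act_map, act_map, Subgroup.coe_mul, mul_smul]
    rw [Algebra.IsCentral.center_eq_bot] at hP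
    obtain ⟨c, hc⟩ := hP
    have hc' : ∀ v, P v = c • v := by
      intro v
      have := LinearMap.congr_fun hc v
      simpa using this.symm
    have hc0 : c ≠ 0 := by
      rintro rfl
      have : P (Function.const _ 1) = P 0 := by rw [hc', hc', zero_smul, zero_smul]
      have := congrFun (P.injective this) hne.some
      simp at this
    refine ⟨Units.mk0 c hc0, fun v => ?_⟩
    have := hc' (T.act (g * g') v)
    simpa [P] using this
  choose c hc using h1
  refine ⟨c, fun g g' j => ?_, hc⟩
  have e1 : ∀ v, T.act g (T.act g' (T.act j v)) =
      ((c g g' : k) * c (g * g') j) • T.act (g * g' * j) v := by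
    intro v; rw [hc, hc, smul_smul]
  have e2 : ∀ v, T.act g (T.act g' (T.act j v)) =
      ((c g' j : k) * c g (g' * j)) • T.act (g * g' * j) v := by
    intro v; rw [hc g' j, map_smul, hc, smul_smul, mul_assoc]
  -- Evaluating on a preimage of a vector with coordinates 1 lets the scalars be read off from one
  -- coordinate.
  obtain ⟨v, hv⟩ := (T.act (g * g' * j)).surjective (Function.const _ 1)
  have e3 := congrFun ((e1 v).symm.trans (e2 v)) hne.some
  rw [hv] at e3
  ext
  simpa using e3

end Intertwiner

/-! ### The components of the simple module -/

section Components

variable (a : E)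

/-- The component of the simple module cut out by an idempotent. -/
abbrev Comp : Submodule k (Fin T.d → k) := LinearMap.range (T.θ a)

/-- The projection to the component cut out by `a`. -/
def proj : (Fin T.d → k) →ₗ[k] T.Comp a := (T.θ a).rangeRestrict

lemma coe_proj (v : Fin T.d → k) : (T.proj a v : Fin T.d → k) = T.θ a v := rfl

variable {a}

lemma map_coe (ha : a * a = a) (v : T.Comp a) : T.θ a v = v := by
  obtain ⟨_, v, rfl⟩ := v
  change (T.θ a * T.θ a) v = T.θ a v
  rw [← map_mul, ha]

lemma proj_coe (ha : a * a = a) (v : T.Comp a) : T.proj a v = v :=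
  Subtype.ext (T.map_coe ha v)

lemma nontrivial_comp (ha : ε * a ≠ 0) : Nontrivial (T.Comp a) := by
  rw [Submodule.nontrivial_iff_ne_bot, Ne, LinearMap.range_eq_bot, T.ker]
  exact ha

/-- The action of the corner of `E` at `a`. -/
def compress (x : E) : Module.End k (T.Comp a) := T.proj a ∘ₗ T.θ x ∘ₗ (T.Comp a).subtype

lemma coe_compress {x : E} (hx : a * x = x) (v : T.Comp a) :
    (T.compress x v : Fin T.d → k) = T.θ x v := by
  change T.θ a (T.θ x v) = T.θ x v
  rw [← Module.End.mul_apply, ← map_mul, hx]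

/-- The element of the block of `ε` attached to `v ⊗ f`. -/
def fromTensor (h : IsPrimCentral ε) (a b : E) :
    T.Comp a ⊗[k] Module.Dual k (T.Comp b) →ₗ[k] E :=
  T.sec h ∘ₗ (LinearMap.lcomp k _ (T.proj b)) ∘ₗ (LinearMap.llcomp k _ _ _ (T.Comp a).subtype) ∘ₗ
    (dualTensorHom k _ _) ∘ₗ (TensorProduct.comm k _ _).toLinearMap

lemma fromTensor_apply (h : IsPrimCentral ε) {a b : E} (t : T.Comp a ⊗[k] Module.Dual k (T.Comp b)) :
    T.fromTensor h a b t = T.sec h ((T.Comp a).subtype ∘ₗ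
      (dualTensorHom k _ _ (TensorProduct.comm k _ _ t)) ∘ₗ T.proj b) := rfl

/-- An operator from the component of `b` to that of `a` is recovered from its extension by zero,
`proj b` being a retraction; finite-dimensionality identifies tensors with operators. -/
lemma fromTensor_injective (h : IsPrimCentral ε) {a b : E} (hb : b * b = b) :
    Function.Injective (T.fromTensor h a b) := by
  intro s t hst
  rw [fromTensor_apply, fromTensor_apply] at hst
  have h1 := T.sec_injective h hst
  apply (TensorProduct.comm k _ _).injective
  apply (dualTensorHomEquiv k _ _).injective
  refine LinearMap.ext fun v => ?_
  have h2 := LinearMap.congr_fun h1 v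
  simp only [LinearMap.comp_apply, T.proj_coe hb] at h2
  exact Subtype.ext h2

/-- Under the isomorphism of the block with `End V`, the Peirce component `ε a E b` becomes the
operators factoring through `proj b` with values in the component of `a`. -/
lemma range_fromTensor (h : IsPrimCentral ε) {a b : E} (ha : a * a = a) (hb : b * b = b) (x : E) :
    (∃ t, T.fromTensor h a b t = x) ↔ ε * x = x ∧ a * x = x ∧ x * b = x := by
  constructor
  · rintro ⟨t, rfl⟩
    refine ⟨T.idem_mul_sec h _, ?_, ?_⟩
    · rw [← mul_one (a * _), fromTensor_apply, T.mul_sec_mul, map_one, mul_one]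
      congr 1
      refine LinearMap.ext fun v => ?_
      simp [Module.End.mul_apply, T.map_coe ha]
    · rw [← one_mul (_ * b), ← mul_assoc, fromTensor_apply, T.mul_sec_mul, map_one, one_mul]
      congr 1
      refine LinearMap.ext fun v => ?_
      simp only [Module.End.mul_apply, LinearMap.comp_apply]
      exact congrArg (T.Comp a).subtype (congrArg _ (T.proj_coe hb (T.proj b v)))
  · rintro ⟨hε, hax, hxb⟩
    obtain ⟨t, ht⟩ := (dualTensorHomEquiv k (T.Comp b) (T.Comp a)).surjective
      (T.proj a ∘ₗ T.θ x ∘ₗ (T.Comp b).subtype)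
    refine ⟨(TensorProduct.comm k _ _).symm t, ?_⟩
    rw [fromTensor_apply, LinearEquiv.apply_symm_apply]
    refine T.eq_of_map_eq (T.idem_mul_sec h _) hε ?_
    have ht' : dualTensorHom k (T.Comp b) (T.Comp a) t =
      T.proj a ∘ₗ T.θ x ∘ₗ (T.Comp b).subtype := ht
    rw [T.map_sec, ht']
    refine LinearMap.ext fun v => ?_
    change T.θ a (T.θ x (T.θ b v)) = T.θ x v
    simp only [← Module.End.mul_apply, ← map_mul, hxb, hax]

lemma fromTensor_map (h : IsPrimCentral ε) {a b : E} {x y : E} (hx : a * x = x) (hy : y * b = y) (hy' : b * y = y)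
    (t : T.Comp a ⊗[k] Module.Dual k (T.Comp b)) :
    T.fromTensor h a b (TensorProduct.map (T.compress x) (T.compress y).dualMap t) =
      x * T.fromTensor h a b t * y := by
  induction t with
  | zero => simp
  | add s t hs ht => simp only [map_add, mul_add, add_mul, hs, ht]
  | tmul v f =>
    rw [TensorProduct.map_tmul, fromTensor_apply, fromTensor_apply, T.mul_sec_mul]
    congr 1
    refine LinearMap.ext fun w => ?_
    simp only [LinearMap.comp_apply, TensorProduct.comm_tmul, dualTensorHom_apply,
      Module.End.mul_apply, map_smul, Submodule.subtype_apply, LinearMap.dualMap_apply,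
      T.coe_compress hx]
    refine congrArg (fun u => f u • T.θ x v) (Subtype.ext ?_)
    change T.θ b (T.θ y (T.θ b w)) = T.θ b (T.θ y w)
    simp only [← Module.End.mul_apply, ← map_mul, hy, hy']

end Components

end BlockRep

end DynTwist

end

open scoped TensorProduct

noncomputable section

set_option linter.unusedSectionVars false

namespace DynTwist

/-! ### The stabilizer acting on components, and irreducibility -/

namespace BlockRep

variable {k : Type*} [Field k] {E : Type*} [Ring E] [Algebra k E]
  {G : Type*} [Group G] [MulSemiringAction G E] [SMulCommClass G k E] [IsSemisimpleRing E]
  {ε : E} (T : BlockRep k ε) {a b : E} (ha : ∀ g : G, g • a = a) (hb : ∀ g : G, g • b = b)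

/-- The projective action of the stabilizer of a block on a component of its simple module. -/
def actComp (g : MulAction.stabilizer G ε) : T.Comp a ≃ₗ[k] T.Comp a :=
  (T.act g).ofSubmodules _ _ (by
    ext v
    constructor
    · rintro ⟨_, ⟨w, rfl⟩, rfl⟩
      exact ⟨T.act g w, by rw [LinearEquiv.coe_coe, act_map, ha]⟩
    · rintro ⟨w, rfl⟩
      refine ⟨_, ⟨(T.act g).symm w, rfl⟩, ?_⟩
      rw [LinearEquiv.coe_coe, act_map, ha, LinearEquiv.apply_symm_apply])

lemma coe_actComp (g : MulAction.stabilizer G ε) (v : T.Comp a) :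
    (T.actComp ha g v : Fin T.d → k) = T.act g v := rfl

lemma coe_actComp_symm (g : MulAction.stabilizer G ε) (v : T.Comp a) :
    ((T.actComp ha g).symm v : Fin T.d → k) = (T.act g).symm v := rfl

lemma isProjectiveRep_actComp (hε : ε * a ≠ 0) :
    IsProjectiveRep fun g : MulAction.stabilizer G ε => T.actComp ha g := by
  refine ⟨T.nontrivial_comp hε, ?_⟩
  obtain ⟨c, hc, hc'⟩ := T.exists_cocycle (G := G)
  exact ⟨c, hc, fun g g' v => Subtype.ext (hc' g g' v)⟩

lemma compress_smul {x : E} (hx : a * x = x) (g : MulAction.stabilizer G ε) (v : T.Comp a) :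
    T.compress ((g : G) • x) (T.actComp ha g v) = T.actComp ha g (T.compress x v) := by
  apply Subtype.ext
  rw [coe_actComp, coe_compress _ hx, act_map, coe_compress, coe_actComp]
  rw [← ha g, ← smul_mul', hx]

lemma fromTensor_tensorDual (h : IsPrimCentral ε) (g : MulAction.stabilizer G ε)
    (t : T.Comp a ⊗[k] Module.Dual k (T.Comp b)) :
    T.fromTensor h a b (tensorDual (T.actComp ha g) (T.actComp hb g) t) =
      (g : G) • T.fromTensor h a b t := by
  induction t with
  | zero => simp
  | add s t hs ht => simp only [map_add, smul_add, hs, ht]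
  | tmul v f =>
    rw [tensorDual_tmul, fromTensor_apply, fromTensor_apply, T.smul_sec]
    congr 1
    refine LinearMap.ext fun w => ?_
    simp only [LinearMap.comp_apply, TensorProduct.comm_tmul, dualTensorHom_apply,
      map_smul, Submodule.subtype_apply, LinearEquiv.coe_coe, coe_actComp]
    refine congrArg (fun u => f u • T.act g v) (Subtype.ext ?_)
    rw [coe_actComp_symm, coe_proj, coe_proj, ← act_symm_map, hb]

/-- The linear representation of the stabilizer of a block on `V ⊗ W^*`, for two components `V`
and `W` of its simple module. -/
def tensorRep (h : IsPrimCentral ε) (hb' : b * b = b) :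
    Representation k (MulAction.stabilizer G ε) (T.Comp a ⊗[k] Module.Dual k (T.Comp b)) where
  toFun g := tensorDual (T.actComp ha g) (T.actComp hb g)
  -- Linearity holds because the action is carried by the injection `fromTensor` into the genuine
  -- action of `G` on `E`; no cocycle needs to be cancelled by hand.
  map_one' := LinearMap.ext fun t => T.fromTensor_injective h hb' (by
    rw [fromTensor_tensorDual]; simp)
  map_mul' g g' := LinearMap.ext fun t => T.fromTensor_injective h hb' (by
    rw [Module.End.mul_apply, fromTensor_tensorDual, fromTensor_tensorDual,
      fromTensor_tensorDual, Subgroup.coe_mul, mul_smul])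

section Irreducible

variable [Fintype G] [CharZero k] {Λ : Type*} [Fintype Λ] {e : Λ → E}

/-- The element of the block corresponding to `X` lies in a diagonal corner, where the sum over the
stabilizer is scalar; conjugation by the projective operators is the action of `G` on `E`. -/
lemma exists_average (he : IsConnectedSystem k G e) (h : IsPrimCentral ε)
    [Fintype (MulAction.stabilizer G ε)] (l : Λ) (X : Module.End k (T.Comp (e l))) :
    ∃ c : k, ∀ u, ∑ g : MulAction.stabilizer G ε,
      T.actComp (fun g => he.smul g l) g (X ((T.actComp (fun g => he.smul g l) g).symm u)) =
        c • u := by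
  set X' : Module.End k (Fin T.d → k) :=
    (T.Comp (e l)).subtype ∘ₗ X ∘ₗ T.proj (e l) with hX'
  obtain ⟨c, hc⟩ := he.exists_sum_stabilizer_smul h (x := T.sec h X') (l := l)
    (T.idem_mul_sec h _)
    (by
      rw [← mul_one (e l * _), T.mul_sec_mul, map_one, mul_one]
      congr 1
      refine LinearMap.ext fun v => ?_
      simp [Module.End.mul_apply, hX', T.map_coe (he.mul_self l)])
    (by
      rw [← one_mul (_ * e l), ← mul_assoc, T.mul_sec_mul, map_one, one_mul]
      congr 1
      refine LinearMap.ext fun v => ?_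
      exact congrArg (T.Comp (e l)).subtype
        (congrArg X (T.proj_coe (he.mul_self l) (T.proj (e l) v))))
  refine ⟨c, fun u => Subtype.ext ?_⟩
  have h1 := LinearMap.congr_fun (congrArg T.θ hc) u
  rw [map_sum, LinearMap.sum_apply, map_smul, map_mul, T.map_idem h, one_mul,
    LinearMap.smul_apply, T.map_coe (he.mul_self l)] at h1
  rw [Submodule.coe_smul, ← h1, Submodule.coe_sum]
  refine Finset.sum_congr rfl fun g _ => ?_
  rw [T.smul_sec, T.map_sec, coe_actComp]
  simp only [LinearMap.comp_apply, LinearEquiv.coe_coe, hX', Submodule.subtype_apply]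
  rw [← coe_actComp_symm T (fun g => he.smul g l), T.proj_coe (he.mul_self l)]

/-- Averaging the rank-one operator `f ⊗ v` gives a scalar, found by taking traces. Read as a
function of `v`, this identity expresses every rank-one operator as a combination of the operators
of the stabilizer; such operators span. -/
lemma isIrreducibleProj_actComp (he : IsConnectedSystem k G e) (h : IsPrimCentral ε) (l : Λ) :
    IsIrreducibleProj fun g : MulAction.stabilizer G ε =>
      T.actComp (fun g => he.smul g l) g := by
  classical
  have := T.nontrivial_comp (he.mul_ne_zero h l)
  set P := fun g : MulAction.stabilizer G ε => T.actComp (fun g => he.smul g l) g with hP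
  have hd : (Module.finrank k (T.Comp (e l)) : k) ≠ 0 := by exact_mod_cast Module.finrank_pos.ne'
  have hK : (Fintype.card (MulAction.stabilizer G ε) : k) ≠ 0 := by
    exact_mod_cast Fintype.card_ne_zero
  have key : ∀ (f : Module.Dual k (T.Comp (e l))) (v u : T.Comp (e l)), ∑ g, f ((P g).symm u) • P g v =
      ((Fintype.card (MulAction.stabilizer G ε) : k) * f v / Module.finrank k (T.Comp (e l))) • u := by
    intro f v u
    obtain ⟨c, hc⟩ := T.exists_average he h l (f.smulRight v)
    have hop : ∑ g, (P g).conj (f.smulRight v) = c • (1 : Module.End k (T.Comp (e l))) := by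
      refine LinearMap.ext fun w => ?_
      rw [LinearMap.smul_apply, Module.End.one_apply, ← hc, LinearMap.sum_apply]
      rfl
    have htr := congrArg (LinearMap.trace k (T.Comp (e l))) hop
    rw [map_sum, map_smul, LinearMap.trace_one] at htr
    simp only [LinearMap.trace_conj', LinearMap.trace_smulRight, Finset.sum_const,
      Finset.card_univ, nsmul_eq_mul, smul_eq_mul] at htr
    rw [htr, mul_div_assoc, div_self hd, mul_one, ← hc]
    exact Finset.sum_congr rfl fun g _ => by simp [hP]
  rw [IsIrreducibleProj, eq_top_iff]
  intro X _
  obtain ⟨t, rfl⟩ := (dualTensorHomEquiv k (T.Comp (e l)) (T.Comp (e l))).surjective X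
  induction t with
  | zero => simp
  | add s t hs ht =>
    rw [map_add]
    exact Submodule.add_mem _ (hs trivial) (ht trivial)
  | tmul f u =>
    -- The coefficients `f ((P g)⁻¹ u)` come from `key`, and the prefactor inverts its constant.
    have : dualTensorHomEquiv k (T.Comp (e l)) (T.Comp (e l)) (f ⊗ₜ u) = ((Module.finrank k (T.Comp (e l)) : k) /
        Fintype.card (MulAction.stabilizer G ε)) •
          ∑ g, f ((P g).symm u) • (P g : T.Comp (e l) →ₗ[k] T.Comp (e l)) := by
      refine LinearMap.ext fun v => ?_
      rw [LinearMap.smul_apply, LinearMap.sum_apply]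
      simp only [LinearMap.smul_apply, LinearEquiv.coe_coe, key]
      rw [smul_smul, dualTensorHomEquiv,
        LinearEquiv.ofBijective_apply, dualTensorHom_apply]
      congr 1
      field_simp
    rw [this]
    exact Submodule.smul_mem _ _ (Submodule.sum_mem _ fun g _ => Submodule.smul_mem _ _
      (Submodule.subset_span ⟨g, rfl⟩))

end Irreducible

end BlockRep

/-! ### A criterion for a representation to be induced -/

section Induced

open Representation

/-- The hypotheses say that `W` is the direct sum of the translates of `i U` over the cosets of `H`:
`h0` makes distinct translates independent, and `hsum` makes them span. -/
lemma nonempty_ind_equiv {k : Type*} [Field k] [CharZero k] {G : Type*} [Group G] [Fintype G]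
    {H : Subgroup G} {U W : Type*} [AddCommGroup U] [Module k U] [AddCommGroup W] [Module k W]
    (σ : Representation k H U) (τ : Representation k G W) (i : U →ₗ[k] W) (r : W →ₗ[k] U)
    (hi : ∀ h u, i (σ h u) = τ h (i u)) (hri : ∀ u, r (i u) = u)
    (h0 : ∀ g ∉ H, ∀ u, r (τ g (i u)) = 0)
    (hsum : ∀ w, ∑ g, τ g (i (r (τ g⁻¹ w))) = (Nat.card H : k) • w) :
    Nonempty ((ind H.subtype σ).Equiv τ) := by
  classical
  have hH : (Nat.card H : k) ≠ 0 := by exact_mod_cast Nat.card_pos.ne'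
  let F : MonoidAlgebra k G →ₗ[k] U →ₗ[k] W :=
    Finsupp.linearCombination k (fun g => τ g⁻¹ ∘ₗ i) ∘ₗ
      (MonoidAlgebra.coeffLinearEquiv k).toLinearMap
  have hF : ∀ g, F (MonoidAlgebra.single g 1) = τ g⁻¹ ∘ₗ i := by
    intro g
    change Finsupp.linearCombination k _ (MonoidAlgebra.coeff (MonoidAlgebra.single g (1 : k))) = _
    simp
  -- In the model by coinvariants, `G` acts on the class of `x ⊗ u` by right multiplication of `x`
  -- by inverses, so this class has to go to `τ x⁻¹ (i u)`.
  let Φ : IndV H.subtype σ →ₗ[k] W := Coinvariants.lift _ (TensorProduct.lift F) (by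
    intro h
    refine TensorProduct.ext (MonoidAlgebra.lhom_ext' fun g => LinearMap.ext_ring ?_)
    refine LinearMap.ext fun u => ?_
    simp [hF, hi, ← Module.End.mul_apply, ← map_mul])
  have hΦ : ∀ x u, Φ (IndV.mk H.subtype σ x u) = τ x⁻¹ (i u) := by
    intro x u
    change F (MonoidAlgebra.single x 1) u = _
    rw [hF]; rfl
  let Ψ : W →ₗ[k] IndV H.subtype σ :=
    (Nat.card H : k)⁻¹ • ∑ g : G, IndV.mk H.subtype σ g⁻¹ ∘ₗ r ∘ₗ τ g⁻¹
  have hΨ : ∀ w, Ψ w = (Nat.card H : k)⁻¹ • ∑ g : G, IndV.mk H.subtype σ g⁻¹ (r (τ g⁻¹ w)) := by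
    intro w; simp [Ψ]
  have hmk : ∀ (h : H) x u, IndV.mk H.subtype σ (h * x) (σ h u) = IndV.mk H.subtype σ x u := by
    intro h x u
    have := Coinvariants.mk_self_apply (Representation.tprod ((leftRegular k G).comp H.subtype) σ)
      h (MonoidAlgebra.single x 1 ⊗ₜ u)
    simpa using this
  have h1 : Φ ∘ₗ Ψ = LinearMap.id := by
    refine LinearMap.ext fun w => ?_
    rw [LinearMap.comp_apply, hΨ, map_smul, map_sum]
    simp only [hΦ, inv_inv]
    rw [hsum, smul_smul, inv_mul_cancel₀ hH, one_smul, LinearMap.id_apply]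
  have h2 : Ψ ∘ₗ Φ = LinearMap.id := by
    refine IndV.hom_ext _ _ fun x => LinearMap.ext fun u => ?_
    simp only [LinearMap.comp_apply, LinearMap.id_apply]
    change Ψ (Φ (IndV.mk H.subtype σ x u)) = IndV.mk H.subtype σ x u
    rw [hΦ, hΨ]
    -- Substituting `y = g⁻¹ x⁻¹`, only `y ∈ H` survives by `h0`, and each such term equals the
    -- class of `x ⊗ u`. The `|H|` copies cancel the normalization of `Ψ`.
    have h3 : ∑ g : G, IndV.mk H.subtype σ g⁻¹ (r (τ g⁻¹ (τ x⁻¹ (i u)))) =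
        ∑ y : G, if y ∈ H then IndV.mk H.subtype σ x u else 0 := by
      refine Fintype.sum_equiv ((Equiv.inv G).trans (Equiv.mulRight x⁻¹)) _ _ fun g => ?_
      simp only [Equiv.trans_apply, Equiv.inv_apply, Equiv.coe_mulRight]
      rw [← Module.End.mul_apply, ← map_mul]
      split_ifs with hg
      · have h4 := hmk ⟨_, hg⟩ x u
        rw [← h4, ← hri (σ _ u), hi]
        simp
      · rw [h0 _ hg, map_zero]
    rw [h3, ← Finset.sum_filter, Finset.sum_const, ← Nat.cast_smul_eq_nsmul k, smul_smul,
      ← Fintype.card_subtype, ← Nat.card_eq_fintype_card]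
    exact (congrArg (· • _) (inv_mul_cancel₀ hH)).trans (one_smul _ _)
  refine ⟨Representation.Equiv.mk (LinearEquiv.ofLinearMap Φ Ψ h1 h2) fun g => ?_⟩
  refine IndV.hom_ext _ _ fun x => LinearMap.ext fun u => ?_
  change Φ (ind H.subtype σ g (IndV.mk H.subtype σ x u)) = τ g (Φ (IndV.mk H.subtype σ x u))
  rw [ind_mk, hΦ, hΦ, ← Module.End.mul_apply, ← map_mul, mul_inv_rev, inv_inv]

end Induced

end DynTwist

end

open scoped TensorProduct

noncomputable section

set_option linter.unusedSectionVars false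

namespace DynTwist

universe u v

variable {k : Type u} [Field k] {G : Type v} [Group G]

/-! ### The antipode and the elements `∑ S(x₁) x₂` and `∑ x₁ S(x₂)` -/

lemma GA.induction {p : GA k G → Prop} (hg : ∀ g, p (grp k g)) (hadd : ∀ x y, p x → p y → p (x + y))
    (hsmul : ∀ (c : k) x, p x → p (c • x)) (x : GA k G) : p x := by
  refine MonoidAlgebra.induction_linear (motive := p) x ?_ hadd ?_
  · have := hsmul 0 _ (hg 1)
    rwa [zero_smul] at this
  · intro g c
    have h1 : c • grp k g = MonoidAlgebra.single g c := by
      change c • MonoidAlgebra.single g (1 : k) = _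
      simp
    rw [← h1]
    exact hsmul c _ (hg g)

lemma GA.tensor_induction {p : GA k G ⊗[k] GA k G → Prop}
    (hg : ∀ g h, p (grp k g ⊗ₜ grp k h)) (hadd : ∀ x y, p x → p y → p (x + y))
    (hsmul : ∀ (c : k) x, p x → p (c • x)) (x : GA k G ⊗[k] GA k G) : p x := by
  induction x with
  | zero => simpa using hsmul 0 _ (hg 1 1)
  | add x y hx hy => exact hadd x y hx hy
  | tmul x y =>
    induction x using GA.induction with
    | hadd x x' hx hx' => rw [TensorProduct.add_tmul]; exact hadd _ _ hx hx'
    | hsmul c x hx => rw [← TensorProduct.smul_tmul']; exact hsmul _ _ hx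
    | hg g =>
      induction y using GA.induction with
      | hadd x x' hx hx' => rw [TensorProduct.tmul_add]; exact hadd _ _ hx hx'
      | hsmul c x hx => rw [TensorProduct.tmul_smul]; exact hsmul _ _ hx
      | hg h => exact hg g h

/-- The antipode of `k[G]`. -/
def antip : GA k G →ₗ[k] GA k G :=
  Finsupp.linearCombination k (fun g => grp k g⁻¹) ∘ₗ
    (MonoidAlgebra.coeffLinearEquiv k).toLinearMap

@[simp] lemma antip_grp (g : G) : antip (grp k g) = grp k g⁻¹ := by
  change Finsupp.linearCombination k _ (MonoidAlgebra.coeff (MonoidAlgebra.single g (1 : k))) = _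
  simp

lemma antip_mul (x y : GA k G) : antip (x * y) = antip y * antip x := by
  induction x using GA.induction with
  | hadd x x' hx hx' => rw [add_mul, map_add, hx, hx', map_add, mul_add]
  | hsmul c x hx => rw [smul_mul_assoc, map_smul, hx, map_smul, mul_smul_comm]
  | hg g =>
    induction y using GA.induction with
    | hadd x x' hx hx' => rw [mul_add, map_add, hx, hx', map_add, add_mul]
    | hsmul c x hx => rw [mul_smul_comm, map_smul, hx, map_smul, smul_mul_assoc]
    | hg h => simp [grp_mul]

/-- The linear map `x ⊗ y ↦ S(x) y`. -/
def leftContr : GA k G ⊗[k] GA k G →ₗ[k] GA k G :=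
  LinearMap.mul' k _ ∘ₗ TensorProduct.map antip LinearMap.id

/-- The linear map `x ⊗ y ↦ x S(y)`. -/
def rightContr : GA k G ⊗[k] GA k G →ₗ[k] GA k G :=
  LinearMap.mul' k _ ∘ₗ TensorProduct.map LinearMap.id antip

@[simp] lemma leftContr_tmul (x y : GA k G) : leftContr (x ⊗ₜ[k] y) = antip x * y := by
  simp [leftContr]

@[simp] lemma rightContr_tmul (x y : GA k G) : rightContr (x ⊗ₜ[k] y) = x * antip y := by
  simp [rightContr]

/-- The linear map `x ⊗ y ⊗ z ↦ S(x) y S(z)`. -/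
def tripleContr : GA k G ⊗[k] (GA k G ⊗[k] GA k G) →ₗ[k] GA k G :=
  LinearMap.mul' k _ ∘ₗ TensorProduct.map antip rightContr

/-- The antipode axiom cancels the two legs of the coproduct. This evaluates the right side of the
dynamical equation after contraction. -/
lemma tripleContr_comul_right (z : GA k G ⊗[k] GA k G) :
    tripleContr (TensorProduct.map LinearMap.id (Coalgebra.comul (R := k)) z) =
      antip (TensorProduct.rid k _ (TensorProduct.map LinearMap.id Coalgebra.counit z)) := by
  induction z using GA.tensor_induction with
  | hadd x y hx hy => simp only [map_add, hx, hy]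
  | hsmul c x hx => simp only [map_smul, hx]
  | hg g h => simp [tripleContr, comul_grp, counit_grp, grp_mul, grp_one]

/-- Here `S(x') x''` cancels in the middle of the product, so that only the counit of the first leg
of `x` remains. This evaluates the left side of the dynamical equation after contraction. -/
lemma tripleContr_assoc (x v w : GA k G ⊗[k] GA k G) (q : GA k G) :
    tripleContr (Algebra.TensorProduct.assoc k k k _ _ _
        (TensorProduct.map (Coalgebra.comul (R := k)) LinearMap.id x * (v ⊗ₜ[k] q)) *
          ((1 : GA k G) ⊗ₜ[k] w)) =
      leftContr v * rightContr w * antip q *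
        antip (TensorProduct.lid k _ (TensorProduct.map Coalgebra.counit LinearMap.id x)) := by
  induction x using GA.tensor_induction with
  | hadd x y hx hy => simp only [map_add, hx, hy, add_mul, mul_add]
  | hsmul c x hx => simp only [map_smul, hx, smul_mul_assoc, mul_smul_comm]
  | hg g h =>
    induction v using GA.tensor_induction with
    | hadd x y hx hy => simp only [map_add, TensorProduct.add_tmul, hx, hy, add_mul, mul_add]
    | hsmul c x hx =>
      simp only [map_smul, ← TensorProduct.smul_tmul', hx, smul_mul_assoc, mul_smul_comm]
    | hg p r =>
      induction w using GA.tensor_induction with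
      | hadd x y hx hy => simp only [map_add, TensorProduct.tmul_add, hx, hy, add_mul, mul_add]
      | hsmul c x hx =>
        simp only [map_smul, TensorProduct.tmul_smul, hx, smul_mul_assoc, mul_smul_comm]
      | hg s t =>
        have e : ∀ (a b : G) (z : GA k G), grp k a * (grp k b * z) = grp k (a * b) * z := by
          intro a b z; rw [← mul_assoc, grp_mul]
        simp [tripleContr, comul_grp, counit_grp, antip_mul, grp_mul, mul_assoc, e]

/-- Invariance of summation over `G`: right translation of `f₁` moves to `f₂` as the inverse
translation, which is where the antipode arises. -/
lemma sum_pair_grp [Fintype G] (f₁ f₂ : G → k) (x : GA k G ⊗[k] GA k G) :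
    ∑ g, pair f₁ f₂ ((grp k g ⊗ₜ[k] grp k g) * x) =
      ∑ g, f₁ g * linExt f₂ (grp k g * leftContr x) := by
  induction x using GA.tensor_induction with
  | hadd x y hx hy => simp only [mul_add, map_add, Finset.sum_add_distrib, hx, hy]
  | hsmul c x hx => simp only [mul_smul_comm, map_smul, smul_eq_mul, mul_left_comm _ c,
      ← Finset.mul_sum, hx]
  | hg h h' =>
    refine Fintype.sum_equiv (Equiv.mulRight h) _ _ fun g => ?_
    simp [grp_mul, mul_assoc]

lemma rightContr_comm {w : GA k G ⊗[k] GA k G} (a : G)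
    (hw : (grp k a ⊗ₜ[k] grp k a) * w = w * (grp k a ⊗ₜ[k] grp k a)) :
    grp k a * rightContr w = rightContr w * grp k a := by
  have h1 : ∀ w : GA k G ⊗[k] GA k G,
      rightContr ((grp k a ⊗ₜ[k] grp k a) * w) * grp k a = grp k a * rightContr w := by
    intro w
    induction w using GA.tensor_induction with
    | hadd x y hx hy => simp only [mul_add, map_add, add_mul, hx, hy]
    | hsmul c x hx => simp only [mul_smul_comm, map_smul, smul_mul_assoc, hx]
    | hg h h' => simp [grp_mul, mul_assoc]
  have h2 : ∀ w : GA k G ⊗[k] GA k G,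
      rightContr (w * (grp k a ⊗ₜ[k] grp k a)) = rightContr w := by
    intro w
    induction w using GA.tensor_induction with
    | hadd x y hx hy => simp only [map_add, add_mul, hx, hy]
    | hsmul c x hx => simp only [map_smul, smul_mul_assoc, hx]
    | hg h h' => simp [grp_mul, mul_assoc]
  rw [← h1, hw, h2]

/-! ### Functions of weight `μ` -/

variable {A : Subgroup G}

lemma linExt_mul_grp {m : Chars k A} {f : G → k} (hf : f ∈ weightFun m) (y : GA k G) (a : A) :
    linExt f (y * grp k (a : G)) = linExt f y * (m.hom a : k) := by
  induction y using GA.induction with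
  | hadd x y hx hy => rw [add_mul, map_add, hx, hy, map_add, add_mul]
  | hsmul c x hx => rw [smul_mul_assoc, map_smul, hx, map_smul, smul_mul_assoc]
  | hg g => rw [grp_mul, linExt_grp, linExt_grp, hf]

open Classical in
/-- The function of weight `μ` supported on `A`. -/
def delta (m : Chars k A) : G → k := fun x => if hx : x ∈ A then (m.hom ⟨x, hx⟩ : k) else 0

lemma delta_mem (m : Chars k A) : delta m ∈ weightFun m := by
  intro g a
  unfold delta
  by_cases hg : g ∈ A
  · have h1 : g * a ∈ A := A.mul_mem hg a.2
    rw [dif_pos hg, dif_pos h1, ← Units.val_mul, ← map_mul]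
    rfl
  · have h1 : g * a ∉ A := fun h => hg ((A.mul_mem_cancel_right a.2).1 h)
    rw [dif_neg hg, dif_neg h1, zero_mul]

lemma delta_one (m : Chars k A) : delta m 1 = 1 := by
  have h : (1 : G) ∈ A := A.one_mem
  have h1 : m.hom ⟨1, h⟩ = 1 := m.hom.map_one
  rw [delta, dif_pos h, h1]
  rfl

lemma delta_of_notMem (m : Chars k A) {x : G} (hx : x ∉ A) : delta m x = 0 := dif_neg hx

lemma mul_delta_neg {m : Chars k A} {f : G → k} (hf : f ∈ weightFun m) (x : G)
    [Decidable (x ∈ A)] : f x * delta (-m) x = if x ∈ A then f 1 else 0 := by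
  split_ifs with hx
  · have h1 := hf 1 ⟨x, hx⟩
    rw [one_mul] at h1
    have h2 : (-m).hom ⟨x, hx⟩ = (m.hom ⟨x, hx⟩)⁻¹ := rfl
    rw [h1, delta, dif_pos hx, h2, mul_assoc, ← Units.val_mul, mul_inv_cancel, Units.val_one,
      mul_one]
  · rw [delta_of_notMem _ hx, mul_zero]

lemma sum_mul_delta_neg [Fintype G] {m : Chars k A} {f : G → k} (hf : f ∈ weightFun m) :
    ∑ x, f x * delta (-m) x = (Nat.card A : k) * f 1 := by
  classical
  simp only [mul_delta_neg hf]
  rw [← Finset.sum_filter, Finset.sum_const, nsmul_eq_mul, Nat.card_eq_fintype_card,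
    Fintype.card_subtype]

lemma shift_mem {m : Chars k A} {f : G → k} (hf : f ∈ weightFun m) (g : G) :
    shift g f ∈ weightFun m := by
  intro h a
  simpa [shift, mul_assoc] using hf (g⁻¹ * h) a

variable [Fintype G] [CharZero k]

lemma antip_charIdem (m : Chars k A) : antip (charIdem m) = charIdem (-m) := by
  have := Fintype.ofFinite A
  simp only [charIdem, finsum_eq_sum_of_fintype, map_smul, map_sum, antip_grp]
  congr 1
  refine Fintype.sum_equiv (Equiv.inv A) _ _ fun a => ?_
  have h1 : (-m).hom a⁻¹ = m.hom a := by
    change (m.hom a⁻¹)⁻¹ = m.hom a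
    rw [map_inv, inv_inv]
  simp [h1]

/-! ### Nondegeneracy of the pairing of opposite weights -/

variable (J : DynamicalTwist k A)

/-- The inverse of `J(λ)`. -/
def invJ (l : Chars k A) : GA k G ⊗[k] GA k G := ((J.isUnit l).unit⁻¹ : (GA k G ⊗[k] GA k G)ˣ)

lemma mul_invJ (l : Chars k A) : J.toFun l * invJ J l = 1 := (J.isUnit l).mul_val_inv

lemma invJ_mul (l : Chars k A) : invJ J l * J.toFun l = 1 := (J.isUnit l).val_inv_mul

lemma invJ_zero_weight (l : Chars k A) (a : A) :
    (grp k (a : G) ⊗ₜ[k] grp k (a : G)) * invJ J l =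
      invJ J l * (grp k (a : G) ⊗ₜ[k] grp k (a : G)) := by
  have h1 := congrArg (fun z => invJ J l * z * invJ J l) (J.zero_weight l a)
  simp only [mul_assoc, mul_invJ, mul_one] at h1
  rw [← mul_assoc (invJ J l) (J.toFun l), invJ_mul, one_mul] at h1
  exact h1.symm

/-- The dynamical equation is multiplied on the right by `1 ⊗ J(λ)⁻¹` and contracted by `x ⊗ y ⊗ z ↦
S(x) y S(z)`; the counit normalizations dispose of the remaining factors. -/
lemma sum_leftContr_mul_rightContr [Fintype (Chars k A)] (l : Chars k A) :
    ∑ m, leftContr (J.toFun (l - m)) * rightContr (invJ J l) * antip (charIdem m) = 1 := by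
  have h := congrArg (fun z => tripleContr (z * ((1 : GA k G) ⊗ₜ[k] invJ J l))) (J.dynamical l)
  have h1 : ((1 : GA k G) ⊗ₜ[k] J.toFun l) * ((1 : GA k G) ⊗ₜ[k] invJ J l) = 1 := by
    rw [Algebra.TensorProduct.tmul_mul_tmul, mul_invJ, one_mul]
    rfl
  have ha : antip (1 : GA k G) = 1 := by rw [← grp_one, antip_grp, inv_one]
  simp only [mul_assoc] at h
  rw [h1, mul_one, tripleContr_comul_right, J.counit_right, ha, finsum_eq_sum_of_fintype,
    Finset.mul_sum, map_sum, Finset.sum_mul, map_sum] at h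
  simp only [tripleContr_assoc, J.counit_left, ha, mul_one] at h
  exact h

/-- The antipode sends `P_m` to `P_{-m}`, and a function of weight `n` sees only `P_n`. In the
preceding identity at `λ = l - n` just the term `m = -n` survives, and it contains `J(l)`. -/
lemma linExt_mul_leftContr_mul_rightContr (l : Chars k A) {n : Chars k A} {f : G → k}
    (hf : f ∈ weightFun n) (y : GA k G) :
    linExt f (y * (leftContr (J.toFun l) * rightContr (invJ J (l - n)))) = linExt f y := by
  classical
  have := Fintype.ofFinite (Chars k A)
  have h := congrArg (fun z => linExt f (y * z)) (sum_leftContr_mul_rightContr J (l - n))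
  simp only [Finset.mul_sum, map_sum, antip_charIdem, ← mul_assoc, linExt_mul_charIdem hf,
    mul_one, eq_neg_iff_add_eq_zero, add_eq_zero_iff_neg_eq, Finset.sum_ite_eq,
    Finset.mem_univ, if_true] at h
  rw [sub_neg_eq_add, sub_add_cancel] at h
  rw [← mul_assoc]
  exact h

/-- The pairing of functions of opposite weights given by the product and the sum of values is
nondegenerate. -/
lemma exists_sum_tw_ne_zero (l : Chars k A) {n : Chars k A} {f : G → k} (hf : f ∈ weightFun n)
    (hf0 : f ≠ 0) :
    ∃ f' ∈ (weightFun (-n) : Submodule k (G → k)), ∑ g, tw (J.toFun l) f f' g ≠ 0 := by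
  obtain ⟨x, hx⟩ := Function.ne_iff.1 hf0
  -- Pairing `f` with this translate under plain summation of products gives `|A| f(x)`. Right
  -- translation of `h` by `R` compensates the factor `leftContr (J l)` produced by `sum_pair_grp`.
  set h : G → k := shift x (delta (-n)) with hh
  have hhm : h ∈ weightFun (-n) := shift_mem (delta_mem _) x
  set R := rightContr (invJ J (l - -n))
  have hl : linExt (fun y => linExt h (grp k y * R)) = linExt h ∘ₗ LinearMap.mulRight k R :=
    hom_ext_grp (by intro g; simp)
  refine ⟨fun y => linExt h (grp k y * R), ?_, ?_⟩
  · intro g a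
    change linExt h (grp k (g * a) * R) = linExt h (grp k g * R) * _
    rw [← grp_mul, mul_assoc, rightContr_comm (a : G) (invJ_zero_weight J _ a), ← mul_assoc,
      linExt_mul_grp hhm]
  · simp only [tw]
    rw [sum_pair_grp, hl]
    simp only [LinearMap.comp_apply, LinearMap.mulRight_apply, mul_assoc]
    simp only [R, linExt_mul_leftContr_mul_rightContr J l hhm, linExt_grp]
    have h1 : ∑ g, f g * h g = ∑ g, shift x⁻¹ f g * delta (-n) g := by
      refine Fintype.sum_equiv (Equiv.mulLeft x⁻¹) _ _ fun g => ?_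
      simp [shift, hh]
    rw [h1, sum_mul_delta_neg (shift_mem hf _)]
    refine mul_ne_zero (by exact_mod_cast Nat.card_pos.ne') ?_
    simpa [shift] using hx

end DynTwist

end

open scoped TensorProduct

noncomputable section

set_option linter.unusedSectionVars false

namespace DynTwist

universe u v

variable {k : Type u} [Field k] {G : Type v} [Group G] {A : Subgroup G}

/-! ### The category algebra of a twist -/

/-- `tw x` as a bilinear map. -/
def twBilin (x : GA k G ⊗[k] GA k G) : (G → k) →ₗ[k] (G → k) →ₗ[k] (G → k) :=
  LinearMap.mk₂ k (tw x)
    (by intro f f' h; funext g; simp [tw, pair_add_left])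
    (by intro c f h; funext g; simp [tw, pair_smul_left])
    (by intro f h h'; funext g; simp [tw, pair_add_right])
    (by intro c f h; funext g; simp [tw, pair_smul_right])

lemma twBilin_apply (x : GA k G ⊗[k] GA k G) (f f' : G → k) : twBilin x f f' = tw x f f' := rfl

lemma tw_zero_right (x : GA k G ⊗[k] GA k G) (f : G → k) : tw x f 0 = 0 :=
  (twBilin x f).map_zero

lemma tw_zero_left (x : GA k G ⊗[k] GA k G) (f : G → k) : tw x 0 f = 0 :=
  LinearMap.map_zero₂ (twBilin x) f

variable (k A) in
/-- Matrices whose entry in position `(λ, μ)` lies in `F_{μ-λ}[G]`. -/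
def catSubmodule : Submodule k (Chars k A → Chars k A → G → k) where
  carrier := {x | ∀ l m, x l m ∈ (weightFun (m - l) : Submodule k (G → k))}
  add_mem' hx hy l m := Submodule.add_mem _ (hx l m) (hy l m)
  zero_mem' _ _ := Submodule.zero_mem _
  smul_mem' c _ hx l m := Submodule.smul_mem _ c (hx l m)

/-- The algebra `⨁_{λ, μ} F_{μ-λ}[G]` of the category with objects `λ ∈ A^*`, morphism spaces
`F_{μ-λ}[G]` and compositions `F_{μ-λ}[G] ⊗ F_{ν-μ}[G] → F_{ν-λ}[G]` given by `J(ν)`. -/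
def CatAlg (_J : DynamicalTwist k A) : Type (max u v) := catSubmodule k A

variable {J : DynamicalTwist k A}

namespace CatAlg

instance : AddCommGroup (CatAlg J) := inferInstanceAs (AddCommGroup (catSubmodule k A))

instance : Module k (CatAlg J) := inferInstanceAs (Module k (catSubmodule k A))

/-- The entries of an element of the category algebra. -/
def val : CatAlg J →ₗ[k] (Chars k A → Chars k A → G → k) := (catSubmodule k A).subtype

lemma val_mem (x : CatAlg J) (l m : Chars k A) : val x l m ∈ weightFun (m - l) := x.2 l m

lemma ext {x y : CatAlg J} (h : ∀ l m, val x l m = val y l m) : x = y :=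
  Subtype.ext (funext fun l => funext fun m => h l m)

instance [Finite G] : Module.Finite k (CatAlg J) :=
  inferInstanceAs (Module.Finite k (catSubmodule k A))

variable [Finite G]

instance : Fintype (Chars k A) := Fintype.ofFinite _

instance : Mul (CatAlg J) :=
  ⟨fun x y => ⟨fun l n => ∑ m, tw (J.toFun n) (val x l m) (val y m n), fun l n =>
    Submodule.sum_mem _ fun m _ => by
      have := tw_mem J n (val_mem x l m) (val_mem y m n)
      rwa [add_comm, sub_add_sub_cancel] at this⟩⟩

lemma val_mul (x y : CatAlg J) (l n : Chars k A) :
    val (x * y) l n = ∑ m, tw (J.toFun n) (val x l m) (val y m n) := rfl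

open Classical in
variable (J) in
/-- The matrix with a single entry. -/
def single (l m : Chars k A) (f : (weightFun (m - l) : Submodule k (G → k))) : CatAlg J :=
  ⟨fun l' m' => if l' = l ∧ m' = m then (f : G → k) else 0, by
    intro l' m'
    dsimp only
    split_ifs with h
    · obtain ⟨rfl, rfl⟩ := h
      exact f.2
    · exact Submodule.zero_mem _⟩

open Classical in
lemma val_single (l m l' m' : Chars k A) (f : (weightFun (m - l) : Submodule k (G → k))) :
    val (single J l m f) l' m' = if l' = l ∧ m' = m then (f : G → k) else 0 := rfl

lemma val_single_self (l m : Chars k A) (f : (weightFun (m - l) : Submodule k (G → k))) :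
    val (single J l m f) l m = f := by
  rw [val_single, if_pos ⟨rfl, rfl⟩]

variable (J) in
/-- The inclusion of the algebra `B_λ` as a diagonal corner. -/
def incl (l : Chars k A) : B J l →ₗ[k] CatAlg J where
  toFun b := single J l l ⟨B.val b, by rw [sub_self]; exact B.val_mem b⟩
  map_add' b b' := by
    refine CatAlg.ext fun l' m' => ?_
    rw [LinearMap.map_add val (single J l l _), Pi.add_apply, Pi.add_apply, val_single, val_single, val_single]
    split_ifs
    · rfl
    · rw [add_zero]
  map_smul' c b := by
    refine CatAlg.ext fun l' m' => ?_
    rw [LinearMap.map_smul val _ (single J l l _), Pi.smul_apply, Pi.smul_apply, val_single, val_single]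
    split_ifs
    · rfl
    · rw [smul_zero]

open Classical in
lemma val_incl (l l' m' : Chars k A) (b : B J l) :
    val (incl J l b) l' m' = if l' = l ∧ m' = l then B.val b else 0 := rfl

lemma val_incl_self (l : Chars k A) (b : B J l) : val (incl J l b) l l = B.val b := by
  rw [val_incl, if_pos ⟨rfl, rfl⟩]

lemma incl_injective (l : Chars k A) : Function.Injective (incl J l) := by
  intro b b' h
  apply B.val_injective
  rw [← val_incl_self, h, val_incl_self]

variable [CharZero k]

open Classical in
lemma val_incl_mul (l l' m' : Chars k A) (b : B J l) (x : CatAlg J) :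
    val (incl J l b * x) l' m' =
      if l' = l then tw (J.toFun m') (B.val b) (val x l m') else 0 := by
  rw [val_mul, Finset.sum_eq_single l]
  · rw [val_incl]
    split_ifs with h1 h2 h2
    · rfl
    · exact absurd h1.1 h2
    · exact absurd ⟨h2, rfl⟩ h1
    · rw [tw_zero_left]
  · intro m _ hm
    rw [val_incl, if_neg (fun h => hm h.2), tw_zero_left]
  · intro h; exact absurd (Finset.mem_univ _) h

open Classical in
lemma val_mul_incl (l l' m' : Chars k A) (b : B J l) (x : CatAlg J) :
    val (x * incl J l b) l' m' =
      if m' = l then tw (J.toFun l) (val x l' l) (B.val b) else 0 := by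
  rw [val_mul, Finset.sum_eq_single l]
  · rw [val_incl]
    split_ifs with h1 h2 h2
    · rw [h2]
    · exact absurd h1.2 h2
    · exact absurd ⟨rfl, h2⟩ h1
    · rw [tw_zero_right]
  · intro m _ hm
    rw [val_incl, if_neg (fun h => hm h.1), tw_zero_right]
  · intro h; exact absurd (Finset.mem_univ _) h

variable (J) in
/-- The unit of `B_λ` in the category algebra. -/
def idem (l : Chars k A) : CatAlg J := incl J l 1

open Classical in
lemma val_idem_mul (l l' m' : Chars k A) (x : CatAlg J) :
    val (idem J l * x) l' m' = if l' = l then val x l' m' else 0 := by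
  rw [idem, val_incl_mul, B.val_one, one_tw]
  split_ifs with h
  · rw [h]
  · rfl

open Classical in
lemma val_mul_idem (l l' m' : Chars k A) (x : CatAlg J) :
    val (x * idem J l) l' m' = if m' = l then val x l' m' else 0 := by
  rw [idem, val_mul_incl, B.val_one, tw_one]
  split_ifs with h
  · rw [h]
  · rfl

instance : One (CatAlg J) := ⟨∑ l, idem J l⟩

lemma one_def : (1 : CatAlg J) = ∑ l, idem J l := rfl

/-- In column `p` the entry of `z` in row `n` has weight `p - n`, so `tw_assoc` shifts `J(p)` to
`J(p - (p - n)) = J(n)`, which is the element used to multiply `x` and `y` into column `n`. -/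
protected lemma mul_assoc (x y z : CatAlg J) : x * y * z = x * (y * z) := by
  refine CatAlg.ext fun l p => ?_
  simp only [val_mul, ← twBilin_apply, map_sum, LinearMap.sum_apply]
  rw [Finset.sum_comm]
  refine Finset.sum_congr rfl fun m _ => Finset.sum_congr rfl fun n _ => ?_
  simp only [twBilin_apply]
  have := tw_assoc J p (p - n) (val x l m) (val y m n) (val_mem z n p)
  rwa [sub_sub_cancel] at this

protected lemma add_mul (x y z : CatAlg J) : (x + y) * z = x * z + y * z := by
  refine CatAlg.ext fun l m => ?_
  simp only [val_mul, ← twBilin_apply, map_add, Pi.add_apply, LinearMap.add_apply,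
    Finset.sum_add_distrib]

protected lemma mul_add (x y z : CatAlg J) : x * (y + z) = x * y + x * z := by
  refine CatAlg.ext fun l m => ?_
  simp only [val_mul, ← twBilin_apply, map_add, Pi.add_apply, Finset.sum_add_distrib]

protected lemma zero_mul (x : CatAlg J) : 0 * x = 0 := by
  refine CatAlg.ext fun l m => ?_
  simp only [val_mul, ← twBilin_apply, map_zero, Pi.zero_apply, LinearMap.zero_apply,
    Finset.sum_const_zero]

protected lemma mul_zero (x : CatAlg J) : x * 0 = 0 := by
  refine CatAlg.ext fun l m => ?_
  simp only [val_mul, ← twBilin_apply, map_zero, Pi.zero_apply, Finset.sum_const_zero]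

protected lemma one_mul (x : CatAlg J) : 1 * x = x := by
  have h : ∀ s : Finset (Chars k A), (∑ l ∈ s, idem J l) * x = ∑ l ∈ s, idem J l * x := by
    classical
    intro s
    induction s using Finset.induction_on with
    | empty => simp [CatAlg.zero_mul]
    | insert l s hl ih => rw [Finset.sum_insert hl, CatAlg.add_mul, ih, Finset.sum_insert hl]
  refine CatAlg.ext fun l m => ?_
  rw [one_def, h, map_sum, Finset.sum_apply, Finset.sum_apply]
  simp only [val_idem_mul]
  rw [Finset.sum_eq_single l (fun c _ hc => if_neg (Ne.symm hc))
    (fun h => absurd (Finset.mem_univ _) h), if_pos rfl]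

protected lemma mul_one (x : CatAlg J) : x * 1 = x := by
  have h : ∀ s : Finset (Chars k A), x * (∑ l ∈ s, idem J l) = ∑ l ∈ s, x * idem J l := by
    classical
    intro s
    induction s using Finset.induction_on with
    | empty => simp [CatAlg.mul_zero]
    | insert l s hl ih => rw [Finset.sum_insert hl, CatAlg.mul_add, ih, Finset.sum_insert hl]
  refine CatAlg.ext fun l m => ?_
  rw [one_def, h, map_sum, Finset.sum_apply, Finset.sum_apply]
  simp only [val_mul_idem]
  rw [Finset.sum_eq_single m (fun c _ hc => if_neg (Ne.symm hc))
    (fun h => absurd (Finset.mem_univ _) h), if_pos rfl]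

instance : Ring (CatAlg J) :=
  { (inferInstance : AddCommGroup (CatAlg J)), (inferInstance : Mul (CatAlg J)),
    (inferInstance : One (CatAlg J)) with
    left_distrib := CatAlg.mul_add
    right_distrib := CatAlg.add_mul
    zero_mul := CatAlg.zero_mul
    mul_zero := CatAlg.mul_zero
    mul_assoc := CatAlg.mul_assoc
    one_mul := CatAlg.one_mul
    mul_one := CatAlg.mul_one }

instance : Algebra k (CatAlg J) :=
  Algebra.ofModule
    (by
      intro c x y
      refine CatAlg.ext fun l m => ?_
      simp only [val_mul, ← twBilin_apply, map_smul, Pi.smul_apply, LinearMap.smul_apply,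
        Finset.smul_sum])
    (by
      intro c x y
      refine CatAlg.ext fun l m => ?_
      simp only [val_mul, ← twBilin_apply, map_smul, Pi.smul_apply, Finset.smul_sum])

instance : SMul G (CatAlg J) := ⟨fun g x => ⟨fun l m => shift g (val x l m), fun l m =>
  shift_mem (val_mem x l m) g⟩⟩

lemma val_smul (g : G) (x : CatAlg J) (l m : Chars k A) :
    val (g • x) l m = shift g (val x l m) := rfl

lemma smul_incl (g : G) (l : Chars k A) (b : B J l) : g • incl J l b = incl J l (g • b) := by
  refine CatAlg.ext fun l' m' => ?_
  rw [val_smul, val_incl, val_incl, B.val_smul]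
  split_ifs
  · rfl
  · rfl

/-- Translation by `g` as a linear map on functions. -/
def shiftLin (g : G) : (G → k) →ₗ[k] (G → k) := LinearMap.funLeft k k (g⁻¹ * ·)

lemma shiftLin_apply (g : G) (f : G → k) : shiftLin g f = shift g f := rfl

lemma smul_idem (g : G) (l : Chars k A) : g • idem J l = idem J l := by
  rw [idem, smul_incl, smul_one]

protected lemma smul_add' (g : G) (x y : CatAlg J) : g • (x + y) = g • x + g • y := by
  refine CatAlg.ext fun l m => ?_
  simp only [val_smul, map_add, Pi.add_apply, ← shiftLin_apply]

instance : MulSemiringAction G (CatAlg J) where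
  one_smul x := by
    refine CatAlg.ext fun l m => ?_
    rw [val_smul]
    funext y
    simp [shift]
  mul_smul g h x := by
    refine CatAlg.ext fun l m => ?_
    simp only [val_smul]
    funext y
    simp [shift, mul_assoc]
  smul_zero g := by
    refine CatAlg.ext fun l m => ?_
    simp only [val_smul, map_zero, Pi.zero_apply, ← shiftLin_apply]
  smul_add := CatAlg.smul_add'
  smul_one g := by
    have h : ∀ s : Finset (Chars k A), g • (∑ l ∈ s, idem J l) = ∑ l ∈ s, idem J l := by
      classical
      intro s
      induction s using Finset.induction_on with
      | empty =>
        refine CatAlg.ext fun l m => ?_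
        simp only [Finset.sum_empty, val_smul, map_zero, Pi.zero_apply, ← shiftLin_apply]
      | insert l s hl ih => rw [Finset.sum_insert hl, CatAlg.smul_add', ih, smul_idem]
    exact h _
  smul_mul g x y := by
    refine CatAlg.ext fun l m => ?_
    simp only [val_smul, val_mul, tw_shift]
    simp only [← shiftLin_apply, map_sum]

instance : SMulCommClass G k (CatAlg J) where
  smul_comm g c x := by
    refine CatAlg.ext fun l m => ?_
    simp only [val_smul, map_smul, Pi.smul_apply, ← shiftLin_apply]

lemma incl_mul (l : Chars k A) (b b' : B J l) : incl J l (b * b') = incl J l b * incl J l b' := by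
  refine CatAlg.ext fun l' m' => ?_
  rw [val_incl_mul, val_incl, val_incl]
  by_cases hl : l' = l
  · by_cases hm : m' = l
    · subst hl hm
      simp [B.val_mul]
    · simp [hm, tw_zero_right]
  · simp [hl]

lemma incl_one (l : Chars k A) : incl J l 1 = idem J l := rfl

lemma idem_mul_incl (l : Chars k A) (b : B J l) : idem J l * incl J l b = incl J l b := by
  rw [← incl_one, ← incl_mul, one_mul]

lemma incl_mul_idem (l : Chars k A) (b : B J l) : incl J l b * idem J l = incl J l b := by
  rw [← incl_one, ← incl_mul, mul_one]

lemma idem_mul_self (l : Chars k A) : idem J l * idem J l = idem J l := by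
  nth_rw 2 [← incl_one]
  rw [idem_mul_incl, incl_one]

lemma idem_mul_single (l m : Chars k A) (f : (weightFun (m - l) : Submodule k (G → k))) :
    idem J l * single J l m f = single J l m f := by
  refine CatAlg.ext fun l' m' => ?_
  rw [val_idem_mul, val_single]
  split_ifs with h1 h2 h2
  · rfl
  · rfl
  · exact absurd h2.1 h1
  · rfl

lemma single_mul_idem (l m : Chars k A) (f : (weightFun (m - l) : Submodule k (G → k))) :
    single J l m f * idem J m = single J l m f := by
  refine CatAlg.ext fun l' m' => ?_
  rw [val_mul_idem, val_single]
  split_ifs with h1 h2 h2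
  · rfl
  · rfl
  · exact absurd h2.2 h1
  · rfl

lemma eq_single_of_mul_eq {l m : Chars k A} {x : CatAlg J} (hl : idem J l * x = x)
    (hm : x * idem J m = x) : x = single J l m ⟨val x l m, val_mem x l m⟩ := by
  refine CatAlg.ext fun l' m' => ?_
  rw [val_single]
  split_ifs with h
  · rw [h.1, h.2]
  · rw [not_and_or] at h
    rcases h with h | h
    · rw [← hl, val_idem_mul, if_neg h]
    · rw [← hm, val_mul_idem, if_neg h]

lemma exists_incl_eq {l : Chars k A} {x : CatAlg J} (hl : idem J l * x = x)
    (hm : x * idem J l = x) : ∃ b, incl J l b = x := by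
  refine ⟨⟨val x l l, ?_⟩, (eq_single_of_mul_eq hl hm).symm⟩
  have := val_mem x l l
  rwa [sub_self] at this

/-- Left translations are transitive on `G`, so an invariant function is constant, equal to its
value at 1. -/
lemma exists_eq_smul_one {l : Chars k A} {b : B J l} (hb : ∀ g : G, g • b = b) :
    ∃ c : k, b = c • 1 := by
  refine ⟨B.val b 1, B.val_injective (funext fun x => ?_)⟩
  have h1 := congrFun (congrArg B.val (hb x)) x
  rw [B.val_smul, shift, inv_mul_cancel] at h1
  rw [map_smul, B.val_one, ← h1]
  simp

variable (J) in
-- Diagonal corners are the `B_λ`, whose invariants are constants; the function `delta` shows that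
-- no `F_{μ-λ}[G]` is zero.
lemma isConnectedSystem : IsConnectedSystem k G (idem J) where
  mul_self := idem_mul_self
  sum := rfl
  smul := smul_idem
  inv l x hl hr hx := by
    obtain ⟨b, rfl⟩ := exists_incl_eq hl hr
    obtain ⟨c, rfl⟩ := exists_eq_smul_one (b := b) (fun g => incl_injective l (by
      rw [← smul_incl, hx]))
    exact ⟨c, by rw [map_smul, incl_one]⟩
  conn l m := by
    refine ⟨single J l m ⟨delta (m - l), delta_mem _⟩, ?_⟩
    rw [idem_mul_single, single_mul_idem]
    intro h
    have h1 := congrFun (congrFun (congrFun (congrArg val h) l) m) 1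
    rw [val_single_self, Subtype.coe_mk, delta_one] at h1
    simp at h1

/-! ### Semisimplicity -/

lemma trace_smul (g : G) (x : CatAlg J) :
    LinearMap.trace k _ (LinearMap.mulLeft k (g • x)) =
      LinearMap.trace k _ (LinearMap.mulLeft k x) := by
  let e : CatAlg J ≃ₗ[k] CatAlg J := (MulSemiringAction.toAlgEquiv k (CatAlg J) g).toLinearEquiv
  have he : LinearMap.mulLeft k (g • x) = e.conj (LinearMap.mulLeft k x) := by
    refine LinearMap.ext fun y => ?_
    obtain ⟨y, rfl⟩ := e.surjective y
    rw [LinearEquiv.conj_apply_apply, LinearEquiv.symm_apply_apply]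
    exact (smul_mul' g x y).symm
  rw [he, LinearMap.trace_conj']

lemma trace_mul_comm (x y : CatAlg J) :
    LinearMap.trace k _ (LinearMap.mulLeft k (x * y)) =
      LinearMap.trace k _ (LinearMap.mulLeft k (y * x)) := by
  rw [LinearMap.mulLeft_mul, LinearMap.mulLeft_mul]
  exact LinearMap.trace_mul_comm k _ _

lemma trace_eq_zero_of_isNilpotent {x : CatAlg J} (hx : IsNilpotent x) :
    LinearMap.trace k _ (LinearMap.mulLeft k x) = 0 := by
  obtain ⟨n, hn⟩ := hx
  refine (LinearMap.isNilpotent_trace_of_isNilpotent ⟨n, ?_⟩).eq_zero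
  rw [LinearMap.pow_mulLeft, hn, LinearMap.mulLeft_zero_eq_zero]

/-- In characteristic zero an idempotent operator of trace zero vanishes, and `idem J l` is nonzero.
-/
lemma trace_idem_ne_zero (l : Chars k A) :
    LinearMap.trace k _ (LinearMap.mulLeft k (idem J l)) ≠ 0 := by
  intro h
  have h1 : IsIdempotentElem (LinearMap.mulLeft k (idem J l)) := by
    change _ ∘ₗ _ = _
    rw [← LinearMap.mulLeft_mul, idem_mul_self]
  have h2 := LinearMap.congr_fun (LinearMap.IsIdempotentElem.eq_zero_of_trace_eq_zero h1 h) (idem J l)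
  obtain ⟨x, hx⟩ := (isConnectedSystem J).conn l l
  apply hx
  rw [LinearMap.mulLeft_apply, idem_mul_self, LinearMap.zero_apply] at h2
  rw [h2, zero_mul, zero_mul]

/-- The translates of `b` sum to the constant function `∑ b`. As the trace is invariant, `|G|` times
the trace of `b` is `∑ b` times the nonzero trace of the idempotent. -/
lemma trace_incl_ne_zero [Fintype G] (l : Chars k A) {b : B J l} (hb : ∑ g, B.val b g ≠ 0) :
    LinearMap.trace k _ (LinearMap.mulLeft k (incl J l b)) ≠ 0 := by
  have h1 : ∑ g : G, g • b = (∑ g, B.val b g) • (1 : B J l) := by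
    apply B.val_injective
    funext x
    rw [map_sum, map_smul, B.val_one, Finset.sum_apply]
    simp only [B.val_smul, shift, Pi.smul_apply, Pi.one_apply, smul_eq_mul, mul_one]
    exact Fintype.sum_equiv ((Equiv.inv G).trans (Equiv.mulRight x)) _ _ (by simp)
  have h2 : ∑ g : G, LinearMap.trace k _ (LinearMap.mulLeft k (g • incl J l b)) =
      (∑ g, B.val b g) * LinearMap.trace k _ (LinearMap.mulLeft k (idem J l)) := by
    rw [← map_sum]
    have h3 : ∑ g : G, LinearMap.mulLeft k (g • incl J l b) =
        (∑ g, B.val b g) • LinearMap.mulLeft k (idem J l) := by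
      refine LinearMap.ext fun y => ?_
      rw [LinearMap.sum_apply, LinearMap.smul_apply]
      simp only [LinearMap.mulLeft_apply]
      rw [← Finset.sum_mul, ← smul_mul_assoc, ← incl_one, ← map_smul, ← h1, map_sum]
      simp only [smul_incl]
    rw [h3, map_smul, smul_eq_mul]
  intro h
  simp only [trace_smul, h, Finset.sum_const_zero] at h2
  exact mul_ne_zero hb (trace_idem_ne_zero l) h2.symm

instance : IsSemisimpleRing (CatAlg J) := by
  have := Fintype.ofFinite G
  have : IsArtinianRing (CatAlg J) := IsArtinianRing.of_finite k _
  refine isSemisimpleRing_of_forall_not_isNilpotent fun x hx => ?_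
  obtain ⟨l, m, hlm⟩ : ∃ l m, val x l m ≠ 0 := by
    by_contra! h
    exact hx (CatAlg.ext (by simpa using h))
  obtain ⟨f, hf, hsum⟩ := exists_sum_tw_ne_zero J l (val_mem x l m) hlm
  rw [neg_sub] at hf
  -- The function `f` is dual to the nonzero entry of `x`, so `idem J l * (x * y)` lies in `B_l`
  -- with nonzero sum of values. By cyclicity its trace is that of `x * y`, which is therefore not
  -- nilpotent.
  let y := single J m l ⟨f, hf⟩
  obtain ⟨b, hb⟩ : ∃ b, incl J l b = idem J l * (x * y) :=
    exists_incl_eq (by rw [← mul_assoc, idem_mul_self])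
      (by rw [mul_assoc, mul_assoc, single_mul_idem])
  have hbv : B.val b = tw (J.toFun l) (val x l m) f := by
    rw [← val_incl_self, hb, val_idem_mul, if_pos rfl, val_mul, Finset.sum_eq_single m]
    · rw [val_single_self]
    · intro m' _ hm'
      rw [val_single, if_neg (fun h => hm' h.1), tw_zero_right]
    · intro h; exact absurd (Finset.mem_univ _) h
  refine ⟨y, fun hn => trace_incl_ne_zero l (b := b) (by rwa [hbv]) ?_⟩
  rw [hb, trace_mul_comm, mul_assoc, single_mul_idem]
  exact trace_eq_zero_of_isNilpotent hn

end CatAlg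

variable [Finite G] [CharZero k]

instance (l : Chars k A) : Module.Finite k (B J l) :=
  inferInstanceAs (Module.Finite k (weightFun (0 : Chars k A) : Submodule k (G → k)))

instance (l : Chars k A) : IsSemisimpleRing (B J l) := by
  have := Fintype.ofFinite G
  have : IsArtinianRing (B J l) := IsArtinianRing.of_finite k _
  refine isSemisimpleRing_of_forall_not_isNilpotent fun x hx => ?_
  obtain ⟨f, hf, hsum⟩ := exists_sum_tw_ne_zero J l (B.val_mem x) (fun h => hx
    (B.val_injective (by rw [h, map_zero])))
  rw [neg_zero] at hf
  refine ⟨⟨f, hf⟩, fun ⟨n, hn⟩ => CatAlg.trace_incl_ne_zero l (b := x * ⟨f, hf⟩) hsum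
    (CatAlg.trace_eq_zero_of_isNilpotent ⟨n + 1, ?_⟩)⟩
  -- Only positive powers are compared, since the inclusion sends the unit of `B_l` to `idem J l`
  -- rather than to 1.
  have h : ∀ n, (CatAlg.incl J l (x * ⟨f, hf⟩)) ^ (n + 1) =
      CatAlg.incl J l ((x * ⟨f, hf⟩) ^ (n + 1)) := by
    intro n
    induction n with
    | zero => simp
    | succ n ih => rw [pow_succ, ih, pow_succ _ (n + 1), CatAlg.incl_mul]
  rw [h, pow_succ, hn, zero_mul, map_zero]

end DynTwist

end

open scoped TensorProduct

noncomputable section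

set_option linter.unusedSectionVars false

namespace DynTwist

universe u v

/-! ### Diagonal corners of a block as full endomorphism algebras -/

lemma BlockRep.exists_compress_eq {k : Type*} [Field k] {E : Type*} [Ring E] [Algebra k E]
    {ε : E} (T : BlockRep k ε) (h : IsPrimCentral ε) {a : E} (ha : a * a = a)
    (X : Module.End k (T.Comp a)) :
    ∃ x, ε * x = x ∧ a * x = x ∧ x * a = x ∧ T.compress x = X := by
  obtain ⟨t, ht⟩ := (dualTensorHomEquiv k (T.Comp a) (T.Comp a)).surjective X
  obtain ⟨h1, h2, h3⟩ := (T.range_fromTensor h ha ha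
    (T.fromTensor h a a ((TensorProduct.comm k _ _).symm t))).1 ⟨_, rfl⟩
  refine ⟨_, h1, h2, h3, LinearMap.ext fun v => Subtype.ext ?_⟩
  have ht' : dualTensorHom k (T.Comp a) (T.Comp a) t = X := ht
  rw [T.coe_compress h2, T.fromTensor_apply, T.map_sec, LinearEquiv.apply_symm_apply, ht',
    LinearMap.comp_apply, LinearMap.comp_apply, T.proj_coe ha]
  rfl

lemma BlockRep.eq_of_compress_eq {k : Type*} [Field k] {E : Type*} [Ring E] [Algebra k E]
    {ε : E} (T : BlockRep k ε) {a : E} {x y : E} (hx : ε * x = x) (hy : ε * y = y)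
    (hax : a * x = x) (hay : a * y = y) (hxa : x * a = x) (hya : y * a = y)
    (hxy : T.compress (a := a) x = T.compress y) : x = y := by
  refine T.eq_of_map_eq hx hy (LinearMap.ext fun v => ?_)
  have h1 := congrArg Subtype.val (LinearMap.congr_fun hxy (T.proj a v))
  rw [T.coe_compress hax, T.coe_compress hay, T.coe_proj, ← Module.End.mul_apply,
    ← Module.End.mul_apply, ← map_mul, ← map_mul, hxa, hya] at h1
  exact h1

variable {k : Type u} [Field k] {G : Type v} [Group G] {A : Subgroup G}

/-! ### Induction from `A` -/

variable (k) in
/-- The action of `G` on `F_μ[G]` by shifts. -/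
def weightRep (m : Chars k A) : Representation k G (weightFun m : Submodule k (G → k)) where
  toFun g := (CatAlg.shiftLin g).restrict fun _ hf => shift_mem hf g
  map_one' := LinearMap.ext fun f => Subtype.ext (funext fun x => by
    change (f : G → k) (1⁻¹ * x) = (f : G → k) x
    simp)
  map_mul' g h := LinearMap.ext fun f => Subtype.ext (funext fun x => by
    change (f : G → k) ((g * h)⁻¹ * x) = (f : G → k) (h⁻¹ * (g⁻¹ * x))
    rw [mul_inv_rev, mul_assoc])

lemma coe_weightRep (m : Chars k A) (g : G) (f : (weightFun m : Submodule k (G → k))) :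
    (weightRep k m g f : G → k) = shift g f := rfl

lemma shift_delta (n : Chars k A) (a : A) :
    shift (a : G) (delta n) = ((n.hom a : kˣ) : k)⁻¹ • delta n := by
  funext x
  rw [Pi.smul_apply, shift, smul_eq_mul]
  by_cases hx : x ∈ A
  · have h1 : (a : G)⁻¹ * x ∈ A := A.mul_mem (A.inv_mem a.2) hx
    have h2 : (⟨(a : G)⁻¹ * x, h1⟩ : A) = a⁻¹ * ⟨x, hx⟩ := rfl
    rw [delta, delta, dif_pos hx, dif_pos h1, h2, map_mul, map_inv, Units.val_mul,
      Units.val_inv_eq_inv_val]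
  · have h1 : (a : G)⁻¹ * x ∉ A := fun h => hx ((A.mul_mem_cancel_left (A.inv_mem a.2)).1 h)
    rw [delta_of_notMem _ hx, delta_of_notMem _ h1, mul_zero]

lemma delta_inv (n : Chars k A) (x : G) : delta n x⁻¹ = delta (-n) x := by
  by_cases hx : x ∈ A
  · have h1 : x⁻¹ ∈ A := A.inv_mem hx
    have h2 : (⟨x⁻¹, h1⟩ : A) = (⟨x, hx⟩ : A)⁻¹ := rfl
    rw [delta, delta, dif_pos hx, dif_pos h1, h2, map_inv]
    rfl
  · have h1 : x⁻¹ ∉ A := fun h => hx (by simpa using h)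
    rw [delta_of_notMem _ hx, delta_of_notMem _ h1]

/-- The line spanned by `delta (-m)` carries the character `m` of `A` under shifts, the inverse in
the shift accounting for the sign; evaluation at 1 is the retraction onto it. -/
lemma nonempty_ind_charRep_equiv [Finite G] [CharZero k] {m n : Chars k A} (hn : n = -m) :
    Nonempty ((Representation.ind A.subtype (charRep m)).Equiv (weightRep k n)) := by
  subst hn
  have := Fintype.ofFinite G
  refine nonempty_ind_equiv (charRep m) (weightRep k (-m))
    (LinearMap.toSpanSingleton k _ ⟨delta (-m), delta_mem _⟩)
    (LinearMap.proj (1 : G) ∘ₗ Submodule.subtype _) ?_ ?_ ?_ ?_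
  · intro a c
    apply Subtype.ext
    have h1 : (charRep m) a c = (m.hom a : k) * c := rfl
    have h2 : ((-m).hom a) = (m.hom a)⁻¹ := rfl
    rw [coe_weightRep, LinearMap.toSpanSingleton_apply, LinearMap.toSpanSingleton_apply,
      Submodule.coe_smul, Submodule.coe_smul, ← CatAlg.shiftLin_apply, map_smul,
      CatAlg.shiftLin_apply, shift_delta, h1, h2, smul_smul, mul_comm]
    simp
  · intro c
    change (c • delta (-m)) 1 = c
    rw [Pi.smul_apply, delta_one, smul_eq_mul, mul_one]
  · intro g hg c
    change (c • delta (-m)) (g⁻¹ * 1) = 0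
    rw [Pi.smul_apply, mul_one, delta_of_notMem _ (fun h => hg (by simpa using h)), smul_zero]
  · intro w
    apply Subtype.ext
    funext x
    rw [Submodule.coe_sum, Finset.sum_apply]
    change ∑ g, (w : G → k) (g⁻¹⁻¹ * 1) * delta (-m) (g⁻¹ * x) = (Nat.card A : k) * (w : G → k) x
    have h1 := sum_mul_delta_neg (shift_mem w.2 x⁻¹)
    simp only [shift, inv_inv, mul_one] at h1 ⊢
    rw [← h1]
    refine Fintype.sum_equiv (Equiv.mulLeft x⁻¹) _ _ fun g => ?_
    rw [← delta_inv]
    simp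

/-! ### Two-sided ideals cut out by central idempotents -/

section Blocks

open scoped Pointwise

variable [Finite G] [CharZero k] {J : DynamicalTwist k A} {ε : CatAlg J}

/-- The two-sided ideal of `B_λ` cut out by a central idempotent of the category algebra. -/
def blockIdeal (h : IsPrimCentral ε) (l : Chars k A) : TwoSidedIdeal (B J l) :=
  TwoSidedIdeal.mk' {b | ε * CatAlg.incl J l b = CatAlg.incl J l b}
    (by simp)
    (by
      intro b b' hb hb'
      simp only [Set.mem_ofPred_eq] at hb hb' ⊢
      rw [map_add, mul_add, hb, hb'])
    (by
      intro b hb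
      simp only [Set.mem_ofPred_eq] at hb ⊢
      rw [map_neg, mul_neg, hb])
    (by
      intro b b' hb
      simp only [Set.mem_ofPred_eq] at hb ⊢
      rw [CatAlg.incl_mul, ← mul_assoc, ← h.comm, mul_assoc, hb])
    (by
      intro b b' hb
      simp only [Set.mem_ofPred_eq] at hb ⊢
      rw [CatAlg.incl_mul, ← mul_assoc, hb])

lemma mem_blockIdeal {h : IsPrimCentral ε} {l : Chars k A} {b : B J l} :
    b ∈ blockIdeal h l ↔ ε * CatAlg.incl J l b = CatAlg.incl J l b :=
  TwoSidedIdeal.mem_mk' _ _ _ _ _ _ _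

lemma exists_incl_eq_idem (h : IsPrimCentral ε) (l : Chars k A) :
    ∃ b, CatAlg.incl J l b = ε * CatAlg.idem J l :=
  CatAlg.exists_incl_eq
    (by rw [← mul_assoc, h.comm, mul_assoc, CatAlg.idem_mul_self])
    (by rw [mul_assoc, CatAlg.idem_mul_self])

lemma blockIdeal_ne_bot (h : IsPrimCentral ε) (l : Chars k A) : blockIdeal h l ≠ ⊥ := by
  have := Fintype.ofFinite G
  obtain ⟨b, hb⟩ := exists_incl_eq_idem h l
  intro h0
  have h1 : b ∈ blockIdeal h l := by
    rw [mem_blockIdeal, hb, ← mul_assoc, h.mul_self]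
  rw [h0, TwoSidedIdeal.mem_bot] at h1
  rw [h1, map_zero] at hb
  exact (CatAlg.isConnectedSystem J).mul_ne_zero h l hb.symm

lemma coe_blockIdeal_smul (h : IsPrimCentral ε) (g : G) (l : Chars k A) :
    (blockIdeal (h.smul g) l : Set (B J l)) = g • (blockIdeal h l : Set (B J l)) := by
  ext b
  rw [Set.mem_smul_set_iff_inv_smul_mem, SetLike.mem_coe, SetLike.mem_coe, mem_blockIdeal,
    mem_blockIdeal, ← CatAlg.smul_incl]
  constructor
  · intro hb
    have := congrArg (g⁻¹ • ·) hb
    simpa [smul_mul'] using this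
  · intro hb
    have := congrArg (g • ·) hb
    simpa [smul_mul'] using this

lemma eq_of_blockIdeal_eq {ε' : CatAlg J} (h : IsPrimCentral ε) (h' : IsPrimCentral ε')
    {l : Chars k A} (hl : (blockIdeal h l : Set (B J l)) = blockIdeal h' l) : ε = ε' := by
  refine h.eq_of_mul_ne_zero h' fun h0 => blockIdeal_ne_bot h l ?_
  rw [eq_bot_iff]
  intro b hb
  have hb' : b ∈ blockIdeal h' l := by
    rw [← SetLike.mem_coe, ← hl]; exact hb
  rw [mem_blockIdeal] at hb hb'
  rw [TwoSidedIdeal.mem_bot]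
  apply CatAlg.incl_injective l
  rw [← hb, ← hb', ← mul_assoc, h0, zero_mul, map_zero]

/-- A block is determined by any one of its diagonal corners, so the stabilizer of the ideal is the
same for all `l`. -/
lemma stabilizer_blockIdeal (h : IsPrimCentral ε) (l : Chars k A) :
    MulAction.stabilizer G (blockIdeal h l : Set (B J l)) = MulAction.stabilizer G ε := by
  ext g
  rw [MulAction.mem_stabilizer_iff, MulAction.mem_stabilizer_iff, ← coe_blockIdeal_smul]
  constructor
  · intro hg
    exact eq_of_blockIdeal_eq _ _ hg
  · intro hg
    ext b
    rw [SetLike.mem_coe, SetLike.mem_coe, mem_blockIdeal, mem_blockIdeal, hg]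

lemma mem_blockBimodule_blockIdeal {ε' : CatAlg J} (h : IsPrimCentral ε) (h' : IsPrimCentral ε')
    {l m : Chars k A} {f : G → k} (hf : f ∈ blockBimodule J (blockIdeal h l) (blockIdeal h' m)) :
    ∃ x : CatAlg J, ε * x = x ∧ x * ε' = x ∧ CatAlg.idem J l * x = x ∧ x * CatAlg.idem J m = x ∧
      CatAlg.val x l m = f := by
  induction hf using Submodule.span_induction with
  | mem f hf =>
    obtain ⟨b, hb, f, hf, b', hb', rfl⟩ := hf
    rw [mem_blockIdeal] at hb hb'
    refine ⟨CatAlg.incl J l b * CatAlg.single J l m ⟨f, hf⟩ * CatAlg.incl J m b', ?_, ?_, ?_, ?_, ?_⟩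
    · rw [← mul_assoc, ← mul_assoc, hb]
    · rw [mul_assoc, h'.comm, hb']
    · rw [← mul_assoc, ← mul_assoc, CatAlg.idem_mul_incl]
    · rw [mul_assoc, CatAlg.incl_mul_idem]
    · rw [CatAlg.val_mul_incl, if_pos rfl, CatAlg.val_incl_mul, if_pos rfl,
        CatAlg.val_single_self]
  | zero => exact ⟨0, by simp⟩
  | add f f' _ _ hf hf' =>
    obtain ⟨x, h1, h2, h3, h4, rfl⟩ := hf
    obtain ⟨y, h1', h2', h3', h4', rfl⟩ := hf'
    exact ⟨x + y, by rw [mul_add, h1, h1'], by rw [add_mul, h2, h2'], by rw [mul_add, h3, h3'],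
      by rw [add_mul, h4, h4'], by rw [map_add]; rfl⟩
  | smul c f _ hf =>
    obtain ⟨x, h1, h2, h3, h4, rfl⟩ := hf
    exact ⟨c • x, by rw [mul_smul_comm, h1], by rw [smul_mul_assoc, h2],
      by rw [mul_smul_comm, h3], by rw [smul_mul_assoc, h4], by rw [map_smul]; rfl⟩

/-- The elements `ε e_l` and `ε e_m` belong to the two ideals and act on `x` as units. -/
lemma val_mem_blockBimodule (h : IsPrimCentral ε) {l m : Chars k A} {x : CatAlg J}
    (hε : ε * x = x) (hl : CatAlg.idem J l * x = x) (hm : x * CatAlg.idem J m = x) :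
    CatAlg.val x l m ∈ blockBimodule J (blockIdeal h l) (blockIdeal h m) := by
  obtain ⟨b, hb⟩ := exists_incl_eq_idem h l
  obtain ⟨b', hb'⟩ := exists_incl_eq_idem h m
  refine Submodule.subset_span ⟨b, ?_, CatAlg.val x l m, CatAlg.val_mem x l m, b', ?_, ?_⟩
  · rw [mem_blockIdeal, hb, ← mul_assoc, h.mul_self]
  · rw [mem_blockIdeal, hb', ← mul_assoc, h.mul_self]
  · have h1 : x = CatAlg.incl J l b * x * CatAlg.incl J m b' := by
      rw [hb, hb', mul_assoc ε, hl, hε, ← mul_assoc, h.comm, hε, hm]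
    conv_lhs => rw [h1]
    rw [CatAlg.val_mul_incl, if_pos rfl, CatAlg.val_incl_mul, if_pos rfl]

/-- Ideals corresponding to each other belong to the same block of the category algebra. -/
lemma eq_of_blockBimodule_ne_bot {ε' : CatAlg J} (h : IsPrimCentral ε) (h' : IsPrimCentral ε')
    {l m : Chars k A} (hlm : blockBimodule J (blockIdeal h l) (blockIdeal h' m) ≠ ⊥) :
    ε = ε' := by
  refine h.eq_of_mul_ne_zero h' fun h0 => hlm ?_
  rw [Submodule.eq_bot_iff]
  intro f hf
  obtain ⟨x, h1, h2, -, -, rfl⟩ := mem_blockBimodule_blockIdeal h h' hf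
  rw [← h1, ← h2, h'.comm, ← mul_assoc, h0, zero_mul, map_zero]
  rfl

/-- The ideal is identified by `compress` with the endomorphisms of the component, a simple algebra:
any rank-one operator is obtained from a nonzero one by multiplication on both sides. -/
lemma isAtom_blockIdeal (h : IsPrimCentral ε) (T : BlockRep k ε) (l : Chars k A) :
    IsAtom (blockIdeal h l) := by
  refine ⟨blockIdeal_ne_bot h l, fun N hN => ?_⟩
  by_contra hN0
  obtain ⟨b, hbN, hb0⟩ : ∃ b ∈ N, b ≠ 0 := by
    by_contra! hb
    exact hN0 (eq_bot_iff.2 fun b hbN => (TwoSidedIdeal.mem_bot _).2 (hb b hbN))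
  refine hN.not_ge ?_
  set ρ : B J l → Module.End k (T.Comp (CatAlg.idem J l)) :=
    fun b => T.compress (CatAlg.incl J l b) with hρ
  have hadd : ∀ b b', ρ (b + b') = ρ b + ρ b' := by
    intro b b'
    simp only [hρ, BlockRep.compress, map_add, LinearMap.comp_add, LinearMap.add_comp]
  have hmul : ∀ b b', ρ (b * b') = ρ b * ρ b' := by
    intro b b'
    refine LinearMap.ext fun v => Subtype.ext ?_
    rw [Module.End.mul_apply]
    simp only [hρ]
    rw [T.coe_compress (CatAlg.idem_mul_incl _ _), T.coe_compress (CatAlg.idem_mul_incl _ _),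
      T.coe_compress (CatAlg.idem_mul_incl _ _), CatAlg.incl_mul, map_mul, Module.End.mul_apply]
  have hinj : ∀ b ∈ blockIdeal h l, ∀ b' ∈ blockIdeal h l, ρ b = ρ b' → b = b' := by
    intro b hb b' hb' hbb
    rw [mem_blockIdeal] at hb hb'
    exact CatAlg.incl_injective l (T.eq_of_compress_eq hb hb' (CatAlg.idem_mul_incl _ _)
      (CatAlg.idem_mul_incl _ _) (CatAlg.incl_mul_idem _ _) (CatAlg.incl_mul_idem _ _) hbb)
  have hsurj : ∀ X, ∃ b, ρ b = X := by
    intro X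
    obtain ⟨x, -, h1, h2, rfl⟩ := T.exists_compress_eq h (CatAlg.idem_mul_self l) X
    obtain ⟨b, rfl⟩ := CatAlg.exists_incl_eq h1 h2
    exact ⟨b, rfl⟩
  have h0 : ρ 0 = 0 := by simp [hρ, BlockRep.compress]
  obtain ⟨v, hv⟩ : ∃ v, ρ b v ≠ 0 := by
    by_contra! hv
    refine hb0 (hinj b (hN.le hbN) 0 (TwoSidedIdeal.zero_mem _) ?_)
    rw [h0]
    exact LinearMap.ext hv
  obtain ⟨f, hf⟩ := Module.Projective.exists_dual_eq_one k hv
  have key : ∀ X, ∃ b ∈ N, ρ b = X := by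
    intro X
    obtain ⟨t, rfl⟩ := (dualTensorHomEquiv k _ _).surjective X
    induction t with
    | zero => exact ⟨0, TwoSidedIdeal.zero_mem _, by rw [h0, map_zero]⟩
    | add s t hs ht =>
      obtain ⟨b, hb, hb'⟩ := hs
      obtain ⟨c, hc, hc'⟩ := ht
      exact ⟨b + c, N.add_mem hb hc, by rw [hadd, hb', hc', map_add]⟩
    | tmul f' w =>
      obtain ⟨c, hc⟩ := hsurj (f.smulRight w)
      obtain ⟨c', hc'⟩ := hsurj (f'.smulRight v)
      refine ⟨c * b * c', N.mul_mem_right _ _ (N.mul_mem_left _ _ hbN), ?_⟩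
      rw [hmul, hmul, hc, hc']
      refine LinearMap.ext fun u => ?_
      rw [dualTensorHomEquiv, LinearEquiv.ofBijective_apply, dualTensorHom_apply]
      simp [Module.End.mul_apply, hf]
  intro c hc
  obtain ⟨b', hb', hcb⟩ := key (ρ c)
  rwa [← hinj b' (hN.le hb') c hc hcb]

variable [IsAlgClosed k]

/-- Some block idempotent `ε` satisfies `ε b ≠ 0` for a nonzero `b ∈ I`. Then `ε b` lies both in `I`
and in the ideal of that block, and distinct minimal ideals meet in zero. -/
lemma exists_blockIdeal_eq {l : Chars k A} {I : TwoSidedIdeal (B J l)} (hI : IsAtom I) :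
    ∃ (ε : CatAlg J) (h : IsPrimCentral ε), I = blockIdeal h l := by
  obtain ⟨b, hbI, hb0⟩ : ∃ b ∈ I, b ≠ 0 := by
    by_contra! hb
    exact hI.1 (eq_bot_iff.2 fun b hbN => (TwoSidedIdeal.mem_bot _).2 (hb b hbN))
  obtain ⟨ε, h, hne, ⟨T⟩⟩ := exists_blockRep_of_ne_zero (k := k) (x := CatAlg.incl J l b)
    (fun h0 => hb0 (CatAlg.incl_injective l (by rw [h0, map_zero])))
  refine ⟨ε, h, ?_⟩
  by_contra hne'
  have h1 := (hI.disjoint_of_ne (isAtom_blockIdeal h T l) hne').eq_bot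
  obtain ⟨c, hc⟩ := exists_incl_eq_idem h l
  have h2 : CatAlg.incl J l (c * b) = ε * CatAlg.incl J l b := by
    rw [CatAlg.incl_mul, hc, mul_assoc, CatAlg.idem_mul_incl]
  have h3 : c * b ∈ I ⊓ blockIdeal h l := by
    refine (TwoSidedIdeal.mem_inf _).2 ⟨I.mul_mem_left _ _ hbI, ?_⟩
    rw [mem_blockIdeal, h2, ← mul_assoc, h.mul_self]
  rw [h1, TwoSidedIdeal.mem_bot] at h3
  rw [h3, map_zero] at h2
  exact hne h2.symm

end Blocks

end DynTwist

end

open scoped TensorProduct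

noncomputable section

set_option linter.unusedSectionVars false

namespace DynTwist

universe u v

/-! ### Induction from tensor products `V ⊗ W^*` -/

section IsInducedFrom

variable {k : Type*} [Field k] {G : Type*} [Group G] {H : Subgroup G} {V W : Type*}
  [AddCommGroup V] [Module k V] [AddCommGroup W] [Module k W] {U : Type*} [AddCommGroup U]
  [Module k U]

/-- The representation `τ` of `G` is induced from the representation `σ` of `H` on `V ⊗ W^*`. -/
def IsInducedFrom (σ : Representation k H (V ⊗[k] Module.Dual k W)) (τ : Representation k G U) :
    Prop :=
  Nonempty ((Representation.ind H.subtype σ).Equiv τ)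

lemma isInducedFrom_of_sum_eq [CharZero k] [Fintype G]
    (σ : Representation k H (V ⊗[k] Module.Dual k W)) (τ : Representation k G U)
    (i : V ⊗[k] Module.Dual k W →ₗ[k] U) (r : U →ₗ[k] V ⊗[k] Module.Dual k W)
    (hi : ∀ h u, i (σ h u) = τ h (i u)) (hri : ∀ u, r (i u) = u)
    (h0 : ∀ g ∉ H, ∀ u, r (τ g (i u)) = 0)
    (hsum : ∀ w, ∑ g, τ g (i (r (τ g⁻¹ w))) = (Nat.card H : k) • w) : IsInducedFrom σ τ :=
  nonempty_ind_equiv σ τ i r hi hri h0 hsum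

lemma tmul_dual_ne_zero {v : V} (hv : v ≠ 0) {f : Module.Dual k W} (hf : f ≠ 0) :
    v ⊗ₜ[k] f ≠ 0 := by
  intro h
  refine hf (LinearMap.ext fun w => ?_)
  have h1 := LinearMap.congr_fun
    (congrArg (fun t => dualTensorHom k W V (TensorProduct.comm k _ _ t)) h) w
  rw [TensorProduct.comm_tmul, dualTensorHom_apply, map_zero, map_zero, LinearMap.zero_apply,
    smul_eq_zero] at h1
  exact h1.resolve_right hv

end IsInducedFrom

/-! ### The dynamical datum attached to a block -/

section BlockDatum

variable {k : Type u} [Field k] {G : Type v} [Group G] {A : Subgroup G}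
  [Finite G] [CharZero k] {J : DynamicalTwist k A} {ε : CatAlg J}

namespace CatAlg

lemma single_add (l m : Chars k A) (f f' : (weightFun (m - l) : Submodule k (G → k))) :
    single J l m (f + f') = single J l m f + single J l m f' := by
  refine CatAlg.ext fun l' m' => ?_
  rw [map_add, Pi.add_apply, Pi.add_apply, val_single, val_single, val_single]
  split_ifs
  · rfl
  · rw [add_zero]

lemma single_smul (l m : Chars k A) (c : k) (f : (weightFun (m - l) : Submodule k (G → k))) :
    single J l m (c • f) = c • single J l m f := by
  refine CatAlg.ext fun l' m' => ?_
  rw [map_smul, Pi.smul_apply, Pi.smul_apply, val_single, val_single]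
  split_ifs
  · rfl
  · rw [smul_zero]

lemma smul_single (l m : Chars k A) (g : G) (f : (weightFun (m - l) : Submodule k (G → k))) :
    g • single J l m f = single J l m (weightRep k (m - l) g f) := by
  refine CatAlg.ext fun l' m' => ?_
  rw [val_smul, val_single, val_single]
  split_ifs
  · rfl
  · rfl

variable (J) in
/-- The inclusion of `F_{μ-λ}[G]` in the category algebra. -/
def singleLin (l m : Chars k A) : (weightFun (m - l) : Submodule k (G → k)) →ₗ[k] CatAlg J where
  toFun := single J l m
  map_add' := single_add l m
  map_smul' := single_smul l m

lemma singleLin_apply (l m : Chars k A) (f : (weightFun (m - l) : Submodule k (G → k))) :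
    singleLin J l m f = single J l m f := rfl

variable (J) in
/-- The projection of the category algebra to `F_{μ-λ}[G]`. -/
def entry (l m : Chars k A) : CatAlg J →ₗ[k] (weightFun (m - l) : Submodule k (G → k)) where
  toFun x := ⟨val x l m, val_mem x l m⟩
  map_add' x y := Subtype.ext (congrFun (congrFun (LinearMap.map_add val x y) l) m)
  map_smul' c x := Subtype.ext (congrFun (congrFun (LinearMap.map_smul val c x) l) m)

lemma entry_single (l m : Chars k A) (f : (weightFun (m - l) : Submodule k (G → k))) :
    entry J l m (single J l m f) = f :=
  Subtype.ext (val_single_self l m f)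

lemma entry_smul (l m : Chars k A) (g : G) (x : CatAlg J) :
    entry J l m (g • x) = weightRep k (m - l) g (entry J l m x) := rfl

end CatAlg

open CatAlg

lemma BlockRep.fromTensor_idem (T : BlockRep k ε) (h : IsPrimCentral ε) {l m : Chars k A}
    (t : T.Comp (idem J l) ⊗[k] Module.Dual k (T.Comp (idem J m))) :
    ε * T.fromTensor h (idem J l) (idem J m) t = T.fromTensor h (idem J l) (idem J m) t ∧
    idem J l * T.fromTensor h (idem J l) (idem J m) t = T.fromTensor h (idem J l) (idem J m) t ∧
    T.fromTensor h (idem J l) (idem J m) t * idem J m = T.fromTensor h (idem J l) (idem J m) t :=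
  (T.range_fromTensor h (idem_mul_self l) (idem_mul_self m) _).1 ⟨t, rfl⟩

/-- The criterion is applied to the inclusion of `ε F_{m-l}[G]` and the retraction `f ↦ ε f`.
Orthogonality of distinct blocks gives the vanishing, and `∑ g • ε = |K|` gives the sum condition.
-/
lemma isInducedFrom_weightRep (T : BlockRep k ε) (h : IsPrimCentral ε) (l m : Chars k A)
    (σ : Representation k (MulAction.stabilizer G ε)
      (T.Comp (idem J l) ⊗[k] Module.Dual k (T.Comp (idem J m))))
    (hσ : ∀ g, σ g = tensorDual (T.actComp (fun g => smul_idem g l) g)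
      (T.actComp (fun g => smul_idem g m) g)) :
    IsInducedFrom σ (weightRep k (m - l)) := by
  classical
  have := Fintype.ofFinite G
  have hinj := T.fromTensor_injective h (a := idem J l) (idem_mul_self m)
  have hsingle : ∀ t, single J l m (entry J l m (T.fromTensor h (idem J l) (idem J m) t)) =
      T.fromTensor h (idem J l) (idem J m) t := by
    intro t
    obtain ⟨-, h2, h3⟩ := T.fromTensor_idem h t
    exact (eq_single_of_mul_eq h2 h3).symm
  have hrange : ∀ f, LinearMap.mulLeft k ε (singleLin J l m f) ∈
      LinearMap.range (T.fromTensor h (idem J l) (idem J m)) := by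
    intro f
    refine (T.range_fromTensor h (idem_mul_self l) (idem_mul_self m) _).2 ⟨?_, ?_, ?_⟩
    · rw [LinearMap.mulLeft_apply, ← mul_assoc, h.mul_self]
    · rw [LinearMap.mulLeft_apply, singleLin_apply, ← mul_assoc, h.comm, mul_assoc,
        idem_mul_single]
    · rw [LinearMap.mulLeft_apply, singleLin_apply, mul_assoc, single_mul_idem]
  let r := (LinearEquiv.ofInjective _ hinj).symm.toLinearMap ∘ₗ
    (LinearMap.mulLeft k ε ∘ₗ singleLin J l m).codRestrict _ hrange
  have hr : ∀ f, T.fromTensor h (idem J l) (idem J m) (r f) = ε * single J l m f := by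
    intro f
    exact congrArg Subtype.val ((LinearEquiv.ofInjective _ hinj).apply_symm_apply _)
  refine isInducedFrom_of_sum_eq _ (weightRep k (m - l))
    (entry J l m ∘ₗ T.fromTensor h (idem J l) (idem J m)) r ?_ ?_ ?_ ?_
  · intro g t
    have h1 : T.fromTensor h (idem J l) (idem J m)
        (σ g t) = (g : G) • T.fromTensor h (idem J l) (idem J m) t := by
      rw [hσ, T.fromTensor_tensorDual]
    rw [LinearMap.comp_apply, LinearMap.comp_apply, h1, entry_smul]
  · intro t
    apply hinj
    rw [hr, LinearMap.comp_apply, hsingle, (T.fromTensor_idem h t).1]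
  · intro g hg t
    apply hinj
    rw [hr, LinearMap.comp_apply, ← smul_single, hsingle,
      h.mul_smul_eq_ite _ _ (T.fromTensor_idem h t).1, if_neg hg, map_zero]
  · intro f
    have h1 : ∀ g : G, weightRep k (m - l) g (entry J l m (T.fromTensor h (idem J l) (idem J m)
        (r (weightRep k (m - l) g⁻¹ f)))) = entry J l m ((g • ε) * single J l m f) := by
      intro g
      rw [hr, ← entry_smul, smul_mul', ← smul_single, smul_inv_smul]
    simp only [LinearMap.comp_apply, h1]
    rw [← map_sum, ← Finset.sum_mul, (isConnectedSystem J).sum_smul h, smul_mul_assoc, one_mul,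
      map_smul, entry_single]

/-- The dynamical datum attached to a block of the category algebra. -/
def blockDatum (T : BlockRep k ε) (h : IsPrimCentral ε) : DynamicalDatum k A where
  K := MulAction.stabilizer G ε
  -- Components of a coordinate space over `k` live in the universe of `k`, as the datum demands.
  V l := T.Comp (idem J l)
  π l := T.actComp fun g => smul_idem g l
  projective l := by
    have := Fintype.ofFinite G
    exact T.isProjectiveRep_actComp _ ((isConnectedSystem J).mul_ne_zero h l)
  irreducible l := by
    have := Fintype.ofFinite G
    exact T.isIrreducibleProj_actComp (isConnectedSystem J) h l
  coherent l m := by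
    refine ⟨T.tensorRep (fun g => smul_idem g l) (fun g => smul_idem g (l - m)) h
      (idem_mul_self _), fun _ => rfl, ?_⟩
    obtain ⟨e⟩ := isInducedFrom_weightRep T h l (l - m)
      (T.tensorRep (fun g => smul_idem g l) (fun g => smul_idem g (l - m)) h (idem_mul_self _))
      (fun _ => rfl)
    obtain ⟨e'⟩ := nonempty_ind_charRep_equiv (m := m) (n := l - m - l) (by abel)
    exact ⟨e.trans e'.symm⟩

/-- The action of `B_λ` on a component of the simple module of a block. -/
def blockAction (T : BlockRep k ε) (l : Chars k A) :
    B J l →ₐ[k] Module.End k (T.Comp (idem J l)) :=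
  AlgHom.ofLinearMap
    { toFun := fun b => T.compress (incl J l b)
      map_add' := by
        intro b b'
        simp only [BlockRep.compress, map_add, LinearMap.comp_add, LinearMap.add_comp]
      map_smul' := by
        intro c b
        simp only [BlockRep.compress, map_smul, LinearMap.comp_smul, LinearMap.smul_comp,
          RingHom.id_apply] }
    (by
      refine LinearMap.ext fun v => Subtype.ext ?_
      change (T.compress (incl J l 1) v : Fin T.d → k) = v
      rw [T.coe_compress (idem_mul_incl _ _), incl_one, T.map_coe (idem_mul_self l)])
    (by
      intro b b'
      refine LinearMap.ext fun v => Subtype.ext ?_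
      change (T.compress (incl J l (b * b')) v : Fin T.d → k) =
        T.compress (incl J l b) (T.compress (incl J l b') v)
      rw [T.coe_compress (idem_mul_incl _ _), T.coe_compress (idem_mul_incl _ _),
        T.coe_compress (idem_mul_incl _ _), incl_mul, map_mul, Module.End.mul_apply])

lemma blockAction_apply (T : BlockRep k ε) (l : Chars k A) (b : B J l) :
    blockAction T l b = T.compress (incl J l b) := rfl

lemma exists_blockAction_eq (T : BlockRep k ε) (h : IsPrimCentral ε) (l : Chars k A)
    (X : Module.End k (T.Comp (idem J l))) : ∃ b ∈ blockIdeal h l, blockAction T l b = X := by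
  obtain ⟨x, h1, h2, h3, rfl⟩ := T.exists_compress_eq h (idem_mul_self l) X
  obtain ⟨b, rfl⟩ := exists_incl_eq h2 h3
  exact ⟨b, mem_blockIdeal.2 h1, rfl⟩

/-- The isomorphism of `V_λ ⊗ V_μ^*` with the block of `F_{μ-λ}[G]`. -/
def blockIso (T : BlockRep k ε) (h : IsPrimCentral ε) (l m : Chars k A) :
    T.Comp (idem J l) ⊗[k] Module.Dual k (T.Comp (idem J m)) →ₗ[k] (G → k) :=
  LinearMap.proj m ∘ₗ LinearMap.proj l ∘ₗ val ∘ₗ T.fromTensor h (idem J l) (idem J m)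

lemma blockIso_apply (T : BlockRep k ε) (h : IsPrimCentral ε) (l m : Chars k A)
    (t : T.Comp (idem J l) ⊗[k] Module.Dual k (T.Comp (idem J m))) :
    blockIso T h l m t = val (T.fromTensor h (idem J l) (idem J m) t) l m := rfl

lemma blockIso_injective (T : BlockRep k ε) (h : IsPrimCentral ε) (l m : Chars k A) :
    Function.Injective (blockIso T h l m) := by
  intro s t hst
  refine T.fromTensor_injective h (idem_mul_self m) ?_
  obtain ⟨-, h2, h3⟩ := T.fromTensor_idem h s
  obtain ⟨-, h2', h3'⟩ := T.fromTensor_idem h t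
  rw [eq_single_of_mul_eq h2 h3, eq_single_of_mul_eq h2' h3']
  exact congrArg (single J l m) (Subtype.ext hst)

lemma range_blockIso (T : BlockRep k ε) (h : IsPrimCentral ε) (l m : Chars k A) :
    LinearMap.range (blockIso T h l m) = blockBimodule J (blockIdeal h l) (blockIdeal h m) := by
  apply le_antisymm
  · rintro _ ⟨t, rfl⟩
    obtain ⟨h1, h2, h3⟩ := T.fromTensor_idem h t
    exact val_mem_blockBimodule h h1 h2 h3
  · intro f hf
    obtain ⟨x, h1, -, h2, h3, rfl⟩ := mem_blockBimodule_blockIdeal h h hf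
    obtain ⟨t, rfl⟩ :=
      (T.range_fromTensor h (idem_mul_self l) (idem_mul_self m) x).2 ⟨h1, h2, h3⟩
    exact ⟨t, rfl⟩

lemma blockAction_conj (T : BlockRep k ε) (l : Chars k A) (g : MulAction.stabilizer G ε)
    (b : B J l) (v : T.Comp (idem J l)) :
    blockAction T l ((g : G) • b) (T.actComp (fun g => smul_idem g l) g v) =
      T.actComp (fun g => smul_idem g l) g (blockAction T l b v) := by
  rw [blockAction_apply, blockAction_apply, ← smul_incl]
  exact T.compress_smul (fun g => smul_idem g l) (idem_mul_incl _ _) g v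

lemma blockIso_bimodule (T : BlockRep k ε) (h : IsPrimCentral ε) (l m : Chars k A) (b : B J l)
    (b' : B J m) (t : T.Comp (idem J l) ⊗[k] Module.Dual k (T.Comp (idem J m))) :
    blockIso T h l m (TensorProduct.map (blockAction T l b) (blockAction T m b').dualMap t) =
      tw (J.toFun m) (tw (J.toFun m) (B.val b) (blockIso T h l m t)) (B.val b') := by
  rw [blockIso_apply, blockIso_apply, blockAction_apply, blockAction_apply,
    T.fromTensor_map h (idem_mul_incl _ _) (incl_mul_idem _ _) (idem_mul_incl _ _),
    val_mul_incl, if_pos rfl, val_incl_mul, if_pos rfl]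

lemma blockIso_equivariant (T : BlockRep k ε) (h : IsPrimCentral ε) (l m : Chars k A)
    (g : MulAction.stabilizer G ε)
    (t : T.Comp (idem J l) ⊗[k] Module.Dual k (T.Comp (idem J m))) :
    blockIso T h l m (tensorDual (T.actComp (fun g => smul_idem g l) g)
      (T.actComp (fun g => smul_idem g m) g) t) = shift (g : G) (blockIso T h l m t) := by
  rw [blockIso_apply, blockIso_apply, ← val_smul, T.fromTensor_tensorDual]

lemma blockAction_one_ne_zero (T : BlockRep k ε) (h : IsPrimCentral ε) (l : Chars k A) :
    ∃ b ∈ blockIdeal h l, blockAction T l b ≠ 0 := by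
  have := Fintype.ofFinite G
  have h1 := T.nontrivial_comp ((isConnectedSystem J).mul_ne_zero h l)
  obtain ⟨b, hb, hb1⟩ := exists_blockAction_eq T h l 1
  exact ⟨b, hb, by rw [hb1]; exact one_ne_zero⟩

lemma blockAction_simple (T : BlockRep k ε) (h : IsPrimCentral ε) (l : Chars k A)
    (W : Submodule k (T.Comp (idem J l)))
    (hW : ∀ b ∈ blockIdeal h l, ∀ w ∈ W, blockAction T l b w ∈ W) : W = ⊥ ∨ W = ⊤ := by
  refine eq_bot_or_eq_top_of_forall_end W fun X w hw => ?_
  obtain ⟨b, hb, rfl⟩ := exists_blockAction_eq T h l X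
  exact hW b hb w hw

lemma blockBimodule_blockIdeal_ne_bot (T : BlockRep k ε) (h : IsPrimCentral ε)
    (l m : Chars k A) : blockBimodule J (blockIdeal h l) (blockIdeal h m) ≠ ⊥ := by
  have := Fintype.ofFinite G
  have h1 := T.nontrivial_comp ((isConnectedSystem J).mul_ne_zero h l)
  have h2 := T.nontrivial_comp ((isConnectedSystem J).mul_ne_zero h m)
  rw [← range_blockIso T h, Ne, LinearMap.range_eq_bot]
  intro h0
  obtain ⟨v, hv⟩ := exists_ne (0 : T.Comp (idem J l))
  obtain ⟨f, hf⟩ := exists_ne (0 : Module.Dual k (T.Comp (idem J m)))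
  refine tmul_dual_ne_zero hv hf (blockIso_injective T h l m (by rw [h0]; rfl))

/-- The realization of the dynamical datum attached to a block. -/
def blockRealization (T : BlockRep k ε) (h : IsPrimCentral ε) :
    Realization J (blockDatum T h) where
  ideal l := blockIdeal h l
  minimal l := isAtom_blockIdeal h T l
  corresponding := blockBimodule_blockIdeal_ne_bot T h
  stabilizer_eq l := stabilizer_blockIdeal h l
  ρ l := blockAction T l
  ideal_acts := blockAction_one_ne_zero T h
  simple := blockAction_simple T h
  conj l g b _ v := blockAction_conj T l g b v
  iso l m := blockIso T h l m
  iso_injective := blockIso_injective T h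
  iso_range := range_blockIso T h
  iso_bimodule := blockIso_bimodule T h
  iso_equivariant := blockIso_equivariant T h

end BlockDatum

end DynTwist

end

open scoped TensorProduct

noncomputable section

set_option linter.unusedSectionVars false

namespace DynTwist

universe u v

/-! ### Schur's lemma for `V` and for `V ⊗ W^*` -/

section Scalars

variable {k : Type*} [Field k]

lemma exists_eq_smul_of_forall_comm {V : Type*} [AddCommGroup V] [Module k V]
    (P : Module.End k V) (hP : ∀ (X : Module.End k V) v, P (X v) = X (P v)) :
    ∃ c : k, ∀ v, P v = c • v := by
  have h : P ∈ Subalgebra.center k (Module.End k V) :=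
    Subalgebra.mem_center_iff.2 fun X => LinearMap.ext fun v => (hP X v).symm
  rw [Algebra.IsCentral.center_eq_bot] at h
  obtain ⟨c, rfl⟩ := h
  exact ⟨c, fun v => rfl⟩

/-- Rank-one `X` and `Y` project every tensor onto a multiple of a prescribed `v ⊗ f`; commuting
with these, `P` must multiply each `v ⊗ f` by one constant, its matrix coefficient at `v₀ ⊗ f₀`. -/
lemma exists_eq_smul_of_forall_map_comm {V W : Type*} [AddCommGroup V] [Module k V]
    [AddCommGroup W] [Module k W] [Nontrivial V] [Nontrivial W]
    (P : V ⊗[k] Module.Dual k W →ₗ[k] V ⊗[k] Module.Dual k W)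
    (hP : ∀ (X : Module.End k V) (Y : Module.End k W) t,
      P (TensorProduct.map X Y.dualMap t) = TensorProduct.map X Y.dualMap (P t)) :
    ∃ c : k, ∀ t, P t = c • t := by
  obtain ⟨v₀, hv₀⟩ := exists_ne (0 : V)
  obtain ⟨w₀, hw₀⟩ := exists_ne (0 : W)
  obtain ⟨g₀, hg₀⟩ := Module.Projective.exists_dual_eq_one k hv₀
  obtain ⟨f₀, hf₀⟩ := Module.Projective.exists_dual_eq_one k hw₀
  let ev : V ⊗[k] Module.Dual k W →ₗ[k] k :=
    LinearMap.mul' k k ∘ₗ TensorProduct.map g₀ (Module.Dual.eval k W w₀)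
  have h1 : ∀ (v : V) (f : Module.Dual k W) s,
      TensorProduct.map (g₀.smulRight v) (f.smulRight w₀).dualMap s = ev s • (v ⊗ₜ[k] f) := by
    intro v f s
    induction s with
    | zero => simp
    | add s t hs ht => rw [map_add, map_add, hs, ht, add_smul]
    | tmul x y =>
      have h2 : (f.smulRight w₀).dualMap y = y w₀ • f := by
        refine LinearMap.ext fun w => ?_
        simp [mul_comm]
      rw [TensorProduct.map_tmul, h2, LinearMap.smulRight_apply, TensorProduct.smul_tmul_smul]
      rfl
  refine ⟨ev (P (v₀ ⊗ₜ f₀)), fun t => ?_⟩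
  induction t with
  | zero => simp
  | add s t hs ht => rw [map_add, hs, ht, smul_add]
  | tmul v f =>
    rw [← h1, ← hP, h1]
    simp [ev, hg₀, hf₀]

end Scalars

variable {k : Type u} [Field k] {G : Type v} [Group G] {A : Subgroup G}

lemma shift_shift (g h : G) (f : G → k) : shift g (shift h f) = shift (g * h) f := by
  funext x
  simp [shift, mul_assoc]

lemma shift_one (f : G → k) : shift 1 f = f := by
  funext x
  simp [shift]

open CatAlg

/-! ### Uniqueness of the datum up to isomorphism -/

section Uniqueness

variable [Finite G] [CharZero k] {J : DynamicalTwist k A} {ε : CatAlg J}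

lemma mem_blockIdeal_smul (h : IsPrimCentral ε) (g : G) {l : Chars k A} {b : B J l} :
    g • b ∈ blockIdeal (h.smul g) l ↔ b ∈ blockIdeal h l := by
  rw [← SetLike.mem_coe, coe_blockIdeal_smul, Set.smul_mem_smul_set_iff, SetLike.mem_coe]

lemma shift_inv_mem_blockBimodule (h : IsPrimCentral ε) (g : G) {l m : Chars k A} {f : G → k}
    (hf : f ∈ blockBimodule J (blockIdeal (h.smul g) l) (blockIdeal (h.smul g) m)) :
    shift g⁻¹ f ∈ blockBimodule J (blockIdeal h l) (blockIdeal h m) := by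
  obtain ⟨x, h1, -, h2, h3, rfl⟩ := mem_blockBimodule_blockIdeal _ _ hf
  rw [← val_smul]
  refine val_mem_blockBimodule _ ?_ ?_ ?_
  · nth_rw 2 [← h1]
    rw [smul_mul', inv_smul_smul]
  · rw [← smul_idem g⁻¹ l, ← smul_mul', h2]
  · rw [← smul_idem g⁻¹ m, ← smul_mul', h3]

/-- The kernel of the action meets the minimal ideal in a proper subideal, hence in zero. -/
lemma Realization.eq_zero_of_mem_ideal {D : DynamicalDatum k A} (R : Realization J D)
    {l : Chars k A} {b : B J l} (hb : b ∈ R.ideal l) (hρ : R.ρ l b = 0) : b = 0 := by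
  have h1 : R.ideal l ⊓ TwoSidedIdeal.ker (R.ρ l) = ⊥ := by
    refine (R.minimal l).2 _ (lt_of_le_of_ne inf_le_left fun h => ?_)
    obtain ⟨c, hc, hc0⟩ := R.ideal_acts l
    rw [← h] at hc
    exact hc0 ((TwoSidedIdeal.mem_ker _).1 ((TwoSidedIdeal.mem_inf _).1 hc).2)
  have h2 : b ∈ R.ideal l ⊓ TwoSidedIdeal.ker (R.ρ l) :=
    (TwoSidedIdeal.mem_inf _).2 ⟨hb, (TwoSidedIdeal.mem_ker _).2 hρ⟩
  rwa [h1, TwoSidedIdeal.mem_bot] at h2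

/-- After twisting by `g`, the module of the realization becomes a simple module on which the ideal
of `ε` acts faithfully. A simple left ideal in it acts nontrivially on both modules, which are
therefore isomorphic. -/
lemma Realization.exists_intertwiner {D : DynamicalDatum k A} (R : Realization J D)
    (T : BlockRep k ε) (h : IsPrimCentral ε) (g : G)
    (hR : ∀ l, R.ideal l = blockIdeal (h.smul g) l) (l : Chars k A) :
    ∃ φ : T.Comp (idem J l) ≃ₗ[k] D.V l, ∀ b v, φ (blockAction T l b v) = R.ρ l (g • b) (φ v) := by
  let γ : B J l ≃ₐ[k] B J l :=
    { MulSemiringAction.toRingEquiv G (B J l) g with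
      commutes' := fun c => by
        change g • (algebraMap k (B J l) c) = algebraMap k (B J l) c
        rw [Algebra.algebraMap_eq_smul_one]
        apply B.val_injective
        rfl }
  have hγ : ∀ b, γ b = g • b := fun b => rfl
  obtain ⟨b, hb, hb0⟩ := blockAction_one_ne_zero T h l
  obtain ⟨L, hL, hLI, x, hx, hx0⟩ := exists_isAtom_of_ne_zero (blockAction T l)
    (TwoSidedIdeal.asIdeal (blockIdeal h l)) ⟨b, hb, hb0⟩
  refine exists_intertwiner_of_isAtom (blockAction T l) ((R.ρ l).comp γ.toAlgHom)
    (fun W hW => blockAction_simple T h l W fun b _ => hW b)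
    (fun W hW => R.simple l W fun b _ w hw => ?_) hL ⟨x, hx, hx0⟩ ⟨x, hx, fun h0 => ?_⟩
  · obtain ⟨b, rfl⟩ := γ.surjective b
    exact hW b w hw
  · change R.ρ l (g • x) = 0 at h0
    have h1 : g • x = 0 := R.eq_zero_of_mem_ideal (by
      rw [hR, mem_blockIdeal_smul]
      exact hLI hx) h0
    have h2 : x = 0 := by simpa using congrArg (g⁻¹ • ·) h1
    rw [h2, map_zero] at hx0
    exact hx0 rfl

/-- Schur's lemma is used twice: on `V_l`, to produce a multiplier `α l`, and on `V_l ⊗ V_m^*`, to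
compare the two bimodule isomorphisms up to a scalar. Equivariance of the latter makes `α`
independent of `l`. -/
lemma Realization.nonempty_iso {D : DynamicalDatum k A} (R : Realization J D)
    (T : BlockRep k ε) (h : IsPrimCentral ε) (g : G)
    (hR : ∀ l, R.ideal l = blockIdeal (h.smul g) l) : Nonempty ((blockDatum T h).Iso D) := by
  have := Fintype.ofFinite G
  choose φ hφ using R.exists_intertwiner T h g hR
  have hnt : ∀ l, Nontrivial (T.Comp (idem J l)) := fun l =>
    T.nontrivial_comp ((isConnectedSystem J).mul_ne_zero h l)
  have hK : (MulAction.stabilizer G ε).map (MulAut.conj g).toMonoidHom = D.K := by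
    rw [← R.stabilizer_eq 0, hR, stabilizer_blockIdeal,
      MulAction.stabilizer_smul_eq_stabilizer_map_conj]
  have hmem : ∀ x : MulAction.stabilizer G ε, g * x * g⁻¹ ∈ D.K := by
    intro x
    rw [← hK]
    exact ⟨x, x.2, rfl⟩
  set π : ∀ l, MulAction.stabilizer G ε → T.Comp (idem J l) ≃ₗ[k] T.Comp (idem J l) :=
    fun l x => T.actComp (fun g => smul_idem g l) x with hπ
  -- the multipliers of the individual components
  have hscalar : ∀ l (x : MulAction.stabilizer G ε), ∃ c : kˣ,
      ∀ v, D.π l ⟨_, hmem x⟩ (φ l v) = (c : k) • φ l (π l x v) := by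
    intro l x
    -- Both `D.π` at `g x g⁻¹`, transported by `φ l`, and `π l x` implement the action of `x` on the
    -- block, so their quotient `P` commutes with all endomorphisms.
    let P : T.Comp (idem J l) ≃ₗ[k] T.Comp (idem J l) :=
      ((φ l).trans (D.π l ⟨_, hmem x⟩)).trans ((φ l).symm.trans (π l x).symm)
    have hP : ∀ v, D.π l ⟨_, hmem x⟩ (φ l v) = φ l (π l x (P v)) := by
      intro v; simp [P]
    obtain ⟨c, hc⟩ := exists_eq_smul_of_forall_comm (P : Module.End k (T.Comp (idem J l))) (by
      intro X v
      obtain ⟨b, hb, rfl⟩ := exists_blockAction_eq T h l X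
      have h1 : g • b ∈ R.ideal l := by rwa [hR, mem_blockIdeal_smul]
      apply (π l x).injective
      apply (φ l).injective
      rw [LinearEquiv.coe_coe, ← hP, hφ, ← R.conj l ⟨_, hmem x⟩ (g • b) h1, hP]
      rw [← blockAction_conj, hφ]
      congr 2
      rw [smul_smul, smul_smul]
      simp)
    have hc0 : c ≠ 0 := by
      rintro rfl
      obtain ⟨v, hv⟩ := exists_ne (0 : T.Comp (idem J l))
      refine hv (P.injective ?_)
      have := hc v
      rw [zero_smul] at this
      rw [map_zero]
      exact this
    refine ⟨Units.mk0 c hc0, fun v => ?_⟩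
    have := hc v
    rw [LinearEquiv.coe_coe] at this
    rw [hP, this, map_smul, map_smul]
    rfl
  choose α hα using hscalar
  let Ξ : ∀ l m, T.Comp (idem J l) ⊗[k] Module.Dual k (T.Comp (idem J m)) ≃ₗ[k]
      D.V l ⊗[k] Module.Dual k (D.V m) :=
    fun l m => TensorProduct.congr (φ l) (φ m).symm.dualMap
  -- comparison of the bimodule isomorphisms
  have hiso : ∀ l m, ∃ c : k, ∀ t, R.iso l m (Ξ l m t) = c • shift g (blockIso T h l m t) := by
    intro l m
    have hrange : ∀ t, (shiftLin g⁻¹ ∘ₗ R.iso l m ∘ₗ (Ξ l m).toLinearMap) t ∈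
        LinearMap.range (blockIso T h l m) := by
      intro t
      rw [range_blockIso]
      refine shift_inv_mem_blockBimodule h g ?_
      rw [← hR, ← hR, ← R.iso_range]
      exact ⟨_, rfl⟩
    -- The isomorphism of the realization, shifted back by `g⁻¹` into the bimodule of `ε` and
    -- compared with `blockIso`, is a bimodule endomorphism.
    let M := (LinearEquiv.ofInjective _ (blockIso_injective T h l m)).symm.toLinearMap ∘ₗ
      (shiftLin g⁻¹ ∘ₗ R.iso l m ∘ₗ (Ξ l m).toLinearMap).codRestrict _ hrange
    have hM : ∀ t, blockIso T h l m (M t) = shift g⁻¹ (R.iso l m (Ξ l m t)) := by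
      intro t
      exact congrArg Subtype.val
        ((LinearEquiv.ofInjective _ (blockIso_injective T h l m)).apply_symm_apply _)
    have hM' : ∀ t, R.iso l m (Ξ l m t) = shift g (blockIso T h l m (M t)) := by
      intro t
      rw [hM, shift_shift, mul_inv_cancel, shift_one]
    obtain ⟨c, hc⟩ := exists_eq_smul_of_forall_map_comm M (by
      intro X Y t
      obtain ⟨b, hb, rfl⟩ := exists_blockAction_eq T h l X
      obtain ⟨b', hb', rfl⟩ := exists_blockAction_eq T h m Y
      have h1 : Ξ l m (TensorProduct.map (blockAction T l b) (blockAction T m b').dualMap t) =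
          TensorProduct.map (R.ρ l (g • b)) (R.ρ m (g • b')).dualMap (Ξ l m t) := by
        induction t with
        | zero => simp
        | add s t hs ht => simp only [map_add, hs, ht]
        | tmul v f =>
          simp only [Ξ, TensorProduct.map_tmul, TensorProduct.congr_tmul, hφ]
          congr 1
          refine LinearMap.ext fun w => ?_
          simp only [LinearEquiv.dualMap_apply, LinearMap.dualMap_apply]
          congr 1
          apply (φ m).injective
          rw [hφ, LinearEquiv.apply_symm_apply, LinearEquiv.apply_symm_apply]
      apply blockIso_injective T h l m
      rw [blockIso_bimodule, hM, hM, h1, R.iso_bimodule, B.val_smul, B.val_smul, hM',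
        tw_shift, tw_shift, shift_shift, shift_shift, inv_mul_cancel, shift_one, shift_one])
    refine ⟨c, fun t => ?_⟩
    rw [hM', hc, map_smul]
    rfl
  have hαeq : ∀ l m x, α l x = α m x := by
    intro l m x
    obtain ⟨c, hc⟩ := hiso l m
    have h1 : ∀ t, tensorDual (D.π l ⟨_, hmem x⟩) (D.π m ⟨_, hmem x⟩) (Ξ l m t) =
        ((α l x : k) * (α m x : k)⁻¹) • Ξ l m (tensorDual (π l x) (π m x) t) := by
      intro t
      induction t with
      | zero => simp
      | add s t hs ht => simp only [map_add, hs, ht, smul_add]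
      | tmul v f =>
        have h2 : ∀ w, (φ m).symm ((D.π m ⟨_, hmem x⟩).symm w) =
            (α m x : k)⁻¹ • (π m x).symm ((φ m).symm w) := by
          intro w
          rw [LinearEquiv.symm_apply_eq, LinearEquiv.symm_apply_eq, map_smul, map_smul, hα,
            LinearEquiv.apply_symm_apply, LinearEquiv.apply_symm_apply, smul_smul,
            inv_mul_cancel₀ (Units.ne_zero _), one_smul]
        simp only [Ξ, TensorProduct.congr_tmul, tensorDual_tmul, hα]
        rw [← TensorProduct.smul_tmul_smul]
        congr 1
        refine LinearMap.ext fun w => ?_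
        have h3 : f ((φ m).symm ((D.π m ⟨_, hmem x⟩).symm w)) =
            (α m x : k)⁻¹ • f ((π m x).symm ((φ m).symm w)) := by rw [h2, map_smul]
        exact h3
    obtain ⟨v, hv⟩ := exists_ne (0 : T.Comp (idem J l))
    obtain ⟨f, hf⟩ := exists_ne (0 : Module.Dual k (T.Comp (idem J m)))
    set s := tensorDual (π l x) (π m x) (v ⊗ₜ f) with hs
    have hs0 : s ≠ 0 := by
      rw [hs, tensorDual_tmul]
      refine tmul_dual_ne_zero (by simpa using hv) fun h0 => hf (LinearMap.ext fun w => ?_)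
      have := LinearMap.congr_fun h0 (π m x w)
      simpa using this
    -- Equivariance of both isomorphisms turns `h1` into the statement that the ratio of multipliers
    -- acts as 1 on `c • shift g (blockIso T h l m s)`, which is nonzero.
    have h2 := congrArg (R.iso l m) (h1 (v ⊗ₜ f))
    rw [R.iso_equivariant, hc, ← shiftLin_apply, map_smul, shiftLin_apply, shift_shift,
      inv_mul_cancel_right, map_smul, hc, ← shift_shift, ← blockIso_equivariant] at h2
    have hne : c • shift g (blockIso T h l m s) ≠ 0 := by
      rw [← hc]
      intro h0
      exact hs0 ((Ξ l m).injective ((R.iso_injective l m (h0.trans (map_zero _).symm)).trans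
        (map_zero _).symm))
    have h3 : (1 - (α l x : k) * (α m x : k)⁻¹) • c • shift g (blockIso T h l m s) = 0 := by
      rw [sub_smul, one_smul, sub_eq_zero]
      exact h2
    have h4 := sub_eq_zero.1 ((smul_eq_zero.1 h3).resolve_right hne)
    exact Units.ext ((mul_inv_eq_one₀ (Units.ne_zero _)).1 h4.symm)
  refine ⟨{
    g := g
    map_conj := hK
    φ := φ
    α := α 0
    comm := fun l x x' hx v => ?_ }⟩
  obtain rfl : x' = ⟨_, hmem x⟩ := Subtype.ext hx
  exact (hα l x v).trans (by rw [hαeq l 0 x]; rfl)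

end Uniqueness

end DynTwist

end

open scoped TensorProduct

noncomputable section

set_option linter.unusedSectionVars false

namespace DynTwist

universe u v

variable {k : Type u} [Field k] {G : Type v} [Group G] {A : Subgroup G}

/-! ### Transport of realizations -/

/-- Bijections of the spaces of functions on `G` which carry the operations given by `J'` to those
given by `J`, and translation by `h` to translation by `g⁻¹ h g`. -/
structure Transport (J' J : DynamicalTwist k A) (g : G) where
  /-- The bijections. -/
  toEquiv : Chars k A → (G → k) ≃ₗ[k] (G → k)
  mem_iff : ∀ (l n : Chars k A) f, toEquiv l f ∈ (weightFun n : Submodule k (G → k)) ↔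
    f ∈ (weightFun n : Submodule k (G → k))
  map_one : ∀ l, toEquiv l 1 = 1
  map_shift : ∀ l (h : G) f, toEquiv l (shift h f) = shift (g⁻¹ * h * g) (toEquiv l f)
  map_tw : ∀ (l n : Chars k A) f₁ f₂, f₂ ∈ (weightFun n : Submodule k (G → k)) →
    toEquiv l (tw (J'.toFun l) f₁ f₂) =
      tw (J.toFun l) (toEquiv (l - n) f₁) (toEquiv l f₂)

namespace Transport

open scoped Pointwise

variable [Finite G] [CharZero k] {J' J : DynamicalTwist k A} {g : G} (Θ : Transport J' J g)

/-- The induced isomorphism of algebras. -/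
def algEquiv (l : Chars k A) : B J' l ≃ₐ[k] B J l :=
  AlgEquiv.ofLinearEquiv
    (((Θ.toEquiv l).ofSubmodules (weightFun 0) (weightFun 0) (by
      ext f
      rw [Submodule.mem_map_equiv, ← Θ.mem_iff l, LinearEquiv.apply_symm_apply]) :
      (weightFun (0 : Chars k A) : Submodule k (G → k)) ≃ₗ[k]
        (weightFun (0 : Chars k A) : Submodule k (G → k))) : B J' l ≃ₗ[k] B J l)
    (B.val_injective (Θ.map_one l))
    (by
      intro b b'
      apply B.val_injective
      have h1 := Θ.map_tw l 0 (B.val b) (B.val b') (B.val_mem b')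
      rw [sub_zero] at h1
      exact h1)

lemma val_algEquiv (l : Chars k A) (b : B J' l) :
    B.val (Θ.algEquiv l b) = Θ.toEquiv l (B.val b) := rfl

lemma algEquiv_smul (l : Chars k A) (h : G) (b : B J' l) :
    Θ.algEquiv l (h • b) = (g⁻¹ * h * g) • Θ.algEquiv l b :=
  B.val_injective (Θ.map_shift l h (B.val b))

/-- The ideal of `B_λ` for `J'` corresponding to an ideal of `B_λ` for `J`. -/
def ideal {l : Chars k A} (I : TwoSidedIdeal (B J l)) : TwoSidedIdeal (B J' l) :=
  (Θ.algEquiv l).symm.toRingEquiv.mapTwoSidedIdeal I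

lemma mem_ideal {l : Chars k A} {I : TwoSidedIdeal (B J l)} {b : B J' l} :
    b ∈ Θ.ideal I ↔ Θ.algEquiv l b ∈ I := by
  rw [ideal, RingEquiv.mapTwoSidedIdeal_apply, TwoSidedIdeal.mem_comap]
  rfl

lemma isAtom_ideal {l : Chars k A} {I : TwoSidedIdeal (B J l)} (hI : IsAtom I) :
    IsAtom (Θ.ideal I) :=
  (OrderIso.isAtom_iff _ I).2 hI

/-- The left factor is transported by `toEquiv` at index `m - (m - l) = l`, that is, by the
isomorphism `algEquiv l`. The index shift in `map_tw` thus matches the bimodule structure. -/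
lemma mem_blockBimodule {l m : Chars k A} {I : TwoSidedIdeal (B J l)}
    {I' : TwoSidedIdeal (B J m)} {f : G → k} :
    f ∈ blockBimodule J' (Θ.ideal I) (Θ.ideal I') ↔ Θ.toEquiv m f ∈ blockBimodule J I I' := by
  have h1 : ∀ (b : B J' l) (f) (_ : f ∈ (weightFun (m - l) : Submodule k (G → k))) (b' : B J' m),
      Θ.toEquiv m (tw (J'.toFun m) (tw (J'.toFun m) (B.val b) f) (B.val b')) =
        tw (J.toFun m) (tw (J.toFun m) (B.val (Θ.algEquiv l b)) (Θ.toEquiv m f))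
          (B.val (Θ.algEquiv m b')) := by
    intro b f hf b'
    rw [Θ.map_tw m 0 _ _ (B.val_mem b'), sub_zero, Θ.map_tw m (m - l) _ _ hf, sub_sub_cancel]
    rfl
  have h2 : (blockBimodule J' (Θ.ideal I) (Θ.ideal I')).map (Θ.toEquiv m).toLinearMap =
      blockBimodule J I I' := by
    rw [blockBimodule, blockBimodule, Submodule.map_span]
    congr 1
    ext x
    constructor
    · rintro ⟨_, ⟨b, hb, f, hf, b', hb', rfl⟩, rfl⟩
      exact ⟨_, Θ.mem_ideal.1 hb, _, (Θ.mem_iff _ _ _).2 hf, _, Θ.mem_ideal.1 hb',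
        h1 b f hf b'⟩
    · rintro ⟨b, hb, f, hf, b', hb', rfl⟩
      obtain ⟨b, rfl⟩ := (Θ.algEquiv l).surjective b
      obtain ⟨b', rfl⟩ := (Θ.algEquiv m).surjective b'
      obtain ⟨f, rfl⟩ := (Θ.toEquiv m).surjective f
      rw [Θ.mem_iff] at hf
      exact ⟨_, ⟨b, Θ.mem_ideal.2 hb, f, hf, b', Θ.mem_ideal.2 hb', rfl⟩, h1 b f hf b'⟩
  rw [← h2, Submodule.mem_map_equiv, LinearEquiv.symm_apply_apply]

lemma blockBimodule_ne_bot {l m : Chars k A} {I : TwoSidedIdeal (B J l)}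
    {I' : TwoSidedIdeal (B J m)} (h : blockBimodule J I I' ≠ ⊥) :
    blockBimodule J' (Θ.ideal I) (Θ.ideal I') ≠ ⊥ := by
  obtain ⟨f, hf, hf0⟩ := (Submodule.ne_bot_iff _).1 h
  obtain ⟨f, rfl⟩ := (Θ.toEquiv m).surjective f
  exact (Submodule.ne_bot_iff _).2 ⟨f, Θ.mem_blockBimodule.2 hf, fun h0 => hf0 (by
    rw [h0, map_zero])⟩

lemma mem_stabilizer_ideal {l : Chars k A} {I : TwoSidedIdeal (B J l)} (h : G) :
    h ∈ MulAction.stabilizer G (Θ.ideal I : Set (B J' l)) ↔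
      g⁻¹ * h * g ∈ MulAction.stabilizer G (I : Set (B J l)) := by
  rw [MulAction.mem_stabilizer_set, MulAction.mem_stabilizer_set]
  simp only [SetLike.mem_coe, Θ.mem_ideal, Θ.algEquiv_smul]
  exact ((Θ.algEquiv l).surjective.forall
    (p := fun b => (g⁻¹ * h * g) • b ∈ I ↔ b ∈ I)).symm

variable {D D' : DynamicalDatum k A} (R : Realization J D) (e : D.Iso D')

/-- The action on the spaces of the datum `D'`. -/
def action (l : Chars k A) : B J' l →ₐ[k] Module.End k (D'.V l) :=
  ((e.φ l).conjAlgEquiv k).toAlgHom.comp ((R.ρ l).comp (Θ.algEquiv l).toAlgHom)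

lemma action_apply (l : Chars k A) (b : B J' l) (v : D.V l) :
    Θ.action R e l b (e.φ l v) = e.φ l (R.ρ l (Θ.algEquiv l b) v) := by
  change e.φ l (R.ρ l (Θ.algEquiv l b) ((e.φ l).symm (e.φ l v))) = _
  rw [LinearEquiv.symm_apply_apply]

/-- The isomorphism of `V'_λ ⊗ V'_μ^*` with a bimodule of functions. -/
def iso (l m : Chars k A) : D'.V l ⊗[k] Module.Dual k (D'.V m) →ₗ[k] (G → k) :=
  (Θ.toEquiv m).symm.toLinearMap ∘ₗ R.iso l m ∘ₗ
    (TensorProduct.congr (e.φ l) (e.φ m).symm.dualMap).symm.toLinearMap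

lemma toEquiv_iso (l m : Chars k A) (t : D.V l ⊗[k] Module.Dual k (D.V m)) :
    Θ.toEquiv m (Θ.iso R e l m (TensorProduct.congr (e.φ l) (e.φ m).symm.dualMap t)) =
      R.iso l m t := by
  rw [iso, LinearMap.comp_apply, LinearMap.comp_apply, LinearEquiv.coe_coe, LinearEquiv.coe_coe,
    LinearEquiv.apply_symm_apply, LinearEquiv.symm_apply_apply]

lemma congr_map_action (l m : Chars k A) (b : B J' l) (b' : B J' m)
    (t : D.V l ⊗[k] Module.Dual k (D.V m)) :
    TensorProduct.map (Θ.action R e l b) (Θ.action R e m b').dualMap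
        (TensorProduct.congr (e.φ l) (e.φ m).symm.dualMap t) =
      TensorProduct.congr (e.φ l) (e.φ m).symm.dualMap
        (TensorProduct.map (R.ρ l (Θ.algEquiv l b)) (R.ρ m (Θ.algEquiv m b')).dualMap t) := by
  induction t with
  | zero => simp
  | add s t hs ht => simp only [map_add, hs, ht]
  | tmul v f =>
    rw [TensorProduct.congr_tmul, TensorProduct.map_tmul, TensorProduct.map_tmul,
      TensorProduct.congr_tmul, action_apply]
    congr 1
    refine LinearMap.ext fun w => ?_
    obtain ⟨w, rfl⟩ := (e.φ m).surjective w
    change f ((e.φ m).symm (Θ.action R e m b' (e.φ m w))) =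
      f (R.ρ m (Θ.algEquiv m b') ((e.φ m).symm (e.φ m w)))
    rw [action_apply, LinearEquiv.symm_apply_apply, LinearEquiv.symm_apply_apply]

/-- The multiplier on `V_l` cancels against its inverse on the dual of `V_m`; this requires `α` not
to depend on the index. -/
lemma congr_tensorDual (l m : Chars k A) (h : D.K) (h' : D'.K) (hh : (h' : G) = e.g * h * e.g⁻¹)
    (t : D.V l ⊗[k] Module.Dual k (D.V m)) :
    tensorDual (D'.π l h') (D'.π m h') (TensorProduct.congr (e.φ l) (e.φ m).symm.dualMap t) =
      TensorProduct.congr (e.φ l) (e.φ m).symm.dualMap (tensorDual (D.π l h) (D.π m h) t) := by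
  induction t with
  | zero => simp
  | add s t hs ht => simp only [map_add, hs, ht]
  | tmul v f =>
    rw [TensorProduct.congr_tmul, tensorDual, TensorProduct.map_tmul, tensorDual,
      TensorProduct.map_tmul, TensorProduct.congr_tmul, LinearEquiv.coe_coe, LinearEquiv.coe_coe,
      e.comm l h h' hh, TensorProduct.smul_tmul]
    congr 1
    refine LinearMap.ext fun w => ?_
    obtain ⟨w, rfl⟩ := (D'.π m h').surjective w
    obtain ⟨w, rfl⟩ := (e.φ m).surjective w
    change (e.α h : k) • f ((e.φ m).symm ((D'.π m h').symm (D'.π m h' (e.φ m w)))) =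
      f ((D.π m h).symm ((e.φ m).symm (D'.π m h' (e.φ m w))))
    rw [LinearEquiv.symm_apply_apply, LinearEquiv.symm_apply_apply, e.comm m h h' hh, map_smul,
      map_smul, map_smul, LinearEquiv.symm_apply_apply, LinearEquiv.symm_apply_apply]

lemma stabilizer_eq (he : e.g = g) (l : Chars k A) :
    MulAction.stabilizer G (Θ.ideal (R.ideal l) : Set (B J' l)) = D'.K := by
  ext h
  rw [mem_stabilizer_ideal, R.stabilizer_eq, ← e.mem, he]
  simp [mul_assoc]

lemma action_ne_zero (l : Chars k A) :
    ∃ b ∈ Θ.ideal (R.ideal l), Θ.action R e l b ≠ 0 := by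
  obtain ⟨b, hb, hb0⟩ := R.ideal_acts l
  obtain ⟨b, rfl⟩ := (Θ.algEquiv l).surjective b
  refine ⟨b, Θ.mem_ideal.2 hb, fun h0 => hb0 (LinearMap.ext fun v => (e.φ l).injective ?_)⟩
  rw [← action_apply, h0, LinearMap.zero_apply, LinearMap.zero_apply, map_zero]

lemma action_simple (l : Chars k A) (W : Submodule k (D'.V l))
    (hW : ∀ b ∈ Θ.ideal (R.ideal l), ∀ w ∈ W, Θ.action R e l b w ∈ W) : W = ⊥ ∨ W = ⊤ := by
  have h1 := R.simple l (W.comap (e.φ l).toLinearMap) fun b hb w hw => by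
    obtain ⟨b, rfl⟩ := (Θ.algEquiv l).surjective b
    rw [Submodule.mem_comap, LinearEquiv.coe_coe] at hw ⊢
    rw [← action_apply]
    exact hW b (Θ.mem_ideal.2 hb) _ hw
  have h2 : W = (W.comap (e.φ l).toLinearMap).map (e.φ l).toLinearMap :=
    (Submodule.map_comap_eq_of_surjective (e.φ l).surjective W).symm
  rcases h1 with h1 | h1
  · left; rw [h2, h1, Submodule.map_bot]
  · right
    rw [h2, h1, Submodule.map_top]
    exact LinearEquiv.range _

lemma exists_conj_eq (he : e.g = g) (h' : D'.K) :
    ∃ h : D.K, (h' : G) = e.g * h * e.g⁻¹ ∧ g⁻¹ * h' * g = h := by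
  refine ⟨⟨g⁻¹ * h' * g, ?_⟩, ?_, rfl⟩
  · rw [← e.mem, he]
    simp [mul_assoc]
  · simp [he, mul_assoc]

lemma action_conj (he : e.g = g) (l : Chars k A) (h' : D'.K) (b : B J' l)
    (hb : b ∈ Θ.ideal (R.ideal l)) (v : D'.V l) :
    Θ.action R e l ((h' : G) • b) (D'.π l h' v) = D'.π l h' (Θ.action R e l b v) := by
  obtain ⟨h, hh, hh'⟩ := exists_conj_eq e he h'
  obtain ⟨v, rfl⟩ := (e.φ l).surjective v
  rw [e.comm l h h' hh, map_smul, action_apply, action_apply, e.comm l h h' hh, algEquiv_smul,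
    hh', R.conj l h _ (Θ.mem_ideal.1 hb)]

lemma iso_injective (l m : Chars k A) : Function.Injective (Θ.iso R e l m) :=
  (Θ.toEquiv m).symm.injective.comp ((R.iso_injective l m).comp (LinearEquiv.injective _))

lemma range_iso (l m : Chars k A) :
    LinearMap.range (Θ.iso R e l m) =
      blockBimodule J' (Θ.ideal (R.ideal l)) (Θ.ideal (R.ideal m)) := by
  ext f
  rw [mem_blockBimodule, ← R.iso_range]
  constructor
  · rintro ⟨t, rfl⟩
    obtain ⟨t, rfl⟩ := (TensorProduct.congr (e.φ l) (e.φ m).symm.dualMap).surjective t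
    exact ⟨t, (Θ.toEquiv_iso R e l m t).symm⟩
  · rintro ⟨t, ht⟩
    exact ⟨_, (Θ.toEquiv m).injective ((Θ.toEquiv_iso R e l m t).trans ht)⟩

lemma iso_mem (l m : Chars k A) (t : D'.V l ⊗[k] Module.Dual k (D'.V m)) :
    Θ.iso R e l m t ∈ (weightFun (m - l) : Submodule k (G → k)) := by
  have h1 : Θ.iso R e l m t ∈
      blockBimodule J' (Θ.ideal (R.ideal l)) (Θ.ideal (R.ideal m)) := by
    rw [← range_iso]
    exact ⟨t, rfl⟩
  refine Submodule.span_le.2 ?_ h1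
  rintro _ ⟨b, -, f, hf, b', -, rfl⟩
  have h2 := tw_mem J' m (tw_mem J' m (B.val_mem b) hf) (B.val_mem b')
  rwa [zero_add, add_zero] at h2

lemma iso_bimodule (l m : Chars k A) (b : B J' l) (b' : B J' m)
    (t : D'.V l ⊗[k] Module.Dual k (D'.V m)) :
    Θ.iso R e l m (TensorProduct.map (Θ.action R e l b) (Θ.action R e m b').dualMap t) =
      tw (J'.toFun m) (tw (J'.toFun m) (B.val b) (Θ.iso R e l m t)) (B.val b') := by
  apply (Θ.toEquiv m).injective
  rw [Θ.map_tw m 0 _ _ (B.val_mem b'), sub_zero, Θ.map_tw m (m - l) _ _ (Θ.iso_mem R e l m t),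
    sub_sub_cancel]
  obtain ⟨t, rfl⟩ := (TensorProduct.congr (e.φ l) (e.φ m).symm.dualMap).surjective t
  rw [congr_map_action, toEquiv_iso, toEquiv_iso, R.iso_bimodule, val_algEquiv, val_algEquiv]

lemma iso_equivariant (he : e.g = g) (l m : Chars k A) (h' : D'.K)
    (t : D'.V l ⊗[k] Module.Dual k (D'.V m)) :
    Θ.iso R e l m (tensorDual (D'.π l h') (D'.π m h') t) =
      shift (h' : G) (Θ.iso R e l m t) := by
  obtain ⟨h, hh, hh'⟩ := exists_conj_eq e he h'
  apply (Θ.toEquiv m).injective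
  obtain ⟨t, rfl⟩ := (TensorProduct.congr (e.φ l) (e.φ m).symm.dualMap).surjective t
  rw [congr_tensorDual e l m h h' hh, toEquiv_iso, Θ.map_shift, toEquiv_iso, hh',
    R.iso_equivariant]

/-- The ideals are pulled back along `Θ` and the modules pushed along `e`. The condition `e.g = g`
matches the conjugation of `K` by `e` with the conjugation of shifts by `Θ`. -/
lemma determines (Θ : Transport J' J g) (R : Realization J D) (e : D.Iso D') (he : e.g = g) : Determines J' D' :=
  ⟨{ ideal := fun l => Θ.ideal (R.ideal l)
     minimal := fun l => Θ.isAtom_ideal (R.minimal l)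
     corresponding := fun l m => Θ.blockBimodule_ne_bot (R.corresponding l m)
     stabilizer_eq := Θ.stabilizer_eq R e he
     ρ := Θ.action R e
     ideal_acts := Θ.action_ne_zero R e
     simple := Θ.action_simple R e
     conj := Θ.action_conj R e he
     iso := Θ.iso R e
     iso_injective := Θ.iso_injective R e
     iso_range := Θ.range_iso R e
     iso_bimodule := Θ.iso_bimodule R e
     iso_equivariant := Θ.iso_equivariant R e he }⟩

end Transport

/-! ### Gauge transformations -/

/-- Right translation of functions by an element of the group algebra. -/
def rightMul (x : GA k G) : (G → k) →ₗ[k] (G → k) where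
  toFun f g := linExt f (grp k g * x)
  map_add' f f' := by
    funext g
    rw [linExt_add]
    rfl
  map_smul' c f := by
    funext g
    rw [linExt_smul]
    rfl

lemma rightMul_apply (x : GA k G) (f : G → k) (g : G) :
    rightMul x f g = linExt f (grp k g * x) := rfl

lemma linExt_rightMul (x : GA k G) (f : G → k) (y : GA k G) :
    linExt (rightMul x f) y = linExt f (y * x) := by
  have h1 : linExt (rightMul x f) = linExt f ∘ₗ LinearMap.mulRight k x :=
    hom_ext_grp (by intro g; simp [rightMul_apply])
  rw [h1]
  rfl

lemma rightMul_rightMul (x y : GA k G) (f : G → k) :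
    rightMul x (rightMul y f) = rightMul (x * y) f := by
  funext g
  rw [rightMul_apply, linExt_rightMul, rightMul_apply, mul_assoc]

lemma rightMul_one (f : G → k) : rightMul 1 f = f := by
  funext g
  rw [rightMul_apply, mul_one, linExt_grp]

lemma linExt_one_apply (x : GA k G) : linExt (1 : G → k) x = Coalgebra.counit (R := k) x := by
  have h1 : linExt (1 : G → k) = Coalgebra.counit :=
    hom_ext_grp (by intro g; simp [counit_grp])
  rw [h1]

lemma rightMul_mem {x : GA k G} (hx : ∀ a : A, grp k (a : G) * x = x * grp k (a : G))
    {m : Chars k A} {f : G → k} (hf : f ∈ weightFun m) : rightMul x f ∈ weightFun m := by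
  intro g a
  rw [rightMul_apply, rightMul_apply, ← grp_mul, mul_assoc, hx, ← mul_assoc,
    linExt_mul_grp hf]

lemma rightMul_shift (x : GA k G) (h : G) (f : G → k) :
    rightMul x (shift h f) = shift h (rightMul x f) := by
  have h1 : linExt (shift h f) = linExt f ∘ₗ LinearMap.mulLeft k (grp k h⁻¹) :=
    hom_ext_grp (by intro g; simp [grp_mul, shift])
  funext g
  rw [rightMul_apply, h1, shift, rightMul_apply, LinearMap.comp_apply,
    LinearMap.mulLeft_apply, ← mul_assoc, grp_mul]

/-- Right translation of functions by a unit of the group algebra. -/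
def rightMulEquiv (t : (GA k G)ˣ) : (G → k) ≃ₗ[k] (G → k) :=
  LinearEquiv.ofLinearMap (rightMul t) (rightMul (t⁻¹ : (GA k G)ˣ))
    (LinearMap.ext fun f => by
      rw [LinearMap.comp_apply, rightMul_rightMul, Units.mul_inv, rightMul_one]
      rfl)
    (LinearMap.ext fun f => by
      rw [LinearMap.comp_apply, rightMul_rightMul, Units.inv_mul, rightMul_one]
      rfl)

lemma rightMulEquiv_apply (t : (GA k G)ˣ) (f : G → k) : rightMulEquiv t f = rightMul t f := rfl

lemma rightMulEquiv_mem_iff {t : (GA k G)ˣ}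
    (ht : ∀ a : A, grp k (a : G) * (t : GA k G) = t * grp k (a : G)) {m : Chars k A} {f : G → k} :
    rightMulEquiv t f ∈ (weightFun m : Submodule k (G → k)) ↔
      f ∈ (weightFun m : Submodule k (G → k)) := by
  have ht' : ∀ a : A, grp k (a : G) * ((t⁻¹ : (GA k G)ˣ) : GA k G) =
      ((t⁻¹ : (GA k G)ˣ) : GA k G) * grp k (a : G) := fun a =>
    (Commute.units_inv_right (show Commute (grp k (a : G)) (t : GA k G) from ht a))
  refine ⟨fun h => ?_, rightMul_mem ht⟩
  have h1 := rightMul_mem ht' h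
  rwa [rightMulEquiv_apply, rightMul_rightMul, Units.inv_mul, rightMul_one] at h1

lemma pair_mul_tmul (x y : GA k G) (f f' : G → k) (w : GA k G ⊗[k] GA k G) :
    pair f f' (w * (x ⊗ₜ[k] y)) = pair (rightMul x f) (rightMul y f') w := by
  induction w with
  | zero => simp
  | add a b ha hb => simp only [add_mul, map_add, ha, hb]
  | tmul a b => simp [linExt_rightMul]

lemma rightMul_charIdem_mul [Finite G] [CharZero k] {x : GA k G}
    (hx : ∀ a : A, grp k (a : G) * x = x * grp k (a : G)) {m n : Chars k A} {f : G → k}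
    (hf : f ∈ weightFun n) [Decidable (n = m)] :
    rightMul (charIdem m * x) f = if n = m then rightMul x f else 0 := by
  have h1 : charIdem m * x = x * charIdem m := by
    have := Fintype.ofFinite A
    simp only [charIdem, finsum_eq_sum_of_fintype, smul_mul_assoc, mul_smul_comm, Finset.sum_mul,
      Finset.mul_sum, hx]
  funext g
  rw [h1, rightMul_apply, ← mul_assoc, linExt_mul_charIdem hf]
  split_ifs <;> rfl

/-- Right translation by `t(λ)` is the transport. The factor `Δ(t(λ)⁻¹)` in `J'` is cancelled, and
`P_μ` selects the weight `n` of the second function, leaving `t(λ - n)` on the first and `t(λ)` on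
the second. -/
lemma nonempty_transport_of_gaugeEquivalent [Finite G] [CharZero k] {J J' : DynamicalTwist k A}
    (h : GaugeEquivalent J J') : Nonempty (Transport J' J 1) := by
  classical
  have := Fintype.ofFinite (Chars k A)
  obtain ⟨t, ht, hc, hJ⟩ := h
  refine ⟨{
    toEquiv := fun l => rightMulEquiv (t l)
    mem_iff := fun l n f => rightMulEquiv_mem_iff (ht l)
    map_one := fun l => ?_
    map_shift := fun l h f => ?_
    map_tw := fun l n f f' hf' => ?_ }⟩
  · funext g
    rw [rightMulEquiv_apply, rightMul_apply, linExt_one_apply, Bialgebra.counit_mul, hc,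
      counit_grp, one_mul]
    rfl
  · rw [rightMulEquiv_apply, rightMulEquiv_apply, rightMul_shift, inv_one, one_mul, mul_one]
  · funext g
    have h1 : Coalgebra.comul (R := k) (t l : GA k G) *
        Coalgebra.comul (R := k) (((t l)⁻¹ : (GA k G)ˣ) : GA k G) = 1 := by
      rw [← Bialgebra.comul_mul, Units.mul_inv, Bialgebra.comul_one]
    rw [rightMulEquiv_apply, rightMul_apply, linExt_tw, hJ, Bialgebra.comul_mul, comul_grp,
      mul_assoc (grp k g ⊗ₜ[k] grp k g), ← mul_assoc (Coalgebra.comul (R := k) (t l : GA k G)),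
      ← mul_assoc (Coalgebra.comul (R := k) (t l : GA k G)), h1, one_mul, ← mul_assoc,
      finsum_eq_sum_of_fintype, Finset.mul_sum, map_sum]
    simp only [pair_mul_tmul, rightMul_charIdem_mul (ht l) hf']
    rw [Finset.sum_eq_single n]
    · rw [if_pos rfl]
      rfl
    · intro m _ hm
      rw [if_neg hm.symm]
      have h2 := pair_smul_right (0 : k) (rightMul (t (l - m) : GA k G) f) 0
      rw [zero_smul, zero_smul] at h2
      rw [h2, LinearMap.zero_apply]
    · exact fun hn => (hn (Finset.mem_univ _)).elim

/-- Translation by `g⁻¹` as a transport of a twist to itself. -/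
def shiftTransport [Finite G] [CharZero k] (J : DynamicalTwist k A) (g : G) : Transport J J g where
  toEquiv _ := LinearEquiv.ofLinearMap (CatAlg.shiftLin g⁻¹) (CatAlg.shiftLin g)
    (LinearMap.ext fun f => by
      rw [LinearMap.comp_apply, CatAlg.shiftLin_apply, CatAlg.shiftLin_apply, shift_shift,
        inv_mul_cancel, shift_one]
      rfl)
    (LinearMap.ext fun f => by
      rw [LinearMap.comp_apply, CatAlg.shiftLin_apply, CatAlg.shiftLin_apply, shift_shift,
        mul_inv_cancel, shift_one]
      rfl)
  mem_iff l n f := by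
    change shift g⁻¹ f ∈ _ ↔ _
    refine ⟨fun h => ?_, fun h => shift_mem h _⟩
    have h1 := shift_mem h g
    rwa [shift_shift, mul_inv_cancel, shift_one] at h1
  map_one l := rfl
  map_shift l h f := by
    change shift g⁻¹ (shift h f) = shift (g⁻¹ * h * g) (shift g⁻¹ f)
    rw [shift_shift, shift_shift, mul_inv_cancel_right]
  map_tw l n f f' _ := by
    change shift g⁻¹ (tw (J.toFun l) f f') = tw (J.toFun l) (shift g⁻¹ f) (shift g⁻¹ f')
    rw [tw_shift]

/-! ### The defined data form one isomorphism class, invariant under gauge equivalence -/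

variable [Finite G] [CharZero k]

/-- The conjugating element of the isomorphism is absorbed by translating functions by its inverse.
-/
lemma Determines.congr {J : DynamicalTwist k A} {D D' : DynamicalDatum k A} (h : Determines J D)
    (hD : D ≈ D') : Determines J D' := by
  obtain ⟨R⟩ := h
  obtain ⟨e⟩ := hD
  exact (shiftTransport J e.g).determines R e rfl

lemma Determines.gauge {J J' : DynamicalTwist k A} {D : DynamicalDatum k A} (h : Determines J D)
    (hJ : GaugeEquivalent J J') : Determines J' D := by
  obtain ⟨R⟩ := h
  obtain ⟨Θ⟩ := nonempty_transport_of_gaugeEquivalent hJ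
  let e : D.Iso D :=
    { g := 1
      map_conj := by
        ext x
        simp
      φ := fun l => LinearEquiv.refl k _
      α := fun _ => 1
      comm := by
        intro l h h' hh v
        obtain rfl : h' = h := Subtype.ext (by simpa using hh)
        simp }
  exact Θ.determines R e rfl

variable [IsAlgClosed k] {J : DynamicalTwist k A}

/-- Each minimal ideal comes from some block of the category algebra; nonvanishing of the bimodules
between them forces these blocks to coincide. -/
lemma Realization.exists_ideal_eq {D : DynamicalDatum k A} (R : Realization J D) :
    ∃ (ε : CatAlg J) (h : IsPrimCentral ε), ∀ l, R.ideal l = blockIdeal h l := by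
  choose ε h hI using fun l => exists_blockIdeal_eq (R.minimal l)
  refine ⟨ε 0, h 0, fun l => ?_⟩
  have h1 := R.corresponding l 0
  rw [hI l, hI 0] at h1
  have h2 := eq_of_blockBimodule_ne_bot (h l) (h 0) h1
  rw [hI l]
  congr

/-- The block underlying a realization is a translate of `ε`, by transitivity of `G` on blocks. -/
lemma Determines.exists_block {D : DynamicalDatum k A} (hD : Determines J D) {ε : CatAlg J}
    (T : BlockRep k ε) (h : IsPrimCentral ε) : blockDatum T h ≈ D := by
  have := Fintype.ofFinite G
  obtain ⟨R⟩ := hD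
  obtain ⟨ε', h', hR⟩ := R.exists_ideal_eq
  obtain ⟨g, rfl⟩ := (CatAlg.isConnectedSystem J).exists_smul_eq h h'
  exact R.nonempty_iso T h g hR

variable (J) in
lemma exists_blockRep : ∃ (ε : CatAlg J) (_ : IsPrimCentral ε), Nonempty (BlockRep k ε) := by
  have h0 : CatAlg.idem J 0 ≠ 0 := by
    intro h1
    have h2 : (1 : B J 0) = 0 := CatAlg.incl_injective 0 (h1.trans (map_zero _).symm)
    have h3 := congrFun (congrArg B.val h2) 1
    rw [map_zero, B.val_one] at h3
    exact one_ne_zero h3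
  obtain ⟨ε, h, -, hT⟩ := exists_blockRep_of_ne_zero (k := k) h0
  exact ⟨ε, h, hT⟩

lemma Determines.equiv {D D' : DynamicalDatum k A} (hD : Determines J D)
    (hD' : Determines J D') : D ≈ D' := by
  obtain ⟨ε, h, ⟨T⟩⟩ := exists_blockRep J
  exact Setoid.trans (Setoid.symm (hD.exists_block T h)) (hD'.exists_block T h)

variable (J) in
lemma exists_determines : ∃ D, Determines J D := by
  obtain ⟨ε, h, ⟨T⟩⟩ := exists_blockRep J
  exact ⟨_, ⟨blockRealization T h⟩⟩

lemma exists_realization_of_isAtom {l : Chars k A} {I : TwoSidedIdeal (B J l)} (hI : IsAtom I) :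
    ∃ (D : DynamicalDatum k A) (R : Realization J D), R.ideal l = I := by
  obtain ⟨ε, h, rfl⟩ := exists_blockIdeal_eq hI
  obtain ⟨T⟩ := h.nonempty_blockRep (k := k)
  exact ⟨_, blockRealization T h, rfl⟩

end DynTwist

end

theorem theorem5p4 {k : Type*} [Field k] [IsAlgClosed k] [CharZero k]
    {G : Type*} [Group G] [Finite G] (A : Subgroup G) (hA : IsMulCommutative A) :
    (∀ (J : DynTwist.DynamicalTwist k A) (l : DynTwist.Chars k A),
      IsSemisimpleRing (DynTwist.B J l)) ∧
    (∀ (J : DynTwist.DynamicalTwist k A) (l : DynTwist.Chars k A)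
      (I : TwoSidedIdeal (DynTwist.B J l)), IsAtom I →
      ∃ (D : DynTwist.DynamicalDatum k A) (R : DynTwist.Realization J D), R.ideal l = I) ∧
    ∃ C : DynTwist.DynamicalTwist k A → DynTwist.DynamicalDatum.IsoClass k A,
      (∀ J D, DynTwist.Determines J D ↔ Quotient.mk _ D = C J) ∧
      ∀ J J', DynTwist.GaugeEquivalent J J' → C J = C J' := by
  refine ⟨fun J l => inferInstance, fun J l I => DynTwist.exists_realization_of_isAtom, ?_⟩
  choose D hD using fun J => DynTwist.exists_determines (k := k) (A := A) J
  -- The class of any chosen datum works: uniqueness gives one direction, stability under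
  -- isomorphism the other, and a gauge equivalence makes the datum chosen for `J` also one for
  -- `J'`.
  refine ⟨fun J => Quotient.mk _ (D J), fun J D' => ⟨fun h => ?_, fun h => ?_⟩, fun J J' h => ?_⟩
  · exact Quotient.sound (h.equiv (hD J))
  · exact (hD J).congr (Setoid.symm (Quotient.exact h))
  · exact Quotient.sound (((hD J).gauge h).equiv (hD J'))
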